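/- An \emph{entropic functional} $S$ assigns a real number $S(P)$ to every finite probability vector $P=(p_1,\dots,p_n)$, $n\ge 1$, and does not depend on the order of the entries; $S(A)$ denotes the value of $S$ at the law of a finite random variable $A$, and $S(A,B)$ its value at the joint law. For a function $f:[0,\infty)\to\mathbb R$ that is injective, put $x\otimes_f y=f\big(f^{-1}(x)f^{-1}(y)\big)$ for $x,y\in f([0,\infty))$. A non-constant entropic functional $S$ with values in $f([0,\infty))$ satisfies the \emph{Kolmogorov--Nagumo generalized Shannon--Khinchin axioms} with respect to $f$ if - **SK1** (continuity) $S$ is continuous on the simplex of probability vectors of each length $n$; - **SK2** (maximality) $S(P)\le S(1/n,\dots,1/n)$ for every $P$ of length $n$; - **SK3** (expandability) $S(p_1,\dots,p_n,0)=S(p_1,\dots,p_n)$; - **SK4** (composability) there is a conditional entropy $S(A|B)\in f([0,\infty))$, a function of the joint law of $(A,B)$, with $S(A,B)=S(A|B)\otimes_f S(B)$ for all $A,B$, such that I) $S(A,B)=S(A)\otimes_f S(B)$ whenever $A$ and $B$ are independent; II) for some function $G$ one has $S(A|B)=G\big(P_B,\{S(A|B=b)\}_{b}\big)$ for all $A,B$,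 where $P_B$ is the law of $B$ and $b$ runs over the outcomes of $B$ of positive probability. For $0<q\le\infty$ and $g:[0,\infty)\to\mathbb R$ let $$S_q^g(P)=g\Big[\Big(\sum_i p_i^q\Big)^{1/(1-q)}\Big],$$ where for $q=1$ and $q=\infty$ the argument of $g$ is understood as its limit, $\exp(-\sum_i p_i\log p_i)$ and $1/\max_i p_i$ respectively. **Theorem.** (a) If $S$ satisfies SK1--SK4 with respect to some injective $f:[0,\infty)\to\mathbb R$, then $S=S_q^g$ for some $q\in(0,\infty]$ and some continuous, strictly increasing $g:[0,\infty)\to\mathbb R$, and $x\otimes_g y=x\otimes_f y$ for all values $x,y$ of $S$. (b) Conversely, if $q\in(0,\infty]$ and $g:[0,\infty)\to\mathbb R$ is strictly increasing, and continuous on $[1,\infty)$, then $S_q^g$ satisfies SK1--SK4 with respect to $g$. (c) For $q\in(0,\infty]$ and $g$ strictly increasing on $[0,\infty)$, one has $q<\infty$ if and only if $S_q^g$ is strictly decomposable: if the law of $B$ is kept, no $S(A|B=b)$ is lowered and at least one of them is raised, then $S(A,B)$ strictly increases. Thus the strictly decomposable solutions of SK1--SK4 are exactly the members of the Uffink class $\{S_q^g:0<q<\infty\}$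 ($g$ strictly increasing on $[0,\infty)$ and continuous on $[1,\infty)$). (d) For $0<q<\infty$ and any $g:[0,\infty)\to\mathbb R$, $S_q^g(P)=g\big[\exp_q\big(\sum_i p_i\log_q(1/p_i)\big)\big]$, where terms with $p_i=0$ are $0$, $\log_q x=\frac{x^{1-q}-1}{1-q}$, $\exp_q x=[1+(1-q)x]^{1/(1-q)}$, and $\log_1=\log$, $\exp_1=\exp$. -/

import Mathlib

open Set
open scoped ENNReal

noncomputable section

/-- The marginal law of `B` when `(A, B)` has joint law `R`. -/
def margB {n m : ℕ} (R : stdSimplex ℝ (Fin n × Fin m)) : stdSimplex ℝ (Fin m) :=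
  stdSimplex.map Prod.snd R

/-- The marginal law of `A` when `(A, B)` has joint law `R`. -/
def margA {n m : ℕ} (R : stdSimplex ℝ (Fin n × Fin m)) : stdSimplex ℝ (Fin n) :=
  stdSimplex.map Prod.fst R

theorem margB_apply {n m : ℕ} (R : stdSimplex ℝ (Fin n × Fin m)) (j : Fin m) :
    margB R j = ∑ i, R (i, j) := by
  classical
  have h : margB R j = ∑ x : Fin n × Fin m with x.2 = j, R x := by
    simp [margB, FunOnFinite.linearMap_apply_apply]
  rw [h, Finset.sum_filter, Fintype.sum_prod_type]
  simp

/-- The conditional law of `A` given `B = j`, for an outcome `j` of positive probability. -/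
def condLaw {n m : ℕ} (R : stdSimplex ℝ (Fin n × Fin m)) (j : Fin m) (hj : 0 < margB R j) :
    stdSimplex ℝ (Fin n) :=
  ⟨fun i => R (i, j) / margB R j, fun i => div_nonneg (stdSimplex.zero_le R (i, j)) hj.le, by
    rw [← Finset.sum_div, ← margB_apply, div_self hj.ne']⟩

/-- `A` and `B` are independent under the joint law `R`. -/
def IndepLaw {n m : ℕ} (R : stdSimplex ℝ (Fin n × Fin m)) : Prop :=
  ∀ i j, R (i, j) = margA R i * margB R j

/-- An entropic functional: a real number for every probability vector of every finite length. -/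
abbrev EntropicFunctional : Type :=
  ∀ n : ℕ, stdSimplex ℝ (Fin n) → ℝ

/-- `S(A, B)`: the entropy of the joint law, read as a probability vector of length `n * m`. -/
def EntropicFunctional.joint (S : EntropicFunctional) {n m : ℕ}
    (R : stdSimplex ℝ (Fin n × Fin m)) : ℝ :=
  S (n * m) (stdSimplex.map finProdFinEquiv R)

/-- The generalized product `x ⊗_f y = f (f⁻¹ x * f⁻¹ y)`, where `f` is regarded as a bijection
from `[0, ∞)` onto its image. -/
def knMul (f : ℝ → ℝ) (x y : ℝ) : ℝ :=
  f (Function.invFunOn f (Ici 0) x * Function.invFunOn f (Ici 0) y)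

/-- Composability of `S` with respect to `f`: there is a conditional entropy `C R = S(A|B)` with
`S(A, B) = S(A|B) ⊗_f S(B)`, satisfying the two consistency requirements. All entropies lie in
the image `f [0, ∞)`, where the product is meaningful. -/
def Composable (f : ℝ → ℝ) (S : EntropicFunctional) : Prop :=
  (∀ (n : ℕ) (P : stdSimplex ℝ (Fin n)), S n P ∈ f '' Ici 0) ∧
  ∃ C : ∀ n m : ℕ, stdSimplex ℝ (Fin n × Fin m) → ℝ,
    (∀ (n m : ℕ) (R : stdSimplex ℝ (Fin n × Fin m)), C n m R ∈ f '' Ici 0) ∧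
    (∀ (n m : ℕ) (R : stdSimplex ℝ (Fin n × Fin m)),
      S.joint R = knMul f (C n m R) (S m (margB R))) ∧
    -- composability for independent variables
    (∀ (n m : ℕ) (R : stdSimplex ℝ (Fin n × Fin m)), IndepLaw R →
      S.joint R = knMul f (S n (margA R)) (S m (margB R))) ∧
    -- decomposability into the entropies of the conditional laws
    ∃ G : ∀ (m : ℕ) (Q : stdSimplex ℝ (Fin m)), ({j : Fin m // 0 < Q j} → ℝ) → ℝ,
      ∀ (n m : ℕ) (R : stdSimplex ℝ (Fin n × Fin m)),
        C n m R = G m (margB R) (fun j => S n (condLaw R j.1 j.2))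

/-- The Kolmogorov–Nagumo generalized Shannon–Khinchin axioms for `S`, with generalized product
`⊗_f`. -/
structure ShannonKhinchin (f : ℝ → ℝ) (S : EntropicFunctional) : Prop where
  /-- `f` is invertible on `[0, ∞)`. -/
  injOn : InjOn f (Ici 0)
  /-- The entropy does not depend on the labelling of the outcomes. -/
  symmetric : ∀ (n : ℕ) (σ : Equiv.Perm (Fin n)) (P : stdSimplex ℝ (Fin n)),
    S n (stdSimplex.map σ P) = S n P
  /-- Not all entropies are equal. -/
  nonconstant : ∃ (n m : ℕ) (P : stdSimplex ℝ (Fin n)) (Q : stdSimplex ℝ (Fin m)),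
    S n P ≠ S m Q
  /-- Continuity. -/
  continuous : ∀ n : ℕ, Continuous (S n)
  /-- Maximality at the uniform distribution. -/
  maximal : ∀ (n : ℕ) (P U : stdSimplex ℝ (Fin n)), (∀ i, U i = 1 / (n : ℝ)) → S n P ≤ S n U
  /-- Expandability: `S (p₁, …, pₙ, 0) = S (p₁, …, pₙ)`. -/
  expandable : ∀ (n : ℕ) (P : stdSimplex ℝ (Fin n)) (P' : stdSimplex ℝ (Fin (n + 1))),
    (∀ i : Fin n, P' i.castSucc = P i) → P' (Fin.last n) = 0 → S (n + 1) P' = S n P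
  /-- Composability. -/
  composable : Composable f S

/-- `(∑ pᵢ ^ q) ^ (1 / (1 - q))`, with the limiting values `exp (-∑ pᵢ log pᵢ)` at `q = 1` and
`1 / max pᵢ` at `q = ∞`. -/
def uffink (q : ℝ≥0∞) {n : ℕ} (P : stdSimplex ℝ (Fin n)) : ℝ :=
  if q = ∞ then 1 / (⨆ i, P i)
  else if q = 1 then Real.exp (-∑ i, P i * Real.log (P i))
  else (∑ i, P i ^ q.toReal) ^ (1 / (1 - q.toReal))

/-- The functional `S_q^f(P) = f ((∑ pᵢ ^ q) ^ (1 / (1 - q)))`. -/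
def uffinkEntropy (q : ℝ≥0∞) (f : ℝ → ℝ) : EntropicFunctional :=
  fun _ P => f (uffink q P)

/-- The `q`-logarithm. -/
def logq (q x : ℝ) : ℝ :=
  if q = 1 then Real.log x else (x ^ (1 - q) - 1) / (1 - q)

/-- The `q`-exponential. -/
def expq (q x : ℝ) : ℝ :=
  if q = 1 then Real.exp x else (1 + (1 - q) * x) ^ (1 / (1 - q))

/-- Strict decomposability: raising conditional entropies `S(A|B=j)`, at least one of them
strictly, while keeping the law of `B`, strictly raises the joint entropy. -/
def StrictlyDecomposable (S : EntropicFunctional) : Prop :=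
  ∀ (n m : ℕ) (R R' : stdSimplex ℝ (Fin n × Fin m)), margB R = margB R' →
    (∀ (j : Fin m) (h : 0 < margB R j) (h' : 0 < margB R' j),
      S n (condLaw R j h) ≤ S n (condLaw R' j h')) →
    (∃ (j : Fin m) (h : 0 < margB R j) (h' : 0 < margB R' j),
      S n (condLaw R j h) < S n (condLaw R' j h')) →
    S.joint R < S.joint R'

end

/-! The substance is part (a). It has two halves: finding a logarithmic scale for the values of `S`,
and determining how entropy behaves under mixtures on that scale.

Scale. As `f` is merely injective, its inverse may be discontinuous, so only its algebra is usable.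
The values of `S` form an interval closed under the generalized product, which is continuous in each
variable because product laws realise it. Once the coordinates under the inverse of `f` are known to
be positive (`coord_pos`), their logarithm embeds this operation into a commutative group, so it is
cancellative. A Hölder-type theorem (`IntervalMonoid.exists_orderHom`) then provides a strictly
increasing real function additive for the product. Maximality makes it monotone on uniform laws, and
normalisation makes it `log n` there; the result is a functional `ℓ` with `IsLogEntropy ℓ` that
orders laws exactly as `S` does.

Mixtures. By decomposability the entropy of a mixture of `P` and `Q`, with weights `t` and `1 - t`
on disjoint sets, depends only on `t`, `ℓ P` and `ℓ Q`. In the variables `y = log t - ℓ P` and `z =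
log (1 - t) - ℓ Q`, minus this entropy is a weighted mean `m t y z`: independent products make it
translation invariant, regrouping three components makes it associative, and uniform laws make it
idempotent (`IsLogEntropy.translationMean`). Each curve `t ↦ m t y z` respects the mean. If all
curves are constant, `m` is a semilattice operation, which the behaviour as `t → 0` forces to be the
maximum; this is `q = ∞`. Otherwise some increasing coordinate `k` turns `m` into affine
combinations. Translation invariance and uniqueness of normalised coordinates make `k` the identity
(`q = 1`) or an affine function of `exp (r x)` with `r = q - 1`, and the limit `t → 0` gives `r >
-1`. Adding one atom at a time (`law_induction`) identifies `exp ℓ` with `uff q`, so `S` is an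
increasing function `g` of `uff q`.

Parts (b) and (c) rest on the chain rule `uff_eq_combine`, which expresses `uff q` of a joint law
through the law of `B` and the conditional values. The expression is strictly increasing in the
latter for finite `q`, while for `q = ∞` a maximum ignores its smaller terms. Part (d) is termwise
algebra. -/

noncomputable section

open Filter Topology

/-! ### Translation invariant means: affinity of curves and the degenerate case -/

/-- A translation invariant family of commutative, associative, idempotent weighted means on the
real line, continuous in the weight and in the arguments. -/
structure TranslationMean (m : ℝ → ℝ → ℝ → ℝ) : Prop where
  trans : ∀ t ∈ Ioo (0 : ℝ) 1, ∀ y z c, m t (y + c) (z + c) = m t y z + c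
  comm : ∀ t ∈ Ioo (0 : ℝ) 1, ∀ y z, m t y z = m (1 - t) z y
  assoc : ∀ s ∈ Ioo (0 : ℝ) 1, ∀ t ∈ Ioo (0 : ℝ) 1, ∀ x y z,
    m s (m t x y) z = m (s * t) x (m (s * (1 - t) / (1 - s * t)) y z)
  idem : ∀ t ∈ Ioo (0 : ℝ) 1, ∀ y, m t y y = y
  cont_weight : ∀ y z, ContinuousOn (fun t => m t y z) (Ioo 0 1)
  cont_left : ∀ t ∈ Ioo (0 : ℝ) 1, Continuous fun y => m t y 0
  boundary : Tendsto (fun t => m t (Real.log t) (Real.log (1 - t))) (𝓝[>] 0) (𝓝 0)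

/-- The mean with unnormalised weights. -/
def wmean (m : ℝ → ℝ → ℝ → ℝ) (a b y z : ℝ) : ℝ := m (a / (a + b)) y z

namespace TranslationMean

variable {m : ℝ → ℝ → ℝ → ℝ}

theorem div_mem {a b : ℝ} (ha : 0 < a) (hb : 0 < b) : a / (a + b) ∈ Ioo (0 : ℝ) 1 :=
  ⟨by positivity, by rw [div_lt_one (by positivity)]; linarith⟩

theorem wmean_comm (h : TranslationMean m) {a b : ℝ} (ha : 0 < a) (hb : 0 < b) (y z : ℝ) :
    wmean m a b y z = wmean m b a z y := by
  unfold wmean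
  rw [h.comm _ (div_mem ha hb)]
  congr 1
  field_simp
  ring

theorem wmean_assoc (h : TranslationMean m) {a b c : ℝ} (ha : 0 < a) (hb : 0 < b) (hc : 0 < c)
    (x y z : ℝ) :
    wmean m (a + b) c (wmean m a b x y) z = wmean m a (b + c) x (wmean m b c y z) := by
  unfold wmean
  rw [h.assoc _ (div_mem (by positivity) hc) _ (div_mem ha hb)]
  have h1 : (a + b) / (a + b + c) * (a / (a + b)) = a / (a + (b + c)) := by
    field_simp; ring
  have h2 : (a + b) / (a + b + c) * (1 - a / (a + b)) / (1 - a / (a + (b + c))) = b / (b + c) := by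
    have e1 : 1 - a / (a + b) = b / (a + b) := by field_simp; ring
    have e2 : 1 - a / (a + (b + c)) = (b + c) / (a + (b + c)) := by field_simp; ring
    rw [e1, e2, ← add_assoc]
    field_simp
  rw [h1, h2]

/-- Associativity and commutativity allow the two middle terms to be exchanged. Applied to four
points of which two pairs coincide, it yields `affine`. -/
theorem wmean_interchange (h : TranslationMean m) {a b c d : ℝ} (ha : 0 < a) (hb : 0 < b)
    (hc : 0 < c) (hd : 0 < d) (x y z w : ℝ) :
    wmean m (a + b) (c + d) (wmean m a b x y) (wmean m c d z w) =
      wmean m (a + c) (b + d) (wmean m a c x z) (wmean m b d y w) := by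
  rw [h.wmean_assoc ha hb (by positivity), h.wmean_assoc ha hc (by positivity),
    ← h.wmean_assoc hb hc hd, ← h.wmean_assoc hc hb hd, h.wmean_comm hb hc, add_comm b c,
    show b + (c + d) = c + (b + d) by ring]

theorem wmean_eq {a b t : ℝ} (hab : a / (a + b) = t) (y z : ℝ) : wmean m a b y z = m t y z := by
  rw [wmean, hab]

/-- The curve `t ↦ m t y z` is affine with respect to the mean. -/
theorem affine (h : TranslationMean m) {s t t' : ℝ} (hs : s ∈ Ioo (0 : ℝ) 1)
    (ht : t ∈ Ioo (0 : ℝ) 1) (ht' : t' ∈ Ioo (0 : ℝ) 1) (y z : ℝ) :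
    m s (m t y z) (m t' y z) = m (s * t + (1 - s) * t') y z := by
  obtain ⟨hs0, hs1⟩ := hs
  obtain ⟨ht0, ht1⟩ := ht
  obtain ⟨ht0', ht1'⟩ := ht'
  have a1 : 0 < s * t := by positivity
  have a2 : 0 < s * (1 - t) := mul_pos hs0 (by linarith)
  have a3 : 0 < (1 - s) * t' := mul_pos (by linarith) ht0'
  have a4 : 0 < (1 - s) * (1 - t') := mul_pos (by linarith) (by linarith)
  have key := h.wmean_interchange a1 a2 a3 a4 y z y z
  have hs' : (1 - s) ≠ 0 := by linarith
  have w1 : s * t / (s * t + s * (1 - t)) = t := by field_simp; ring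
  have w2 : (1 - s) * t' / ((1 - s) * t' + (1 - s) * (1 - t')) = t' := by field_simp; ring
  have w3 : (s * t + s * (1 - t)) /
      (s * t + s * (1 - t) + ((1 - s) * t' + (1 - s) * (1 - t'))) = s := by
    rw [show s * t + s * (1 - t) + ((1 - s) * t' + (1 - s) * (1 - t')) = 1 by ring]
    ring
  rw [wmean_eq w1, wmean_eq w2, wmean_eq w3] at key
  rw [key, wmean, wmean, wmean, h.idem _ (div_mem a1 a3), h.idem _ (div_mem a2 a4)]
  congr 1
  rw [show s * t + (1 - s) * t' + (s * (1 - t) + (1 - s) * (1 - t')) = 1 by ring, div_one]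

/-- If the curve `t ↦ m t y z` is not injective then it is constant. -/
theorem eq_of_not_inj (h : TranslationMean m) {y z t t' : ℝ} (ht : t ∈ Ioo (0 : ℝ) 1)
    (ht' : t' ∈ Ioo (0 : ℝ) 1) (hlt : t < t') (he : m t y z = m t' y z) {a b : ℝ}
    (ha : a ∈ Ioo (0 : ℝ) 1) (hb : b ∈ Ioo (0 : ℝ) 1) : m a y z = m b y z := by
  wlog hab : a ≤ b generalizing a b
  · exact (this hb ha (le_of_not_ge hab)).symm
  refine (constant_of_has_deriv_right_zero (f := fun x => m x y z) (a := a) (b := b)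
    ((h.cont_weight y z).mono fun x hx => ⟨ha.1.trans_le hx.1, hx.2.trans_lt hb.2⟩) ?_ b
    ⟨hab, le_rfl⟩).symm
  intro p hp
  have hp0 : 0 < p := ha.1.trans_le hp.1
  have hp1 : p < 1 := hp.2.trans hb.2
  have hd : 0 < t' - t := sub_pos.2 hlt
  have key : ∀ᶠ x in 𝓝[≥] p, m x y z = m p y z := by
    -- With a common partner `τ = (p - s * t) / (1 - s)` and a common weight `s`, the parameter `t`
    -- leads to `p` and `t'` leads to `x`. The bounds on `s` keep `τ` inside the unit interval.
    set s₀ := min (min (p / 2) ((1 - p) / 2)) (1 / 2) with hs₀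
    have hs₀0 : 0 < s₀ := by
      simp only [hs₀, lt_min_iff]; refine ⟨⟨?_, ?_⟩, ?_⟩ <;> linarith
    have hmem : Ico p (p + s₀ * (t' - t)) ∈ 𝓝[≥] p :=
      Ico_mem_nhdsGE (by nlinarith)
    filter_upwards [hmem] with x hx
    rcases hx.1.eq_or_lt with rfl | hpx
    · rfl
    set s := (x - p) / (t' - t) with hs
    have hs0 : 0 < s := div_pos (by linarith) hd
    have hss : s < s₀ := by rw [hs, div_lt_iff₀ hd]; linarith [hx.2]
    have h1 : s < p / 2 := hss.trans_le ((min_le_left _ _).trans (min_le_left _ _))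
    have h2 : s < (1 - p) / 2 := hss.trans_le ((min_le_left _ _).trans (min_le_right _ _))
    have h3 : s < 1 / 2 := hss.trans_le (min_le_right _ _)
    have hτ : (p - s * t) / (1 - s) ∈ Ioo (0 : ℝ) 1 := by
      have : 0 < 1 - s := by linarith
      refine ⟨div_pos ?_ this, ?_⟩
      · nlinarith [ht.1, ht.2]
      · rw [div_lt_one this]; nlinarith [ht.1, ht.2]
    have e1 := h.affine (s := s) ⟨hs0, by linarith⟩ ht hτ y z
    have e2 := h.affine (s := s) ⟨hs0, by linarith⟩ ht' hτ y z
    have h1s : 1 - s ≠ 0 := by linarith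
    have e3 : (1 - s) * ((p - s * t) / (1 - s)) = p - s * t := by field_simp
    have e4 : s * (t' - t) = x - p := by rw [hs]; field_simp
    rw [e3, show s * t + (p - s * t) = p by ring] at e1
    rw [e3, show s * t' + (p - s * t) = x by linarith] at e2
    rw [← e1, ← e2, he]
  exact (hasDerivWithinAt_const p (Ici p) (m p y z)).congr_of_eventuallyEq key rfl

/-- The degenerate means are given by the maximum. -/
theorem eq_max (h : TranslationMean m)
    (hc : ∀ y z, ∀ a ∈ Ioo (0 : ℝ) 1, ∀ b ∈ Ioo (0 : ℝ) 1, m a y z = m b y z) :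
    ∀ t ∈ Ioo (0 : ℝ) 1, ∀ y z, m t y z = max y z := by
  have hh : (1 / 2 : ℝ) ∈ Ioo (0 : ℝ) 1 := by norm_num
  set j : ℝ → ℝ → ℝ := fun y z => m (1 / 2) y z with hj
  have hmj : ∀ t ∈ Ioo (0 : ℝ) 1, ∀ y z, m t y z = j y z := fun t ht y z => hc y z _ ht _ hh
  have jcomm : ∀ y z, j y z = j z y := fun y z => by
    rw [hj]; simp only; rw [h.comm _ hh]; norm_num
  have jassoc : ∀ x y z, j (j x y) z = j x (j y z) := fun x y z => by
    have := h.assoc _ hh _ hh x y z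
    rw [hmj (1 / 2 * (1 / 2)) (by norm_num), hmj (1 / 2 * (1 - 1 / 2) / (1 - 1 / 2 * (1 / 2)))
      (by norm_num)] at this
    exact this
  have jidem : ∀ y, j y y = y := fun y => h.idem _ hh y
  have jtrans : ∀ y z c, j (y + c) (z + c) = j y z + c := fun y z c => h.trans _ hh y z c
  have jcont : Continuous fun y => j y 0 := h.cont_left _ hh
  -- elements absorbing zero are nonnegative
  have hD : ∀ d, j d 0 = d → 0 ≤ d := by
    intro d hd
    by_contra hneg
    push Not at hneg
    have hn : ∀ n : ℕ, j (n * d) 0 = n * d := by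
      intro n
      induction n with
      | zero => simpa using jidem 0
      | succ n ih =>
        have e : j (((n + 1 : ℕ) : ℝ) * d) d = ((n + 1 : ℕ) : ℝ) * d := by
          have := jtrans (n * d) 0 d
          rw [ih, zero_add] at this
          push_cast
          rw [show ((n : ℝ) + 1) * d = n * d + d by ring, this]
        calc j (((n + 1 : ℕ) : ℝ) * d) 0 = j (j (((n + 1 : ℕ) : ℝ) * d) d) 0 := by rw [e]
          _ = j (((n + 1 : ℕ) : ℝ) * d) (j d 0) := jassoc _ _ _
          _ = _ := by rw [hd, e]
    -- Let the log-odds of the weight be `n * d`, which tends to `-∞`. The boundary condition makes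
    -- the value tend to `0`, whereas `hn` says that it equals `n * d`.
    have hb := h.boundary
    have hlog : Tendsto (fun t : ℝ => Real.log (1 - t)) (𝓝[>] 0) (𝓝 0) := by
      have : ContinuousAt (fun t : ℝ => Real.log (1 - t)) 0 := by
        apply ContinuousAt.log
        · fun_prop
        · norm_num
      have := this.tendsto
      simp only [sub_zero, Real.log_one] at this
      exact this.mono_left nhdsWithin_le_nhds
    have hb' : Tendsto (fun t : ℝ => j (Real.log t - Real.log (1 - t)) 0) (𝓝[>] 0) (𝓝 0) := by
      have := hb.sub hlog
      rw [sub_zero] at this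
      refine this.congr' ?_
      filter_upwards [Ioo_mem_nhdsGT (zero_lt_one' ℝ)] with t ht
      rw [hmj t ht, sub_eq_iff_eq_add, ← jtrans]
      simp
    set u : ℕ → ℝ := fun n => 1 / (1 + Real.exp (-(n * d))) with hu
    have hexp : Tendsto (fun n : ℕ => Real.exp (-(n * d))) atTop atTop := by
      refine Real.tendsto_exp_atTop.comp ?_
      have : Tendsto (fun n : ℕ => (n : ℝ) * (-d)) atTop atTop :=
        tendsto_natCast_atTop_atTop.atTop_mul_const (by linarith)
      exact this.congr fun n => by ring
    have hu0 : Tendsto u atTop (𝓝[>] 0) := by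
      rw [tendsto_nhdsWithin_iff]
      refine ⟨?_, Eventually.of_forall fun n => by simp only [hu, mem_Ioi]; positivity⟩
      have : Tendsto (fun n : ℕ => 1 + Real.exp (-(n * d))) atTop atTop :=
        tendsto_atTop_add_const_left _ _ hexp
      simp only [hu, one_div]
      exact this.inv_tendsto_atTop
    have h2 := hb'.comp hu0
    have h3 : Tendsto (fun n : ℕ => (n : ℝ) * d) atTop (𝓝 0) := by
      refine h2.congr fun n => ?_
      have e1 : Real.log (u n) - Real.log (1 - u n) = n * d := by
        have hpos : 0 < Real.exp (-(n * d)) := Real.exp_pos _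
        have : 1 - u n = Real.exp (-(n * d)) / (1 + Real.exp (-(n * d))) := by
          simp only [hu]; field_simp; ring
        rw [this, Real.log_div hpos.ne' (by positivity)]
        simp only [hu]
        rw [Real.log_div one_ne_zero (by positivity), Real.log_exp, Real.log_one]
        ring
      simp only [Function.comp]
      rw [e1, hn]
    have h4 : Tendsto (fun n : ℕ => (n : ℝ) * (-d)) atTop atTop :=
      tendsto_natCast_atTop_atTop.atTop_mul_const (by linarith)
    have h5 : Tendsto (fun n : ℕ => (n : ℝ) * (-d)) atTop (𝓝 0) := by
      simpa using h3.neg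
    exact not_tendsto_nhds_of_tendsto_atTop h4 0 h5
  have jj : ∀ d, j (j d 0) 0 = j d 0 := fun d => by rw [jassoc, jidem]
  have hge0 : ∀ d, 0 ≤ j d 0 := fun d => hD _ (jj d)
  -- The element `j d 0` absorbs `d` too, so its translate `j d 0 - d` absorbs zero and `hD`
  -- applies.
  have hge : ∀ d, d ≤ j d 0 := fun d => by
    have e : j (j d 0) d = j d 0 := by rw [jcomm, ← jassoc, jidem]
    have := jtrans (j d 0) d (-d)
    rw [e, add_neg_cancel] at this
    linarith [hD _ this]
  have hpos : ∀ d, 0 ≤ d → j d 0 = d := by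
    intro d hd
    obtain ⟨d', -, hd'⟩ := intermediate_value_Icc hd jcont.continuousOn
      (show d ∈ Icc (j 0 0) (j d 0) from ⟨by rw [jidem]; exact hd, hge d⟩)
    simp only at hd'
    rw [← hd', jj]
  intro t ht y z
  rw [hmj t ht]
  rcases le_total z y with hyz | hyz
  · have := jtrans (y - z) 0 z
    rw [sub_add_cancel, zero_add, hpos _ (by linarith)] at this
    rw [this, max_eq_left hyz, sub_add_cancel]
  · have := jtrans (z - y) 0 y
    rw [sub_add_cancel, zero_add, hpos _ (by linarith)] at this
    rw [jcomm, this, max_eq_right hyz, sub_add_cancel]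

end TranslationMean

/-! ### Monotone additive functions -/

theorem eq_zero_of_forall_nat_mul_le {g C : ℝ} (h : ∀ n : ℕ, |n * g| ≤ C) : g = 0 := by
  by_contra hg
  obtain ⟨n, hn⟩ := exists_nat_gt (C / |g|)
  have := h n
  rw [abs_mul, Nat.abs_cast] at this
  rw [div_lt_iff₀ (abs_pos.2 hg)] at hn
  linarith

theorem additive_nat_mul {f : ℝ → ℝ} (hadd : ∀ x y, f (x + y) = f x + f y) (n : ℕ) (x : ℝ) :
    f (n * x) = n * f x :=
  by simpa using map_nsmul (AddMonoidHom.mk' f hadd) n x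

/-- A monotone additive function is linear. -/
theorem Monotone.eq_mul_of_additive {f : ℝ → ℝ} (hf : Monotone f)
    (hadd : ∀ x y, f (x + y) = f x + f y) (x : ℝ) : f x = f 1 * x := by
  have hint : ∀ k : ℤ, f k = f 1 * k := fun k => by
    have := map_zsmul (AddMonoidHom.mk' f hadd) k 1
    simpa [mul_comm] using this
  have hbd : ∀ n : ℕ, |n * (f x - f 1 * x)| ≤ f 1 := by
    intro n
    have h1 := hf (Int.floor_le (n * x))
    have h2 := hf (Int.lt_floor_add_one (n * x)).le
    have h0 : 0 ≤ f 1 := by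
      have := hf (zero_le_one' ℝ)
      have h00 := hadd 0 0
      rw [add_zero] at h00
      linarith
    rw [hadd, hint, additive_nat_mul hadd] at h2
    rw [hint, additive_nat_mul hadd] at h1
    have h3 := mul_le_mul_of_nonneg_left (Int.floor_le (n * x)) h0
    have h4 := mul_le_mul_of_nonneg_left (Int.lt_floor_add_one (n * x)).le h0
    rw [abs_le]
    constructor <;> nlinarith
  linarith [eq_zero_of_forall_nat_mul_le hbd]

/-! ### Affine coordinates and classification of the nondegenerate means -/

namespace TranslationMean

variable {m : ℝ → ℝ → ℝ → ℝ}

/-- If some curve `t ↦ m t y z` is not constant, then every segment from `x` to `y` can be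
prolonged beyond `y`. -/
theorem exists_prolong (h : TranslationMean m)
    (hnc : ∃ y z, ∃ a ∈ Ioo (0 : ℝ) 1, ∃ b ∈ Ioo (0 : ℝ) 1, m a y z ≠ m b y z) (x y : ℝ) :
    ∃ t ∈ Ioo (0 : ℝ) 1, ∃ z, m t x z = y := by
  set N : ℝ → Prop := fun d => ∃ t ∈ Ioo (0 : ℝ) 1, ∃ z, m t 0 z = d with hN
  -- The second prolongation is translated so as to start where the first one ends; associativity
  -- merges the two.
  have hadd : ∀ d d', N d → N d' → N (d + d') := by
    rintro d d' ⟨t, ht, z, rfl⟩ ⟨s, hs, z', rfl⟩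
    refine ⟨s * t, ⟨mul_pos hs.1 ht.1, by nlinarith [hs.1, hs.2, ht.1, ht.2]⟩,
      m (s * (1 - t) / (1 - s * t)) z (z' + m t 0 z), ?_⟩
    rw [← h.assoc s hs t ht, add_comm (m t 0 z) (m s 0 z'), ← h.trans s hs, zero_add]
  obtain ⟨y₀, z₀, a, ha, b, hb, hab⟩ := hnc
  wlog hlt : a < b generalizing a b
  · exact this b hb a ha hab.symm (lt_of_le_of_ne (le_of_not_gt hlt) fun e => hab (e ▸ rfl))
  -- On the given curve, the step from `t'` to `t` is prolonged to a parameter `τ` beyond `t`,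
  -- halfway to the end of the unit interval.
  have hV : ∀ t ∈ Ioo (0 : ℝ) 1, ∀ t' ∈ Ioo (0 : ℝ) 1, t ≠ t' → N (m t y₀ z₀ - m t' y₀ z₀) := by
    intro t ht t' ht' hne
    have key : ∀ τ ∈ Ioo (0 : ℝ) 1, (τ - t) / (τ - t') ∈ Ioo (0 : ℝ) 1 →
        N (m t y₀ z₀ - m t' y₀ z₀) := by
      intro τ hτ hs
      have hd : τ - t' ≠ 0 := fun e => by rw [e, div_zero] at hs; exact lt_irrefl _ hs.1
      refine ⟨_, hs, m τ y₀ z₀ - m t' y₀ z₀, ?_⟩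
      have e := h.affine hs ht' hτ y₀ z₀
      have e2 := h.trans _ hs (m t' y₀ z₀) (m τ y₀ z₀) (-m t' y₀ z₀)
      rw [e, add_neg_cancel, ← sub_eq_add_neg, ← sub_eq_add_neg] at e2
      rw [e2]
      congr 2
      field_simp
      ring
    rcases lt_or_gt_of_ne hne with hlt | hlt
    · refine key (t / 2) ⟨by linarith [ht.1], by linarith [ht.2]⟩ ?_
      rw [← neg_div_neg_eq]
      have : 0 < -(t / 2 - t') := by linarith [ht.1]
      exact ⟨div_pos (by linarith [ht.1]) this, by rw [div_lt_one this]; linarith⟩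
    · refine key ((1 + t) / 2) ⟨by linarith [ht.1], by linarith [ht.2]⟩ ?_
      have : 0 < (1 + t) / 2 - t' := by linarith [ht.2]
      exact ⟨div_pos (by linarith [ht.2]) this, by rw [div_lt_one this]; linarith⟩
  have hN0 : N 0 := ⟨1 / 2, by norm_num, 0, h.idem _ (by norm_num) _⟩
  set lo := min (m a y₀ z₀) (m b y₀ z₀)
  set hi := max (m a y₀ z₀) (m b y₀ z₀)
  have hlohi : lo < hi := min_lt_max.2 hab
  have hsmall : ∀ d ∈ Icc 0 (hi - lo), N d ∧ N (-d) := by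
    intro d hd
    rcases hd.1.eq_or_lt with rfl | hd0
    · exact ⟨hN0, by rwa [neg_zero]⟩
    have hivt : Icc lo hi ⊆ (fun t => m t y₀ z₀) '' Icc a b := by
      have := intermediate_value_uIcc (a := a) (b := b) (f := fun t => m t y₀ z₀)
        ((h.cont_weight y₀ z₀).mono fun t ht => by
          rw [uIcc_of_le hlt.le] at ht
          exact ⟨ha.1.trans_le ht.1, ht.2.trans_lt hb.2⟩)
      rwa [uIcc_of_le hlt.le] at this
    obtain ⟨t, ht, ht2⟩ := hivt (show lo ∈ Icc lo hi from ⟨le_rfl, hlohi.le⟩)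
    obtain ⟨t', ht', ht2'⟩ := hivt (show lo + d ∈ Icc lo hi from
      ⟨by linarith, by linarith [hd.2]⟩)
    simp only at ht2 ht2'
    have m1 : t ∈ Ioo (0 : ℝ) 1 := ⟨ha.1.trans_le ht.1, ht.2.trans_lt hb.2⟩
    have m2 : t' ∈ Ioo (0 : ℝ) 1 := ⟨ha.1.trans_le ht'.1, ht'.2.trans_lt hb.2⟩
    have hne : t ≠ t' := by rintro rfl; linarith
    have h1 := hV t' m2 t m1 hne.symm
    have h2 := hV t m1 t' m2 hne
    rw [ht2, ht2'] at h1 h2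
    rw [show lo + d - lo = d by ring] at h1
    rw [show lo - (lo + d) = -d by ring] at h2
    exact ⟨h1, h2⟩
  have hall : ∀ d, N d := by
    intro d
    have hmul : ∀ (n : ℕ) (x : ℝ), N x → N (n * x) := by
      intro n x hx
      induction n with
      | zero => simpa using hN0
      | succ n ih => push_cast; rw [add_mul, one_mul]; exact hadd _ _ ih hx
    obtain ⟨n, hn⟩ := exists_nat_gt (|d| / (hi - lo))
    rw [div_lt_iff₀ (by linarith)] at hn
    have hn0 : (0 : ℝ) < n := by
      rcases Nat.eq_zero_or_pos n with rfl | h0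
      · simp at hn; linarith [abs_nonneg d]
      · exact_mod_cast h0
    have hd' : |d| / n ∈ Icc 0 (hi - lo) :=
      ⟨by positivity, by rw [div_le_iff₀ hn0]; linarith⟩
    have : N (d / n) := by
      rcases abs_choice d with e | e
      · have := (hsmall _ hd').1; rwa [e] at this
      · have := (hsmall _ hd').2; rwa [e, neg_div, neg_neg] at this
    have := hmul n _ this
    rwa [mul_div_cancel₀ _ hn0.ne'] at this
  obtain ⟨t, ht, z, hz⟩ := hall (y - x)
  refine ⟨t, ht, z + x, ?_⟩
  have := h.trans t ht 0 z x
  rw [zero_add, hz] at this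
  linarith

/-- Prolonging from `a` beyond `b`, and then from the new endpoint back beyond `a`, puts both points
at interior parameters of one curve. -/
theorem exists_line (h : TranslationMean m)
    (hpro : ∀ x y, ∃ t ∈ Ioo (0 : ℝ) 1, ∃ z, m t x z = y) (a b : ℝ) :
    ∃ p q, ∃ t₁ ∈ Ioo (0 : ℝ) 1, ∃ t₂ ∈ Ioo (0 : ℝ) 1, t₁ < t₂ ∧ m t₁ p q = a ∧ m t₂ p q = b := by
  obtain ⟨t, ht, q, hq⟩ := hpro a b
  obtain ⟨s, hs, p, hp⟩ := hpro q a
  have h1 : 1 - s ∈ Ioo (0 : ℝ) 1 := ⟨by linarith [hs.2], by linarith [hs.1]⟩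
  have h2 : t * (1 - s) ∈ Ioo (0 : ℝ) 1 :=
    ⟨mul_pos ht.1 h1.1, by nlinarith [ht.1, ht.2, h1.1, h1.2]⟩
  have ea : m (1 - s) p q = a := by rw [← hp, h.comm s hs]
  have eb : m (t * (1 - s)) p q = b := by
    rw [← hq, ← ea, h.assoc t ht _ h1, h.idem]
    have : 0 < 1 - t * (1 - s) := by linarith [h2.2]
    refine ⟨div_pos (mul_pos ht.1 (by linarith [hs.1])) this, ?_⟩
    rw [div_lt_one this]
    nlinarith [ht.1, ht.2]
  refine ⟨q, p, 1 - (1 - s), by simpa using hs, 1 - t * (1 - s),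
    ⟨by linarith [h2.2], by linarith [h2.1]⟩, ?_, ?_, ?_⟩
  · nlinarith [ht.1, ht.2, h1.1]
  · rw [← h.comm _ h1, ea]
  · rw [← h.comm _ h2, eb]

/-- `k` turns the mean into an affine combination, for arguments in `s`. -/
def AffineOn (m : ℝ → ℝ → ℝ → ℝ) (k : ℝ → ℝ) (s : Set ℝ) : Prop :=
  ∀ t ∈ Ioo (0 : ℝ) 1, ∀ x ∈ s, ∀ y ∈ s, k (m t x y) = t * k x + (1 - t) * k y

/-- The coordinate is the inverse of a curve through `a` and `b`. That curve is not constant, hence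
injective by `eq_of_not_inj`, hence strictly monotone by continuity, and `affine` transfers the mean
to its parameter. -/
theorem exists_chart (h : TranslationMean m)
    (hpro : ∀ x y, ∃ t ∈ Ioo (0 : ℝ) 1, ∃ z, m t x z = y) {a b : ℝ} (hab : a < b) :
    ∃ k : ℝ → ℝ, StrictMonoOn k (Icc a b) ∧ AffineOn m k (Icc a b) ∧
      (∀ t ∈ Ioo (0 : ℝ) 1, ∀ x ∈ Icc a b, ∀ y ∈ Icc a b, m t x y ∈ Icc a b) ∧
      ∀ w ∈ Ioo a b, ∃ s ∈ Ioo (0 : ℝ) 1, m s a b = w := by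
  obtain ⟨p, q, t₁, ht₁, t₂, ht₂, hlt, ea, eb⟩ := h.exists_line hpro a b
  set V : ℝ → ℝ := fun t => m t p q with hV
  have hsub : Icc t₁ t₂ ⊆ Ioo 0 1 := fun t ht => ⟨ht₁.1.trans_le ht.1, ht.2.trans_lt ht₂.2⟩
  have hinj : InjOn V (Icc t₁ t₂) := by
    intro t ht t' ht' he
    by_contra hne
    have : V t₁ = V t₂ := by
      rcases lt_or_gt_of_ne hne with hl | hl
      · exact h.eq_of_not_inj (hsub ht) (hsub ht') hl he ht₁ ht₂
      · exact h.eq_of_not_inj (hsub ht') (hsub ht) hl he.symm ht₁ ht₂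
    simp only [hV] at this
    linarith
  have hcont : ContinuousOn V (Icc t₁ t₂) := (h.cont_weight p q).mono hsub
  have hmono : StrictMonoOn V (Icc t₁ t₂) :=
    hcont.strictMonoOn_of_injOn_Icc hlt.le (by simp only [hV]; linarith) hinj
  have hsurj : ∀ x, ∃ t, x ∈ Icc a b → t ∈ Icc t₁ t₂ ∧ V t = x := by
    intro x
    by_cases hx : x ∈ Icc a b
    · obtain ⟨t, ht, e⟩ := intermediate_value_Icc hlt.le hcont
        (show x ∈ Icc (V t₁) (V t₂) by simp only [hV]; rwa [ea, eb])
      exact ⟨t, fun _ => ⟨ht, e⟩⟩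
    · exact ⟨0, fun hx' => absurd hx' hx⟩
  choose k hk using hsurj
  have hkm : StrictMonoOn k (Icc a b) := by
    intro x hx y hy hxy
    by_contra hle
    have := hmono.monotoneOn (hk y hy).1 (hk x hx).1 (le_of_not_gt hle)
    rw [(hk x hx).2, (hk y hy).2] at this
    linarith
  have hconv : ∀ t ∈ Ioo (0 : ℝ) 1, ∀ x ∈ Icc a b, ∀ y ∈ Icc a b,
      t * k x + (1 - t) * k y ∈ Icc t₁ t₂ := fun t ht x hx y hy =>
    (convex_Icc t₁ t₂) (hk x hx).1 (hk y hy).1 ht.1.le (by linarith [ht.2]) (by ring)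
  have haff : ∀ t ∈ Ioo (0 : ℝ) 1, ∀ x ∈ Icc a b, ∀ y ∈ Icc a b,
      m t x y = V (t * k x + (1 - t) * k y) := by
    intro t ht x hx y hy
    have := h.affine ht (hsub (hk x hx).1) (hsub (hk y hy).1) p q
    have e1 : m (k x) p q = x := (hk x hx).2
    have e2 : m (k y) p q = y := (hk y hy).2
    rw [e1, e2] at this
    exact this
  have hmem : ∀ t ∈ Ioo (0 : ℝ) 1, ∀ x ∈ Icc a b, ∀ y ∈ Icc a b, m t x y ∈ Icc a b := by
    intro t ht x hx y hy
    rw [haff t ht x hx y hy]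
    have hc := hconv t ht x hx y hy
    have e1 := hmono.monotoneOn (left_mem_Icc.2 hlt.le) hc hc.1
    have e2 := hmono.monotoneOn hc (right_mem_Icc.2 hlt.le) hc.2
    simp only [hV] at e1 e2 ⊢
    exact ⟨ea ▸ e1, eb ▸ e2⟩
  refine ⟨k, hkm, ?_, hmem, ?_⟩
  · intro t ht x hx y hy
    refine hinj (hk _ (hmem t ht x hx y hy)).1 (hconv t ht x hx y hy) ?_
    rw [(hk _ (hmem t ht x hx y hy)).2, haff t ht x hx y hy]
  · intro w hw
    have hwI : w ∈ Icc a b := Ioo_subset_Icc_self hw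
    have haI : a ∈ Icc a b := left_mem_Icc.2 hab.le
    have hbI : b ∈ Icc a b := right_mem_Icc.2 hab.le
    have l1 := hkm haI hwI hw.1
    have l2 := hkm hwI hbI hw.2
    have hd : 0 < k b - k a := by linarith
    have hs : (k b - k w) / (k b - k a) ∈ Ioo (0 : ℝ) 1 :=
      ⟨div_pos (by linarith) hd, by rw [div_lt_one hd]; linarith⟩
    refine ⟨_, hs, ?_⟩
    rw [haff _ hs a haI b hbI]
    have : (k b - k w) / (k b - k a) * k a + (1 - (k b - k w) / (k b - k a)) * k b = k w := by
      field_simp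
      ring
    rw [this, (hk w hwI).2]

/-- Of three distinct points `0`, `1`, `x`, one lies between the others and so is a mean of them;
affinity at that mean can be solved for the coordinate of `x`. -/
theorem AffineOn.eq_of_normalized
    (hbet : ∀ x y, x < y → ∀ w ∈ Ioo x y, ∃ s ∈ Ioo (0 : ℝ) 1, m s x y = w) {k k' : ℝ → ℝ}
    {S : Set ℝ} (h0 : (0 : ℝ) ∈ S) (h1 : (1 : ℝ) ∈ S) (hk : AffineOn m k S)
    (hk' : AffineOn m k' S) (k0 : k 0 = 0) (k1 : k 1 = 1) (k0' : k' 0 = 0) (k1' : k' 1 = 1) :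
    EqOn k k' S := by
  intro x hx
  rcases lt_trichotomy x 0 with hlt | rfl | hgt
  · obtain ⟨s, hs, e⟩ := hbet x 1 (by linarith) 0 ⟨hlt, zero_lt_one⟩
    have e1 := hk s hs x hx 1 h1
    have e2 := hk' s hs x hx 1 h1
    rw [e, k0, k1] at e1
    rw [e, k0', k1'] at e2
    have := hs.1.ne'
    exact mul_left_cancel₀ this (by linarith)
  · rw [k0, k0']
  · rcases lt_trichotomy x 1 with hlt1 | rfl | hgt1
    · obtain ⟨s, hs, e⟩ := hbet 0 1 one_pos x ⟨hgt, hlt1⟩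
      have e1 := hk s hs 0 h0 1 h1
      have e2 := hk' s hs 0 h0 1 h1
      rw [e, k0, k1] at e1
      rw [e, k0', k1'] at e2
      rw [e1, e2]
    · rw [k1, k1']
    · obtain ⟨s, hs, e⟩ := hbet 0 x hgt 1 ⟨one_pos, hgt1⟩
      have e1 := hk s hs 0 h0 x hx
      have e2 := hk' s hs 0 h0 x hx
      rw [e, k0, k1] at e1
      rw [e, k0', k1'] at e2
      have : (1 - s) ≠ 0 := by linarith [hs.2]
      exact mul_left_cancel₀ this (by linarith)

/-- A strictly increasing function turning the mean into affine combinations. -/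
theorem exists_global_chart (h : TranslationMean m)
    (hpro : ∀ x y, ∃ t ∈ Ioo (0 : ℝ) 1, ∃ z, m t x z = y) :
    ∃ k : ℝ → ℝ, StrictMono k ∧ AffineOn m k univ ∧ k 0 = 0 ∧ k 1 = 1 := by
  have hbet : ∀ x y, x < y → ∀ w ∈ Ioo x y, ∃ s ∈ Ioo (0 : ℝ) 1, m s x y = w :=
    fun x y hxy => (h.exists_chart hpro hxy).choose_spec.2.2.2
  -- The radius `N + 1` keeps the normalisation points `0` and `1` inside even for `N = 0`.
  have hloc : ∀ N : ℕ, ∃ k : ℝ → ℝ, StrictMonoOn k (Icc (-(N + 1 : ℝ)) (N + 1)) ∧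
      AffineOn m k (Icc (-(N + 1 : ℝ)) (N + 1)) ∧
      (∀ t ∈ Ioo (0 : ℝ) 1, ∀ x ∈ Icc (-(N + 1 : ℝ)) (N + 1), ∀ y ∈ Icc (-(N + 1 : ℝ)) (N + 1),
        m t x y ∈ Icc (-(N + 1 : ℝ)) (N + 1)) ∧ k 0 = 0 ∧ k 1 = 1 := by
    intro N
    have hN : (0 : ℝ) ≤ N := N.cast_nonneg
    obtain ⟨k, k1, k2, k3, -⟩ := h.exists_chart hpro (a := -(N + 1 : ℝ)) (b := N + 1) (by linarith)
    have h01 : k 0 < k 1 := k1 ⟨by linarith, by linarith⟩ ⟨by linarith, by linarith⟩ one_pos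
    have hd : 0 < k 1 - k 0 := by linarith
    refine ⟨fun x => (k x - k 0) / (k 1 - k 0), ?_, ?_, k3, by simp, div_self hd.ne'⟩
    · intro x hx y hy hxy
      have := k1 hx hy hxy
      exact div_lt_div_of_pos_right (by linarith) hd
    · intro t ht x hx y hy
      simp only
      rw [k2 t ht x hx y hy]
      field_simp
      ring
  choose K K1 K2 K3 K4 K5 using hloc
  have hmemN : ∀ {N : ℕ} {x : ℝ}, |x| ≤ N + 1 ↔ x ∈ Icc (-(N + 1 : ℝ)) (N + 1) := abs_le
  have h0N : ∀ N : ℕ, (0 : ℝ) ∈ Icc (-(N + 1 : ℝ)) (N + 1) := fun N => by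
    rw [← hmemN, abs_zero]; positivity
  have h1N : ∀ N : ℕ, (1 : ℝ) ∈ Icc (-(N + 1 : ℝ)) (N + 1) := fun N => by
    rw [← hmemN, abs_one]; linarith [N.cast_nonneg (α := ℝ)]
  -- The choice of interval is immaterial: normalised charts agree wherever both are defined.
  set k : ℝ → ℝ := fun x => K ⌈|x|⌉₊ x with hk
  have hkN : ∀ (N : ℕ) (x : ℝ), x ∈ Icc (-(N + 1 : ℝ)) (N + 1) → k x = K N x := by
    intro N x hx
    set N' := ⌈|x|⌉₊ with hN'
    have hx' : x ∈ Icc (-(N' + 1 : ℝ)) (N' + 1) := by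
      rw [← hmemN]; linarith [Nat.le_ceil |x|]
    refine AffineOn.eq_of_normalized hbet
      (S := Icc (-(N' + 1 : ℝ)) (N' + 1) ∩ Icc (-(N + 1 : ℝ)) (N + 1))
      ⟨h0N _, h0N _⟩ ⟨h1N _, h1N _⟩ ?_ ?_ (K4 N') (K5 N') (K4 N) (K5 N) ⟨hx', hx⟩
    · exact fun t ht y hy z hz => K2 N' t ht y hy.1 z hz.1
    · exact fun t ht y hy z hz => K2 N t ht y hy.2 z hz.2
  have hex : ∀ x y : ℝ, ∃ N : ℕ, x ∈ Icc (-(N + 1 : ℝ)) (N + 1) ∧ y ∈ Icc (-(N + 1 : ℝ)) (N + 1) := by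
    intro x y
    refine ⟨⌈max |x| |y|⌉₊, ?_, ?_⟩ <;> rw [← hmemN]
    · linarith [Nat.le_ceil (max |x| |y|), le_max_left |x| |y|]
    · linarith [Nat.le_ceil (max |x| |y|), le_max_right |x| |y|]
  refine ⟨k, ?_, ?_, ?_, ?_⟩
  · intro x y hxy
    obtain ⟨N, hx, hy⟩ := hex x y
    rw [hkN N x hx, hkN N y hy]
    exact K1 N hx hy hxy
  · intro t ht x _ y _
    obtain ⟨N, hx, hy⟩ := hex x y
    rw [hkN N x hx, hkN N y hy, hkN N _ (K3 N t ht x hx y hy)]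
    exact K2 N t ht x hx y hy
  · rw [hkN 0 0 (h0N 0), K4]
  · rw [hkN 0 1 (h1N 0), K5]

/-- The nondegenerate means are the exponential means and the arithmetic mean. -/
theorem eq_exp_mean (h : TranslationMean m)
    (hnc : ∃ y z, ∃ a ∈ Ioo (0 : ℝ) 1, ∃ b ∈ Ioo (0 : ℝ) 1, m a y z ≠ m b y z) :
    (∀ t ∈ Ioo (0 : ℝ) 1, ∀ y z, m t y z = t * y + (1 - t) * z) ∨
    ∃ r : ℝ, r ≠ 0 ∧ ∀ t ∈ Ioo (0 : ℝ) 1, ∀ y z,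
      Real.exp (r * m t y z) = t * Real.exp (r * y) + (1 - t) * Real.exp (r * z) := by
  have hpro := h.exists_prolong hnc
  have hbet : ∀ x y, x < y → ∀ w ∈ Ioo x y, ∃ s ∈ Ioo (0 : ℝ) 1, m s x y = w :=
    fun x y hxy => (h.exists_chart hpro hxy).choose_spec.2.2.2
  obtain ⟨k, km, ka, k0, k1⟩ := h.exists_global_chart hpro
  set α : ℝ → ℝ := fun c => k (1 + c) - k c with hα
  have hα0 : ∀ c, 0 < α c := fun c => sub_pos.2 (km (by linarith))
  have hkα : ∀ x c, k (x + c) = α c * k x + k c := by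
    intro x c
    -- The chart translated by `c` and renormalised is again a normalised chart, hence equal to `k`.
    have := AffineOn.eq_of_normalized hbet (S := univ)
      (k := fun x => (k (x + c) - k c) / α c) (k' := k) trivial trivial ?_ ka ?_ ?_ k0 k1
      (mem_univ x)
    · simp only at this
      rw [div_eq_iff (hα0 c).ne'] at this
      linarith
    · intro t ht x _ y _
      beta_reduce
      rw [← h.trans t ht, ka t ht _ trivial _ trivial]
      have := (hα0 c).ne'
      field_simp
      ring
    · simp
    · exact div_self (hα0 c).ne'
  have hαmul : ∀ c d, α (c + d) = α c * α d := by
    intro c d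
    have e1 := hkα (1 + d) c
    have e2 := hkα d c
    have : α (c + d) = k (1 + d + c) - k (d + c) := by
      simp only [hα]; rw [show 1 + (c + d) = 1 + d + c by ring, add_comm c d]
    rw [this, e1, e2]
    simp only [hα]
    ring
  by_cases hone : ∀ c, α c = 1
  · left
    have hlin : ∀ x, k x = x := fun x => by
      have := km.monotone.eq_mul_of_additive (fun x c => by rw [hkα, hone, one_mul]) x
      rw [this, k1, one_mul]
    intro t ht y z
    have := ka t ht y trivial z trivial
    rwa [hlin, hlin, hlin] at this
  · right
    push Not at hone
    obtain ⟨c, hc⟩ := hone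
    have hkc : k c ≠ 0 := by
      intro e
      have : c = 0 := km.injective (e.trans k0.symm)
      subst this
      simp [hα, k1, k0] at hc
    set κ := (α c - 1) / k c with hκ
    have hκ0 : κ ≠ 0 := div_ne_zero (sub_ne_zero.2 hc) hkc
    -- Both expansions of `k (x + c)` are compared, with the roles of `x` and `c` exchanged.
    have hακ : ∀ x, α x = 1 + κ * k x := by
      intro x
      have e1 := hkα x c
      have e2 := hkα c x
      rw [add_comm c x, e1] at e2
      rw [hκ]
      field_simp
      linarith
    have hladd : ∀ x y, Real.log (α (x + y)) = Real.log (α x) + Real.log (α y) := fun x y => by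
      rw [hαmul, Real.log_mul (hα0 x).ne' (hα0 y).ne']
    have hlin : ∃ r, ∀ x, Real.log (α x) = r * x := by
      rcases lt_or_gt_of_ne hκ0 with hneg | hpos
      · have hm : Monotone fun x => -Real.log (α x) := by
          intro x y hxy
          refine neg_le_neg (Real.log_le_log (hα0 y) ?_)
          rw [hακ, hακ]
          linarith [mul_le_mul_of_nonpos_left (km.monotone hxy) hneg.le]
        have := hm.eq_mul_of_additive (fun x y => by rw [hladd]; ring)
        exact ⟨Real.log (α 1), fun x => by linarith [this x]⟩
      · have hm : Monotone fun x => Real.log (α x) := by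
          intro x y hxy
          refine Real.log_le_log (hα0 x) ?_
          rw [hακ, hακ]
          linarith [mul_le_mul_of_nonneg_left (km.monotone hxy) hpos.le]
        exact ⟨_, hm.eq_mul_of_additive hladd⟩
    obtain ⟨r, hr⟩ := hlin
    have hexp : ∀ x, Real.exp (r * x) = 1 + κ * k x := fun x => by
      rw [← hr, Real.exp_log (hα0 x), hακ]
    refine ⟨r, ?_, ?_⟩
    · rintro rfl
      have := hexp 1
      rw [k1] at this
      simp at this
      exact hκ0 this
    · intro t ht y z
      rw [hexp, hexp, hexp, ka t ht y trivial z trivial]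
      ring

/-- If `r ≤ -1`, both terms `t ^ (1 + r)` and `(1 - t) ^ (1 + r)` are at least `1`, so their sum
cannot approach the boundary value `exp 0 = 1`. This becomes the positivity of `q = 1 + r`. -/
theorem exponent_gt (h : TranslationMean m) {r : ℝ}
    (hr : ∀ t ∈ Ioo (0 : ℝ) 1, ∀ y z,
      Real.exp (r * m t y z) = t * Real.exp (r * y) + (1 - t) * Real.exp (r * z)) : -1 < r := by
  by_contra hle
  push Not at hle
  have h1 : Tendsto (fun t => Real.exp (r * m t (Real.log t) (Real.log (1 - t)))) (𝓝[>] 0)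
      (𝓝 1) := by
    have := (Real.continuous_exp.tendsto (r * 0)).comp (h.boundary.const_mul r)
    rw [mul_zero, Real.exp_zero] at this
    exact this
  have h2 : ∀ᶠ t in 𝓝[>] (0 : ℝ),
      Real.exp (r * m t (Real.log t) (Real.log (1 - t))) < 2 :=
    h1.eventually_lt_const (by norm_num)
  obtain ⟨t, ht, ht2⟩ := (h2.and (Ioo_mem_nhdsGT (zero_lt_one' ℝ))).exists
  have key : ∀ u ∈ Ioo (0 : ℝ) 1, 1 ≤ u * Real.exp (r * Real.log u) := by
    intro u hu
    have : u * Real.exp (r * Real.log u) = Real.exp ((1 + r) * Real.log u) := by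
      conv_lhs => rw [← Real.exp_log hu.1]
      rw [Real.log_exp, ← Real.exp_add]
      ring_nf
    rw [this]
    exact Real.one_le_exp (mul_nonneg_of_nonpos_of_nonpos (by linarith)
      (Real.log_nonpos hu.1.le hu.2.le))
  rw [hr t ht2] at ht
  linarith [key t ht2, key (1 - t) ⟨by linarith [ht2.2], by linarith [ht2.1]⟩]

end TranslationMean

/-! ### Hölder's theorem for monoids on an interval -/

/-- A cancellative continuous monoid structure on an interval of the real line, given through an
injective homomorphism `θ` to some group. -/
structure IntervalMonoid {G : Type*} [AddCommGroup G] (X : Set ℝ) (op : ℝ → ℝ → ℝ) (θ : ℝ → G)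
    (e : ℝ) : Prop where
  ordConnected : OrdConnected X
  one_mem : e ∈ X
  op_mem : ∀ x ∈ X, ∀ y ∈ X, op x y ∈ X
  injOn : InjOn θ X
  map_op : ∀ x ∈ X, ∀ y ∈ X, θ (op x y) = θ x + θ y
  map_one : θ e = 0
  cont : ∀ x ∈ X, ∀ u ∈ X, ∀ v ∈ X, ContinuousOn (op x) (Icc u v)

namespace IntervalMonoid

variable {G : Type*} [AddCommGroup G] {X : Set ℝ} {op : ℝ → ℝ → ℝ} {θ : ℝ → G} {e : ℝ}

theorem op_comm (h : IntervalMonoid X op θ e) {x y : ℝ} (hx : x ∈ X) (hy : y ∈ X) :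
    op x y = op y x :=
  h.injOn (h.op_mem x hx y hy) (h.op_mem y hy x hx) (by
    rw [h.map_op x hx y hy, h.map_op y hy x hx, add_comm])

theorem one_op (h : IntervalMonoid X op θ e) {x : ℝ} (hx : x ∈ X) : op e x = x :=
  h.injOn (h.op_mem e h.one_mem x hx) hx (by
    rw [h.map_op e h.one_mem x hx, h.map_one, zero_add])

theorem op_one (h : IntervalMonoid X op θ e) {x : ℝ} (hx : x ∈ X) : op x e = x := by
  rw [h.op_comm hx h.one_mem, h.one_op hx]

/-- The difference `op c y - op b y` is positive at `y = e`. If it were not positive at `y = x` it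
would vanish in between, contradicting cancellation. -/
theorem op_lt_op (h : IntervalMonoid X op θ e) {x b c : ℝ} (hx : x ∈ X) (hb : b ∈ X) (hc : c ∈ X)
    (hbc : b < c) : op x b < op x c := by
  by_contra hle
  push Not at hle
  have hmin : min e x ∈ X := by rcases min_choice e x with h' | h' <;> rw [h'] <;> simp [h.one_mem, hx]
  have hmax : max e x ∈ X := by rcases max_choice e x with h' | h' <;> rw [h'] <;> simp [h.one_mem, hx]
  have hcont : ContinuousOn (fun y => op c y - op b y) (uIcc e x) :=
    (h.cont c hc _ hmin _ hmax).sub (h.cont b hb _ hmin _ hmax)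
  have h0 : (0 : ℝ) ∈ uIcc (op c e - op b e) (op c x - op b x) := by
    rw [h.op_one hc, h.op_one hb, h.op_comm hc hx, h.op_comm hb hx, mem_uIcc]
    right
    constructor <;> linarith
  obtain ⟨y, hy, hy0⟩ := intermediate_value_uIcc hcont h0
  have hyX : y ∈ X := h.ordConnected.out hmin hmax hy
  have heq : op c y = op b y := by simp only at hy0; linarith
  have := congrArg θ heq
  rw [h.map_op c hc y hyX, h.map_op b hb y hyX] at this
  exact hbc.ne' (h.injOn hc hb (add_right_cancel this))

theorem op_le_op (h : IntervalMonoid X op θ e) {x b c : ℝ} (hx : x ∈ X) (hb : b ∈ X) (hc : c ∈ X)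
    (hbc : b ≤ c) : op x b ≤ op x c := by
  rcases hbc.eq_or_lt with rfl | hlt
  · rfl
  · exact (h.op_lt_op hx hb hc hlt).le

/-- Iterated multiplication of `z` by `a`. -/
def iter (op : ℝ → ℝ → ℝ) (a z : ℝ) : ℕ → ℝ
  | 0 => z
  | n + 1 => op a (iter op a z n)

theorem iter_mem (h : IntervalMonoid X op θ e) {a z : ℝ} (ha : a ∈ X) (hz : z ∈ X) (n : ℕ) :
    iter op a z n ∈ X := by
  induction n with
  | zero => exact hz
  | succ n ih => exact h.op_mem a ha _ ih

theorem map_iter (h : IntervalMonoid X op θ e) {a z : ℝ} (ha : a ∈ X) (hz : z ∈ X) (n : ℕ) :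
    θ (iter op a z n) = n • θ a + θ z := by
  induction n with
  | zero => simp [iter]
  | succ n ih =>
    rw [iter, h.map_op a ha _ (h.iter_mem ha hz n), ih, succ_nsmul]
    abel

/-- Bounded iterates would increase to a limit `L` in `X` fixed by `op a`, which forces `a = e`.
This is the source of the Archimedean property. -/
theorem exists_lt_iter (h : IntervalMonoid X op θ e) {a z b : ℝ} (ha : a ∈ X) (hz : z ∈ X)
    (hb : b ∈ X) (hea : e < a) : ∃ n, b < iter op a z n := by
  by_contra hcon
  push Not at hcon
  have hmono : Monotone (iter op a z) := monotone_nat_of_le_succ fun n => by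
    have hm := h.iter_mem ha hz n
    have := h.op_lt_op hm h.one_mem ha hea
    rw [h.op_one hm, h.op_comm hm ha] at this
    exact this.le
  have hbdd : BddAbove (range (iter op a z)) := ⟨b, by rintro _ ⟨n, rfl⟩; exact hcon n⟩
  have hlim := tendsto_atTop_ciSup hmono hbdd
  set L := ⨆ n, iter op a z n
  have hL : L ∈ Icc z b := ⟨le_ciSup hbdd 0, ciSup_le hcon⟩
  have hLX : L ∈ X := h.ordConnected.out hz hb hL
  have hc := (h.cont a ha z hz b hb) L hL
  have h1 : Tendsto (iter op a z) atTop (𝓝[Icc z b] L) :=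
    tendsto_nhdsWithin_iff.2 ⟨hlim, Eventually.of_forall fun n => ⟨hmono n.zero_le, hcon n⟩⟩
  have h2 : Tendsto (fun n => iter op a z (n + 1)) atTop (𝓝 (op a L)) := hc.tendsto.comp h1
  have h3 := (tendsto_add_atTop_iff_nat 1).2 hlim
  have h4 := congrArg θ (tendsto_nhds_unique h2 h3)
  rw [h.map_op a ha L hLX] at h4
  have h5 : θ a = θ e := by rw [h.map_one]; exact left_eq_add.1 (by rw [add_comm]; exact h4.symm)
  exact hea.ne' (h.injOn ha h.one_mem h5)

theorem exists_op_eq (h : IntervalMonoid X op θ e) {x y : ℝ} (hx : x ∈ X) (hy : y ∈ X)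
    (hex : e ≤ x) (hxy : x < y) : ∃ d ∈ X, e < d ∧ op x d = y := by
  have h1 : y ∈ Icc (op x e) (op x y) := by
    refine ⟨by rw [h.op_one hx]; exact hxy.le, ?_⟩
    have := h.op_le_op hy h.one_mem hx hex
    rwa [h.op_one hy, h.op_comm hy hx] at this
  obtain ⟨d, hd, hd'⟩ := intermediate_value_Icc (hex.trans hxy.le) (h.cont x hx e h.one_mem y hy) h1
  refine ⟨d, h.ordConnected.out h.one_mem hy hd, lt_of_le_of_ne hd.1 ?_, hd'⟩
  rintro rfl
  rw [h.op_one hx] at hd'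
  exact hxy.ne hd'

/-- Equal differences mean `op x y' = op y x'`, so strict monotonicity excludes opposite orders.
Hence the sign of a difference is independent of its representation. -/
theorem le_of_sub_eq (h : IntervalMonoid X op θ e) {x y x' y' : ℝ} (hx : x ∈ X) (hy : y ∈ X)
    (hx' : x' ∈ X) (hy' : y' ∈ X) (heq : θ x - θ y = θ x' - θ y') (hle : y ≤ x) : y' ≤ x' := by
  by_contra hlt
  push Not at hlt
  have e1 : op x y' = op y x' := by
    refine h.injOn (h.op_mem x hx y' hy') (h.op_mem y hy x' hx') ?_
    rw [h.map_op x hx y' hy', h.map_op y hy x' hx', add_comm (θ y), ← sub_eq_sub_iff_add_eq_add]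
    exact heq
  have h1 := h.op_lt_op hy hx' hy' hlt
  have h2 := h.op_le_op hy' hy hx hle
  rw [h.op_comm hy' hy, h.op_comm hy' hx] at h2
  linarith

/-- The group of differences. -/
def diffGroup (h : IntervalMonoid X op θ e) : AddSubgroup G where
  carrier := {g | ∃ x ∈ X, ∃ y ∈ X, g = θ x - θ y}
  zero_mem' := ⟨e, h.one_mem, e, h.one_mem, by simp⟩
  add_mem' := by
    rintro _ _ ⟨x, hx, y, hy, rfl⟩ ⟨x', hx', y', hy', rfl⟩
    refine ⟨op x x', h.op_mem x hx x' hx', op y y', h.op_mem y hy y' hy', ?_⟩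
    rw [h.map_op x hx x' hx', h.map_op y hy y' hy']
    abel
  neg_mem' := by
    rintro _ ⟨x, hx, y, hy, rfl⟩
    exact ⟨y, hy, x, hx, by abel⟩

/-- The cone of differences `θ x - θ y` with `y ≤ x`. -/
def diffCone (h : IntervalMonoid X op θ e) : AddGroupCone h.diffGroup where
  carrier := {g | ∃ x ∈ X, ∃ y ∈ X, y ≤ x ∧ (g : G) = θ x - θ y}
  zero_mem' := ⟨e, h.one_mem, e, h.one_mem, le_rfl, by simp⟩
  add_mem' := by
    rintro g g' ⟨x, hx, y, hy, hxy, hg⟩ ⟨x', hx', y', hy', hxy', hg'⟩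
    refine ⟨op x x', h.op_mem x hx x' hx', op y y', h.op_mem y hy y' hy', ?_, ?_⟩
    · refine (h.op_le_op hy hy' hx' hxy').trans ?_
      rw [h.op_comm hy hx', h.op_comm hx hx']
      exact h.op_le_op hx' hy hx hxy
    · rw [h.map_op x hx x' hx', h.map_op y hy y' hy', AddSubgroup.coe_add, hg, hg']
      abel
  eq_zero_of_mem_of_neg_mem' := by
    rintro g ⟨x, hx, y, hy, hxy, hg⟩ ⟨x', hx', y', hy', hxy', hg'⟩
    have : x = y := le_antisymm (h.le_of_sub_eq hx' hy' hy hx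
      (by rw [← hg', AddSubgroup.coe_neg, hg]; abel) hxy') hxy
    ext
    simp [hg, this]

/-- The differences `θ x - θ y` form a linearly ordered group, Archimedean by `exists_lt_iter`, and
such a group embeds into the reals. -/
theorem exists_orderHom (h : IntervalMonoid X op θ e) {a : ℝ} (ha : a ∈ X) (hea : e < a) :
    ∃ ℓ : ℝ → ℝ, StrictMonoOn ℓ X ∧ ∀ x ∈ X, ∀ y ∈ X, ℓ (op x y) = ℓ x + ℓ y := by
  classical
  have hmn : HasMemOrNegMem h.diffCone := ⟨by
    rintro ⟨g, x, hx, y, hy, rfl⟩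
    rcases le_total y x with hle | hle
    · exact Or.inl ⟨x, hx, y, hy, hle, rfl⟩
    · exact Or.inr ⟨y, hy, x, hx, hle, by simp⟩⟩
  let : LinearOrder h.diffGroup := LinearOrder.mkOfAddGroupCone h.diffCone
  have : IsOrderedAddMonoid h.diffGroup := IsOrderedAddMonoid.mkOfCone h.diffCone
  have hle : ∀ g g' : h.diffGroup, g ≤ g' ↔ g' - g ∈ h.diffCone := fun g g' => Iff.rfl
  have hmem : ∀ x ∈ X, θ x ∈ h.diffGroup := fun x hx =>
    ⟨x, hx, e, h.one_mem, by rw [h.map_one, sub_zero]⟩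
  -- Multiplying `x` and `y` by the same high power of `a` moves both above `e` without changing the
  -- difference; above `e` the quotient exists in `X`.
  have hrepr : ∀ g : h.diffGroup, 0 < g → ∃ d ∈ X, e < d ∧ (g : G) = θ d := by
    intro g hg
    obtain ⟨x, hx, y, hy, hxy, e1⟩ := (hle 0 g).1 hg.le
    rw [sub_zero] at e1
    have hne : y ≠ x := by
      rintro rfl
      rw [sub_self] at e1
      exact hg.ne' (Subtype.ext e1)
    obtain ⟨n, hn⟩ := h.exists_lt_iter ha hy h.one_mem hea
    have hX1 := h.iter_mem ha hx n
    have hX2 := h.iter_mem ha hy n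
    have hlt : iter op a y n < iter op a x n := by
      refine lt_of_le_of_ne (h.le_of_sub_eq hx hy hX1 hX2 ?_ hxy) ?_
      · rw [h.map_iter ha hx, h.map_iter ha hy]; abel
      · intro e2
        have := congrArg θ e2
        rw [h.map_iter ha hx, h.map_iter ha hy] at this
        exact hne (h.injOn hy hx (add_left_cancel this))
    obtain ⟨d, hd, hed, e2⟩ := h.exists_op_eq hX2 hX1 hn.le hlt
    refine ⟨d, hd, hed, ?_⟩
    have := congrArg θ e2
    rw [h.map_op _ hX2 d hd, h.map_iter ha hx, h.map_iter ha hy, add_assoc] at this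
    rw [e1, sub_eq_iff_eq_add, add_comm]
    exact (add_left_cancel this).symm
  have : Archimedean h.diffGroup := ⟨by
    intro g g' hg'
    rcases le_or_gt g 0 with h0 | h0
    · exact ⟨0, by simpa using h0⟩
    obtain ⟨d, hd, hed, e1⟩ := hrepr g h0
    obtain ⟨d', hd', hed', e2⟩ := hrepr g' hg'
    obtain ⟨n, hn⟩ := h.exists_lt_iter hd' h.one_mem hd hed'
    refine ⟨n, (hle _ _).2 ⟨iter op d' e n, h.iter_mem hd' h.one_mem n, d, hd, hn.le, ?_⟩⟩
    rw [h.map_iter hd' h.one_mem, h.map_one, add_zero]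
    simp [e1, e2]⟩
  obtain ⟨φ, hφ⟩ := Archimedean.exists_orderAddMonoidHom_real_injective h.diffGroup
  have hφm : StrictMono φ := (OrderHomClass.monotone φ).strictMono_of_injective hφ
  refine ⟨fun x => if hx : x ∈ X then φ ⟨θ x, hmem x hx⟩ else 0, ?_, ?_⟩
  · intro x hx y hy hxy
    simp only [hx, hy, dif_pos]
    refine hφm (lt_of_le_of_ne ((hle _ _).2 ⟨y, hy, x, hx, hxy.le, rfl⟩) ?_)
    intro e1
    exact hxy.ne (h.injOn hx hy (congrArg Subtype.val e1))
  · intro x hx y hy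
    simp only [hx, hy, dif_pos, h.op_mem x hx y hy]
    rw [← map_add]
    congr 1
    ext
    exact h.map_op x hx y hy

/-- Some `d > e` has arbitrarily small `ℓ d`. Near `x` every `y` satisfies `y < op x d` and `x ≤ op
d y`, so `ℓ y` differs from `ℓ x` by at most `ℓ d`. -/
theorem continuousOn_of_strictMonoOn (h : IntervalMonoid X op θ e) {a : ℝ} (ha : a ∈ X)
    (hea : e < a) {ℓ : ℝ → ℝ} (hm : StrictMonoOn ℓ X)
    (hadd : ∀ x ∈ X, ∀ y ∈ X, ℓ (op x y) = ℓ x + ℓ y) {u v : ℝ} (hu : u ∈ X) (hv : v ∈ X) :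
    ContinuousOn ℓ (Icc u v) := by
  -- When `d` is split as `op d₁ d₂` with both factors above `e`, one factor takes at most half of
  -- `ℓ d`.
  have hhalf : ∀ k : ℕ, ∃ d ∈ X, e < d ∧ ℓ d ≤ ℓ a * (1 / 2) ^ k := by
    intro k
    induction k with
    | zero => exact ⟨a, ha, hea, by simp⟩
    | succ k ih =>
      obtain ⟨d, hd, hed, hdk⟩ := ih
      obtain ⟨d₁, h1, h2⟩ := exists_between hed
      have hd₁ : d₁ ∈ X := h.ordConnected.out h.one_mem hd ⟨h1.le, h2.le⟩
      obtain ⟨d₂, hd₂, h3, h4⟩ := h.exists_op_eq hd₁ hd h1.le h2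
      have hs := hadd d₁ hd₁ d₂ hd₂
      rw [h4] at hs
      rcases le_total (ℓ d₁) (ℓ d₂) with hl | hl
      · exact ⟨d₁, hd₁, h1, by rw [pow_succ]; linarith⟩
      · exact ⟨d₂, hd₂, h3, by rw [pow_succ]; linarith⟩
  have hsmall : ∀ ε > 0, ∃ d ∈ X, e < d ∧ ℓ d < ε := by
    intro ε hε
    have ht : Tendsto (fun k : ℕ => ℓ a * (1 / 2 : ℝ) ^ k) atTop (𝓝 (ℓ a * 0)) :=
      (tendsto_pow_atTop_nhds_zero_of_lt_one (by norm_num) (by norm_num)).const_mul _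
    rw [mul_zero] at ht
    obtain ⟨k, hk⟩ := (ht.eventually_lt_const hε).exists
    obtain ⟨d, hd, hed, hdk⟩ := hhalf k
    exact ⟨d, hd, hed, hdk.trans_lt hk⟩
  intro x hx
  have hIX : ∀ y ∈ Icc u v, y ∈ X := fun y hy => h.ordConnected.out hu hv hy
  have hxX := hIX x hx
  rw [ContinuousWithinAt, Metric.tendsto_nhds]
  intro ε hε
  obtain ⟨d, hd, hed, hdε⟩ := hsmall ε hε
  have hr : x < op x d := by
    have := h.op_lt_op hxX h.one_mem hd hed
    rwa [h.op_one hxX] at this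
  -- If `d` already carries the endpoint `u` to `x` or beyond, every `y` qualifies; otherwise the
  -- threshold is the solution `w` of `op d w = x`.
  obtain ⟨l, hl, hl'⟩ : ∃ l < x, ∀ y ∈ Icc u v, l < y → x ≤ op d y := by
    rcases le_or_gt x (op d u) with hc | hc
    · exact ⟨x - 1, by linarith, fun y hy _ => hc.trans (h.op_le_op hd hu (hIX y hy) hy.1)⟩
    · obtain ⟨w, hw, hw'⟩ := intermediate_value_Icc hx.1 (h.cont d hd u hu x hxX)
        (show x ∈ Icc (op d u) (op d x) from ⟨hc.le, by rw [h.op_comm hd hxX]; exact hr.le⟩)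
      have hwX : w ∈ X := h.ordConnected.out hu hxX hw
      refine ⟨w, lt_of_le_of_ne hw.2 ?_, fun y hy hwy => ?_⟩
      · rintro rfl
        rw [h.op_comm hxX hd, hw'] at hr
        exact lt_irrefl _ hr
      · rw [← hw']
        exact (h.op_lt_op hd hwX (hIX y hy) hwy).le
  filter_upwards [self_mem_nhdsWithin, mem_nhdsWithin_of_mem_nhds (Ioo_mem_nhds hl hr)]
    with y hy hy'
  have hyX := hIX y hy
  have h1 := hm hyX (h.op_mem x hxX d hd) hy'.2
  have h2 := hm.monotoneOn hxX (h.op_mem d hd y hyX) (hl' y hy hy'.1)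
  rw [hadd x hxX d hd] at h1
  rw [hadd d hd y hyX] at h2
  rw [Real.dist_eq, abs_lt]
  constructor <;> linarith

end IntervalMonoid

/-! ### Laws on finite sets: injections, mixtures, products -/

namespace stdSimplex

variable {α β γ : Type} [Fintype α] [Fintype β] [Fintype γ]

theorem map_apply [DecidableEq β] (f : α → β) (P : stdSimplex ℝ α) (y : β) :
    map f P y = ∑ x with f x = y, P x := by
  simp [FunOnFinite.linearMap_apply_apply]

/-- A law is the image of `P` under an injection as soon as it agrees with `P` on the range. -/
theorem map_eq_of_injective {ι : α → β} (hι : Function.Injective ι) {P : stdSimplex ℝ α}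
    {Q : stdSimplex ℝ β} (h : ∀ x, Q (ι x) = P x) : map ι P = Q := by
  classical
  have hsum : ∑ y ∈ Finset.univ.image ι, Q y = 1 := by
    rw [Finset.sum_image fun a _ b _ hab => hι hab, ← sum_eq_one P]
    exact Finset.sum_congr rfl fun x _ => h x
  have hrest : ∀ y, y ∉ Finset.univ.image ι → Q y = 0 := by
    intro y hy
    have h1 := Finset.sum_sdiff (f := Q) (Finset.subset_univ (Finset.univ.image ι))
    rw [hsum, sum_eq_one] at h1
    have h2 : ∑ y ∈ Finset.univ \ Finset.univ.image ι, Q y = 0 := by linarith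
    rw [Finset.sum_eq_zero_iff_of_nonneg fun _ _ => zero_le _ _] at h2
    exact h2 y (by simp only [Finset.mem_sdiff, Finset.mem_univ, true_and]; exact hy)
  ext y
  rw [map_apply]
  by_cases hy : y ∈ Finset.univ.image ι
  · obtain ⟨x, -, rfl⟩ := Finset.mem_image.1 hy
    rw [h, Finset.sum_eq_single x]
    · intro b hb hbx
      exact absurd (hι (Finset.mem_filter.1 hb).2) hbx
    · simp
  · rw [hrest y hy]
    refine Finset.sum_eq_zero fun x hx => ?_
    exact absurd (Finset.mem_image.2 ⟨x, Finset.mem_univ _, (Finset.mem_filter.1 hx).2⟩) hy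

theorem map_apply_of_injective {ι : α → β} (hι : Function.Injective ι) (P : stdSimplex ℝ α)
    (x : α) : map ι P (ι x) = P x := by
  classical
  rw [map_apply, Finset.sum_eq_single x]
  · intro b hb hbx
    exact absurd (hι (Finset.mem_filter.1 hb).2) hbx
  · simp

theorem sum_map_of_injective {ι : α → β} (hι : Function.Injective ι) (P : stdSimplex ℝ α)
    {φ : ℝ → ℝ} (h0 : φ 0 = 0) : ∑ y, φ (map ι P y) = ∑ x, φ (P x) := by
  classical
  rw [← Finset.sum_subset (Finset.subset_univ (Finset.univ.image ι)),
    Finset.sum_image fun a _ b _ hab => hι hab]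
  · exact Finset.sum_congr rfl fun x _ => by rw [map_apply_of_injective hι]
  · intro y _ hy
    rw [map_apply, Finset.sum_eq_zero, h0]
    intro x hx
    exact absurd (Finset.mem_image.2 ⟨x, Finset.mem_univ _, (Finset.mem_filter.1 hx).2⟩) hy

/-- The truncation of a real number to the unit interval. -/
def clamp (t : ℝ) : ℝ := max 0 (min 1 t)

theorem clamp_nonneg (t : ℝ) : 0 ≤ clamp t := le_max_left _ _

theorem clamp_le_one (t : ℝ) : clamp t ≤ 1 := max_le zero_le_one (min_le_left _ _)

theorem clamp_of_mem {t : ℝ} (ht : t ∈ Icc (0 : ℝ) 1) : clamp t = t := by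
  rw [clamp, min_eq_right ht.2, max_eq_right ht.1]

theorem continuous_clamp : Continuous clamp := by unfold clamp; fun_prop

/-- The mixture of two laws on disjoint sets, with weights `t` and `1 - t`. -/
def mix (t : ℝ) (P : stdSimplex ℝ α) (Q : stdSimplex ℝ β) : stdSimplex ℝ (α ⊕ β) :=
  ⟨Sum.elim (fun a => clamp t * P a) (fun b => (1 - clamp t) * Q b), by
    constructor
    · rintro (a | b)
      · exact mul_nonneg (clamp_nonneg t) (zero_le P a)
      · exact mul_nonneg (sub_nonneg.2 (clamp_le_one t)) (zero_le Q b)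
    · rw [Fintype.sum_sum_type]
      simp only [Sum.elim_inl, Sum.elim_inr, ← Finset.mul_sum]
      rw [sum_eq_one P, sum_eq_one Q]
      ring⟩

theorem mix_inl' (t : ℝ) (P : stdSimplex ℝ α) (Q : stdSimplex ℝ β) (a : α) :
    mix t P Q (Sum.inl a) = clamp t * P a := rfl

theorem mix_inr' (t : ℝ) (P : stdSimplex ℝ α) (Q : stdSimplex ℝ β) (b : β) :
    mix t P Q (Sum.inr b) = (1 - clamp t) * Q b := rfl

theorem mix_inl {t : ℝ} (ht : t ∈ Icc (0 : ℝ) 1) (P : stdSimplex ℝ α) (Q : stdSimplex ℝ β)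
    (a : α) : mix t P Q (Sum.inl a) = t * P a := by rw [mix_inl', clamp_of_mem ht]

theorem mix_inr {t : ℝ} (ht : t ∈ Icc (0 : ℝ) 1) (P : stdSimplex ℝ α) (Q : stdSimplex ℝ β)
    (b : β) : mix t P Q (Sum.inr b) = (1 - t) * Q b := by rw [mix_inr', clamp_of_mem ht]

/-- The law of a pair of independent variables. -/
def prodLaw (P : stdSimplex ℝ α) (Q : stdSimplex ℝ β) : stdSimplex ℝ (α × β) :=
  ⟨fun x => P x.1 * Q x.2, fun x => mul_nonneg (zero_le P x.1) (zero_le Q x.2), by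
    rw [Fintype.sum_prod_type]
    simp only [← Finset.mul_sum, sum_eq_one, mul_one]⟩

theorem prodLaw_apply (P : stdSimplex ℝ α) (Q : stdSimplex ℝ β) (x : α × β) :
    prodLaw P Q x = P x.1 * Q x.2 := rfl

theorem continuous_eval (a : α) : Continuous fun P : stdSimplex ℝ α => P a :=
  (continuous_apply a).comp continuous_subtype_val

theorem continuous_mix :
    Continuous fun x : ℝ × stdSimplex ℝ α × stdSimplex ℝ β => mix x.1 x.2.1 x.2.2 := by
  refine Continuous.subtype_mk (continuous_pi ?_) _
  rintro (a | b)
  · exact (continuous_clamp.comp continuous_fst).mul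
      ((continuous_eval a).comp (continuous_fst.comp continuous_snd))
  · exact (continuous_const.sub (continuous_clamp.comp continuous_fst)).mul
      ((continuous_eval b).comp (continuous_snd.comp continuous_snd))

theorem continuous_mix_left (P : stdSimplex ℝ α) (Q : stdSimplex ℝ β) :
    Continuous fun t : ℝ => mix t P Q :=
  continuous_mix.comp (continuous_id.prodMk (continuous_const (y := (P, Q))))

theorem continuous_prodLaw :
    Continuous fun x : stdSimplex ℝ α × stdSimplex ℝ β => prodLaw x.1 x.2 := by
  refine Continuous.subtype_mk (continuous_pi fun x => ?_) _
  exact ((continuous_eval x.1).comp continuous_fst).mul ((continuous_eval x.2).comp continuous_snd)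

theorem map_swap_mix {t : ℝ} (ht : t ∈ Icc (0 : ℝ) 1) (P : stdSimplex ℝ α) (Q : stdSimplex ℝ β) :
    map Sum.swap (mix t P Q) = mix (1 - t) Q P := by
  have ht' : 1 - t ∈ Icc (0 : ℝ) 1 := ⟨by linarith [ht.2], by linarith [ht.1]⟩
  refine map_eq_of_injective (Equiv.sumComm α β).injective ?_
  rintro (a | b)
  · simp [mix_inl ht, mix_inr ht']
  · simp [mix_inr ht, mix_inl ht']

theorem map_sumAssoc_mix {s t : ℝ} (hs : s ∈ Ioo (0 : ℝ) 1) (ht : t ∈ Ioo (0 : ℝ) 1)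
    (P : stdSimplex ℝ α) (Q : stdSimplex ℝ β) (R : stdSimplex ℝ γ) :
    map (Equiv.sumAssoc α β γ) (mix s (mix t P Q) R) =
      mix (s * t) P (mix (s * (1 - t) / (1 - s * t)) Q R) := by
  have hs' := Ioo_subset_Icc_self hs
  have ht' := Ioo_subset_Icc_self ht
  have hst : s * t < 1 := by nlinarith [hs.1, hs.2, ht.1, ht.2]
  have h1 : s * t ∈ Icc (0 : ℝ) 1 := ⟨by nlinarith [hs.1, ht.1], hst.le⟩
  have h2 : s * (1 - t) / (1 - s * t) ∈ Icc (0 : ℝ) 1 :=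
    ⟨div_nonneg (mul_nonneg hs.1.le (by linarith [ht.2])) (by linarith),
      by rw [div_le_one (by linarith)]; nlinarith [hs.2]⟩
  have h3 : 1 - s * t ≠ 0 := by linarith
  refine map_eq_of_injective (Equiv.sumAssoc α β γ).injective ?_
  rintro ((a | b) | c)
  · simp only [Equiv.sumAssoc_apply_inl_inl, mix_inl h1, mix_inl hs', mix_inl ht']
    ring
  · simp only [Equiv.sumAssoc_apply_inl_inr, mix_inr h1, mix_inl h2, mix_inl hs', mix_inr ht']
    field_simp
  · simp only [Equiv.sumAssoc_apply_inr, mix_inr h1, mix_inr h2, mix_inr hs']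
    field_simp
    ring

theorem map_sumProdDistrib_prodLaw (t : ℝ) (P : stdSimplex ℝ α) (Q : stdSimplex ℝ β)
    (A : stdSimplex ℝ γ) :
    map (Equiv.sumProdDistrib α β γ) (prodLaw (mix t P Q) A) =
      mix t (prodLaw P A) (prodLaw Q A) := by
  refine map_eq_of_injective (Equiv.sumProdDistrib α β γ).injective ?_
  rintro ⟨a | b, c⟩
  · simp only [Equiv.sumProdDistrib_apply_left, mix_inl', prodLaw_apply]
    ring
  · simp only [Equiv.sumProdDistrib_apply_right, mix_inr', prodLaw_apply]
    ring

theorem barycenter_eval [Nonempty α] (x : α) :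
    (barycenter : stdSimplex ℝ α) x = (Fintype.card α : ℝ)⁻¹ := rfl

theorem map_finSumFinEquiv_mix (k l : ℕ) [NeZero k] [NeZero l] [NeZero (k + l)] :
    map finSumFinEquiv (mix (k / ((k + l : ℕ) : ℝ)) (barycenter : stdSimplex ℝ (Fin k))
      (barycenter : stdSimplex ℝ (Fin l))) = (barycenter : stdSimplex ℝ (Fin (k + l))) := by
  have hk : (0 : ℝ) < k := Nat.cast_pos.2 (NeZero.pos k)
  have hl : (0 : ℝ) < l := Nat.cast_pos.2 (NeZero.pos l)
  have h1 : (k / ((k + l : ℕ) : ℝ)) ∈ Icc (0 : ℝ) 1 := by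
    push_cast
    exact ⟨by positivity, by rw [div_le_one (by positivity)]; linarith⟩
  refine map_eq_of_injective finSumFinEquiv.injective ?_
  rintro (a | b)
  · rw [mix_inl h1]
    simp only [barycenter_eval, Fintype.card_fin]
    push_cast
    field_simp
  · rw [mix_inr h1]
    simp only [barycenter_eval, Fintype.card_fin]
    push_cast
    field_simp
    ring

theorem mix_zero (P : stdSimplex ℝ α) (Q : stdSimplex ℝ β) : mix 0 P Q = map Sum.inr Q :=
  (map_eq_of_injective Sum.inr_injective fun x => by rw [mix_inr (by simp)]; simp).symm

theorem mix_one (P : stdSimplex ℝ α) (Q : stdSimplex ℝ β) : mix 1 P Q = map Sum.inl P :=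
  (map_eq_of_injective Sum.inl_injective fun x => by rw [mix_inl (by simp)]; simp).symm

/-- Every law arises from the one-point law by adding one atom at a time. -/
theorem law_induction {p : ∀ (α : Type) [Fintype α], stdSimplex ℝ α → Prop}
    (hmap : ∀ (α β : Type) [Fintype α] [Fintype β] (ι : α → β), Function.Injective ι →
      ∀ P : stdSimplex ℝ α, p α P → p β (map ι P))
    (hpt : p Unit default)
    (hmix : ∀ (α : Type) [Fintype α] (P : stdSimplex ℝ α) (t : ℝ), t ∈ Ioo (0 : ℝ) 1 → p α P →
      p (Unit ⊕ α) (mix t (default : stdSimplex ℝ Unit) P)) :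
    ∀ (α : Type) [Fintype α] (P : stdSimplex ℝ α), p α P := by
  have hfin : ∀ (n : ℕ) (P : stdSimplex ℝ (Fin n)), p (Fin n) P := by
    intro n
    induction n with
    | zero => intro P; have := sum_eq_one P; simp at this
    | succ n ih =>
      intro P
      have hsum : P 0 + ∑ i : Fin n, P i.succ = 1 := by
        rw [← Fin.sum_univ_succ, sum_eq_one]
      rcases (zero_le P 0).eq_or_lt with h0 | h0
      · set P' : stdSimplex ℝ (Fin n) := ⟨fun i => P i.succ, fun i => zero_le P _, by
          rw [← h0, zero_add] at hsum; exact hsum⟩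
        rw [← map_eq_of_injective (Fin.succ_injective n) (P := P') (Q := P) fun x => rfl]
        exact hmap _ _ _ (Fin.succ_injective n) _ (ih P')
      rcases (le_one P 0).eq_or_lt with h1 | h1
      · have hι : Function.Injective fun _ : Unit => (0 : Fin (n + 1)) :=
          Function.injective_of_subsingleton _
        rw [← map_eq_of_injective hι (P := default) (Q := P) fun x => by rw [h1]; rfl]
        exact hmap _ _ _ hι _ hpt
      · have hd : 0 < 1 - P 0 := by linarith
        set P' : stdSimplex ℝ (Fin n) := ⟨fun i => P i.succ / (1 - P 0),
          fun i => div_nonneg (zero_le P _) hd.le, by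
            rw [← Finset.sum_div, div_eq_one_iff_eq hd.ne']; linarith⟩ with hP'
        have hι : Function.Injective
            (Sum.elim (fun _ : Unit => (0 : Fin (n + 1))) (Fin.succ : Fin n → Fin (n + 1))) :=
          Function.Injective.sumElim (Function.injective_of_subsingleton _) (Fin.succ_injective n)
            fun _ b => (Fin.succ_ne_zero b).symm
        have hI : P 0 ∈ Icc (0 : ℝ) 1 := ⟨h0.le, h1.le⟩
        rw [← map_eq_of_injective hι (P := mix (P 0) default P') (Q := P)]
        · exact hmap _ _ _ hι _ (hmix _ _ _ ⟨h0, h1⟩ (ih P'))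
        · rintro (a | b)
          · rw [mix_inl hI, eq_one_of_unique (default : stdSimplex ℝ Unit), mul_one]; rfl
          · rw [mix_inr hI]
            change P b.succ = (1 - P 0) * (P b.succ / (1 - P 0))
            field_simp
  intro α _ P
  have := hmap _ _ (Fintype.equivFin α).symm (Fintype.equivFin α).symm.injective _
    (hfin _ (map (Fintype.equivFin α) P))
  rwa [map_comp_apply, show ((Fintype.equivFin α).symm : _ → α) ∘ Fintype.equivFin α = id by
    ext; simp, map_id_apply] at this

end stdSimplex

/-- A function through which a continuous map on a compact space factors is continuous on the
image. -/
theorem continuousOn_range_of_comp {K Y Z : Type*} [TopologicalSpace K] [CompactSpace K]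
    [TopologicalSpace Y] [T2Space Y] [TopologicalSpace Z] {π : K → Y} (hπ : Continuous π)
    {F : Y → Z} (hF : Continuous (F ∘ π)) : ContinuousOn F (range π) := by
  rw [continuousOn_iff_continuous_domRestrict]
  -- A continuous map from a compact to a Hausdorff space is closed, hence a quotient map onto its
  -- range.
  have hq : IsQuotientMap (rangeFactorization π) :=
    (hπ.codRestrict _).isClosedMap.isQuotientMap (hπ.codRestrict _) rangeFactorization_surjective
  rw [hq.continuous_iff]
  exact hF

open stdSimplex

/-! ### Logarithmic entropies and their means -/

/-- A continuous functional on laws which is invariant under injections, additive for independent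
variables, decomposable, and normalised at the uniform laws. -/
structure IsLogEntropy (ℓ : ∀ (α : Type) [Fintype α], stdSimplex ℝ α → ℝ) : Prop where
  map_inj : ∀ (α β : Type) [Fintype α] [Fintype β] (ι : α → β), Function.Injective ι →
    ∀ P : stdSimplex ℝ α, ℓ β (stdSimplex.map ι P) = ℓ α P
  prod : ∀ (α β : Type) [Fintype α] [Fintype β] (P : stdSimplex ℝ α) (Q : stdSimplex ℝ β),
    ℓ (α × β) (prodLaw P Q) = ℓ α P + ℓ β Q
  mix_congr : ∀ (α α' β β' : Type) [Fintype α] [Fintype α'] [Fintype β] [Fintype β'] (t : ℝ)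
    (P : stdSimplex ℝ α) (P' : stdSimplex ℝ α') (Q : stdSimplex ℝ β) (Q' : stdSimplex ℝ β'),
    ℓ α P = ℓ α' P' → ℓ β Q = ℓ β' Q' → ℓ (α ⊕ β) (mix t P Q) = ℓ (α' ⊕ β') (mix t P' Q')
  cont : ∀ (α : Type) [Fintype α], Continuous (ℓ α)
  unif : ∀ (n : ℕ) [NeZero n], ℓ (Fin n) barycenter = Real.log n

namespace IsLogEntropy

variable {ℓ : ∀ (α : Type) [Fintype α], stdSimplex ℝ α → ℝ}

theorem point (h : IsLogEntropy ℓ) : ℓ Unit default = 0 := by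
  have h1 := h.map_inj Unit (Fin 1) (fun _ => 0) (Function.injective_of_subsingleton _) default
  rw [← h1, show stdSimplex.map (fun _ : Unit => (0 : Fin 1)) default = barycenter from
    Subsingleton.elim _ _, h.unif]
  simp

theorem Icc_subset_range (h : IsLogEntropy ℓ) (n : ℕ) [NeZero n] :
    Icc 0 (Real.log n) ⊆ range (ℓ (Fin n)) := by
  have h1 := h.map_inj Unit (Fin n) (fun _ => 0) (Function.injective_of_subsingleton _) default
  rw [h.point] at h1
  have := intermediate_value_univ (stdSimplex.map (fun _ : Unit => (0 : Fin n)) default)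
    (barycenter : stdSimplex ℝ (Fin n)) (h.cont (Fin n))
  rwa [h1, h.unif] at this

theorem exists_log_ge (X : ℝ) : ∃ n : ℕ, NeZero n ∧ X ≤ Real.log n := by
  obtain ⟨n, hn⟩ := exists_nat_ge (Real.exp X)
  have hn0 : (0 : ℝ) < n := (Real.exp_pos X).trans_le hn
  exact ⟨n, ⟨by rintro rfl; simp at hn0⟩, (Real.le_log_iff_exp_le hn0).2 hn⟩

theorem exists_law (h : IsLogEntropy ℓ) {X : ℝ} (hX : 0 ≤ X) :
    ∃ (n : ℕ) (P : stdSimplex ℝ (Fin n)), ℓ (Fin n) P = X := by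
  obtain ⟨n, hn, hXn⟩ := exists_log_ge X
  obtain ⟨P, hP⟩ := h.Icc_subset_range n ⟨hX, hXn⟩
  exact ⟨n, P, hP⟩

theorem mix_prod (h : IsLogEntropy ℓ) {α β γ : Type} [Fintype α] [Fintype β] [Fintype γ] (t : ℝ)
    (P : stdSimplex ℝ α) (Q : stdSimplex ℝ β) (A : stdSimplex ℝ γ) :
    ℓ _ (mix t (prodLaw P A) (prodLaw Q A)) = ℓ _ (mix t P Q) + ℓ _ A := by
  rw [← map_sumProdDistrib_prodLaw, h.map_inj _ _ _ (Equiv.injective _), h.prod]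

/-- Shifting the entropies of both components shifts the entropy of the mixture. -/
theorem mix_shift (h : IsLogEntropy ℓ) {α α' β β' : Type} [Fintype α] [Fintype α'] [Fintype β]
    [Fintype β'] (t : ℝ) (P : stdSimplex ℝ α) (P' : stdSimplex ℝ α') (Q : stdSimplex ℝ β)
    (Q' : stdSimplex ℝ β') {c : ℝ} (hP : ℓ α' P' = ℓ α P + c) (hQ : ℓ β' Q' = ℓ β Q + c) :
    ℓ _ (mix t P' Q') = ℓ _ (mix t P Q) + c := by
  -- An independent variable of entropy `|c|` is attached to both components: to `P`, `Q` if `c ≥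
  -- 0`, to `P'`, `Q'` if `c ≤ 0`.
  rcases le_total 0 c with hc | hc
  · obtain ⟨n, A, hA⟩ := h.exists_law hc
    rw [← hA, ← h.mix_prod]
    refine h.mix_congr _ _ _ _ t _ _ _ _ ?_ ?_
    · rw [h.prod, hA, hP]
    · rw [h.prod, hA, hQ]
  · obtain ⟨n, A, hA⟩ := h.exists_law (neg_nonneg.2 hc)
    have : ℓ _ (mix t P' Q') + ℓ _ A = ℓ _ (mix t P Q) := by
      rw [← h.mix_prod]
      refine h.mix_congr _ _ _ _ t _ _ _ _ ?_ ?_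
      · rw [h.prod, hA, hP]; ring
      · rw [h.prod, hA, hQ]; ring
    linarith

/-- The mean `m` is associated with the logarithmic entropy `ℓ`: it sends the logarithms of the
typical probabilities of two components to that of their mixture. -/
def IsMean (ℓ : ∀ (α : Type) [Fintype α], stdSimplex ℝ α → ℝ) (m : ℝ → ℝ → ℝ → ℝ) : Prop :=
  ∀ (α β : Type) [Fintype α] [Fintype β] (t : ℝ) (P : stdSimplex ℝ α) (Q : stdSimplex ℝ β)
    (c : ℝ), m t (Real.log t - ℓ α P + c) (Real.log (1 - t) - ℓ β Q + c) =
      c - ℓ (α ⊕ β) (mix t P Q)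

/-- The shift `c` is needed because entropies are nonnegative: it brings all real pairs `Y`, `Z`
within reach. Independence of the chosen laws and of `c` is `mix_shift`. -/
theorem exists_isMean (h : IsLogEntropy ℓ) : ∃ m, IsMean ℓ m := by
  have hex : ∀ t Y Z : ℝ, ∃ v, ∀ (α β : Type) [Fintype α] [Fintype β]
      (P : stdSimplex ℝ α) (Q : stdSimplex ℝ β) (c : ℝ), Real.log t - ℓ α P + c = Y →
        Real.log (1 - t) - ℓ β Q + c = Z → v = c - ℓ (α ⊕ β) (mix t P Q) := by
    intro t Y Z
    set C := max (Y - Real.log t) (Z - Real.log (1 - t))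
    obtain ⟨n, P₀, hP₀⟩ := h.exists_law (X := Real.log t - Y + C)
      (by linarith [le_max_left (Y - Real.log t) (Z - Real.log (1 - t))])
    obtain ⟨n', Q₀, hQ₀⟩ := h.exists_law (X := Real.log (1 - t) - Z + C)
      (by linarith [le_max_right (Y - Real.log t) (Z - Real.log (1 - t))])
    refine ⟨C - ℓ _ (mix t P₀ Q₀), fun α β _ _ P Q c hY hZ => ?_⟩
    have := h.mix_shift t P P₀ Q Q₀ (c := C - c) (by linarith) (by linarith)
    linarith
  choose m hm using hex
  exact ⟨m, fun α β _ _ t P Q c => hm t _ _ α β P Q c rfl rfl⟩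

variable {m : ℝ → ℝ → ℝ → ℝ}

theorem IsMean.eq (hm : IsMean ℓ m) {α β : Type} [Fintype α] [Fintype β] {t y z c : ℝ}
    {P : stdSimplex ℝ α} {Q : stdSimplex ℝ β} (hP : ℓ α P = Real.log t - y + c)
    (hQ : ℓ β Q = Real.log (1 - t) - z + c) : m t y z = c - ℓ (α ⊕ β) (mix t P Q) := by
  rw [← hm, hP, hQ]
  congr 1 <;> ring

/-- The entropy of a mixture depends continuously on the weight and on both entropies. -/
theorem exists_mix_function (h : IsLogEntropy ℓ) : ∃ F : ℝ × ℝ × ℝ → ℝ,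
    (∀ (α β : Type) [Fintype α] [Fintype β] (t : ℝ) (P : stdSimplex ℝ α) (Q : stdSimplex ℝ β),
      F (t, ℓ α P, ℓ β Q) = ℓ (α ⊕ β) (mix t P Q)) ∧
    ContinuousOn F (Ioo 0 1 ×ˢ Ioi 0 ×ˢ Ioi 0) := by
  have hF : ∀ t X Y : ℝ, ∃ v, ∀ (α β : Type) [Fintype α] [Fintype β] (P : stdSimplex ℝ α)
      (Q : stdSimplex ℝ β), ℓ α P = X → ℓ β Q = Y → v = ℓ (α ⊕ β) (mix t P Q) := by
    intro t X Y
    by_cases hex : ∃ (α β : Type) (_ : Fintype α) (_ : Fintype β) (P : stdSimplex ℝ α)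
        (Q : stdSimplex ℝ β), ℓ α P = X ∧ ℓ β Q = Y
    · obtain ⟨α, β, _, _, P, Q, rfl, rfl⟩ := hex
      exact ⟨ℓ _ (mix t P Q), fun α' β' _ _ P' Q' hP hQ =>
        h.mix_congr _ _ _ _ t P P' Q Q' hP.symm hQ.symm⟩
    · exact ⟨0, fun α β i j P Q hP hQ => absurd ⟨α, β, i, j, P, Q, hP, hQ⟩ hex⟩
  choose F hF using hF
  have hFs : ∀ (α β : Type) [Fintype α] [Fintype β] (t : ℝ) (P : stdSimplex ℝ α)
      (Q : stdSimplex ℝ β), F t (ℓ α P) (ℓ β Q) = ℓ (α ⊕ β) (mix t P Q) :=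
    fun α β _ _ t P Q => hF t _ _ α β P Q rfl rfl
  refine ⟨fun x => F x.1 x.2.1 x.2.2, hFs, ?_⟩
  rintro ⟨t, X, Y⟩ ⟨ht, hX, hY⟩
  refine ContinuousAt.continuousWithinAt ?_
  -- The extra `1` places `X` and `Y` strictly below `log n`, so that the image of the compact set
  -- `K` is a neighbourhood of `(t, X, Y)`.
  obtain ⟨n, hn, hXn⟩ := exists_log_ge (max X Y + 1)
  set K := Icc (0 : ℝ) 1 × stdSimplex ℝ (Fin n) × stdSimplex ℝ (Fin n)
  set π : K → ℝ × ℝ × ℝ := fun k => (k.1, ℓ _ k.2.1, ℓ _ k.2.2) with hπ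
  have hc : Continuous π := by
    have h1 : Continuous fun k : K => ℓ (Fin n) k.2.1 :=
      (h.cont (Fin n)).comp (continuous_fst.comp continuous_snd)
    have h2 : Continuous fun k : K => ℓ (Fin n) k.2.2 :=
      (h.cont (Fin n)).comp (continuous_snd.comp continuous_snd)
    exact (continuous_subtype_val.comp continuous_fst).prodMk (h1.prodMk h2)
  have hcF : Continuous ((fun x : ℝ × ℝ × ℝ => F x.1 x.2.1 x.2.2) ∘ π) := by
    have : ((fun x : ℝ × ℝ × ℝ => F x.1 x.2.1 x.2.2) ∘ π) =
        fun k : K => ℓ (Fin n ⊕ Fin n) (mix (k.1 : ℝ) k.2.1 k.2.2) := by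
      ext k
      exact hFs _ _ _ _ _
    rw [this]
    exact (h.cont _).comp (continuous_mix.comp
      ((continuous_subtype_val.comp continuous_fst).prodMk continuous_snd))
  refine (continuousOn_range_of_comp hc hcF).continuousAt ?_
  have hmem : Ioo (0 : ℝ) 1 ×ˢ Ioo 0 (Real.log n) ×ˢ Ioo 0 (Real.log n) ∈ 𝓝 (t, X, Y) := by
    refine prod_mem_nhds (Ioo_mem_nhds ht.1 ht.2) (prod_mem_nhds (Ioo_mem_nhds hX ?_)
      (Ioo_mem_nhds hY ?_))
    · linarith [le_max_left X Y]
    · linarith [le_max_right X Y]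
  refine mem_of_superset hmem ?_
  rintro ⟨t', X', Y'⟩ ⟨ht', hX', hY'⟩
  obtain ⟨P, hP⟩ := h.Icc_subset_range n (Ioo_subset_Icc_self hX')
  obtain ⟨Q, hQ⟩ := h.Icc_subset_range n (Ioo_subset_Icc_self hY')
  exact ⟨(⟨t', Ioo_subset_Icc_self ht'⟩, P, Q), by simp [hπ, hP, hQ]⟩

theorem continuousAt_mean (h : IsLogEntropy ℓ) (hm : IsMean ℓ m) {t : ℝ} (ht : t ∈ Ioo (0 : ℝ) 1)
    (y z : ℝ) : ContinuousAt (fun x : ℝ × ℝ × ℝ => m x.1 x.2.1 x.2.2) (t, y, z) := by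
  -- With `C` as below both entropies are at least `1` at the given point, so they stay positive
  -- nearby and one fixed `C` serves a whole neighbourhood.
  obtain ⟨F, hF, hFc⟩ := h.exists_mix_function
  set C := 1 + |Real.log t - y| + |Real.log (1 - t) - z| with hC
  set φ : ℝ × ℝ × ℝ → ℝ × ℝ × ℝ := fun x =>
    (x.1, Real.log x.1 - x.2.1 + C, Real.log (1 - x.1) - x.2.2 + C) with hφ
  have hφc : ContinuousAt φ (t, y, z) := by
    have h1 : ContinuousAt (fun x : ℝ × ℝ × ℝ => Real.log x.1) (t, y, z) :=
      continuousAt_fst.log ht.1.ne'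
    have h2 : ContinuousAt (fun x : ℝ × ℝ × ℝ => Real.log (1 - x.1)) (t, y, z) :=
      (continuousAt_const.sub continuousAt_fst).log (sub_pos.2 ht.2).ne'
    have h3 : ContinuousAt (fun x : ℝ × ℝ × ℝ => x.2.1) (t, y, z) := by fun_prop
    have h4 : ContinuousAt (fun x : ℝ × ℝ × ℝ => x.2.2) (t, y, z) := by fun_prop
    exact continuousAt_fst.prodMk (((h1.sub h3).add continuousAt_const).prodMk
      ((h2.sub h4).add continuousAt_const))
  have hU : IsOpen (Ioo (0 : ℝ) 1 ×ˢ Ioi (0 : ℝ) ×ˢ Ioi (0 : ℝ)) :=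
    isOpen_Ioo.prod (isOpen_Ioi.prod isOpen_Ioi)
  have hmem : φ (t, y, z) ∈ Ioo (0 : ℝ) 1 ×ˢ Ioi (0 : ℝ) ×ˢ Ioi (0 : ℝ) := by
    refine ⟨ht, ?_, ?_⟩
    · simp only [hφ, mem_Ioi]
      linarith [neg_abs_le (Real.log t - y), abs_nonneg (Real.log (1 - t) - z)]
    · simp only [hφ, mem_Ioi]
      linarith [abs_nonneg (Real.log t - y), neg_abs_le (Real.log (1 - t) - z)]
  have hFa : ContinuousAt F (φ (t, y, z)) := hFc.continuousAt (hU.mem_nhds hmem)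
  have hcomp : ContinuousAt (fun x => C - F (φ x)) (t, y, z) :=
    continuousAt_const.sub (hFa.comp hφc)
  refine hcomp.congr ?_
  filter_upwards [hφc.preimage_mem_nhds (hU.mem_nhds hmem)] with x hx
  obtain ⟨n, P, hP⟩ := h.exists_law (le_of_lt hx.2.1)
  obtain ⟨n', Q, hQ⟩ := h.exists_law (le_of_lt hx.2.2)
  rw [hm.eq hP hQ, ← hF, hP, hQ]

/-- The uniform law on `k + l` points is the mixture of those on `k` and on `l` points, and all its
atoms have the same probability. -/
theorem mean_idem_rat (h : IsLogEntropy ℓ) (hm : IsMean ℓ m) (k l : ℕ) [NeZero k] [NeZero l]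
    (y : ℝ) : m (k / ((k + l : ℕ) : ℝ)) y y = y := by
  have hk : (0 : ℝ) < k := Nat.cast_pos.2 (NeZero.pos k)
  have hl : (0 : ℝ) < l := Nat.cast_pos.2 (NeZero.pos l)
  have : NeZero (k + l) := ⟨by have := NeZero.pos k; omega⟩
  have hkl : (0 : ℝ) < ((k + l : ℕ) : ℝ) := Nat.cast_pos.2 (NeZero.pos _)
  have e1 : 1 - k / ((k + l : ℕ) : ℝ) = l / ((k + l : ℕ) : ℝ) := by
    field_simp; push_cast; ring
  rw [hm.eq (c := y + Real.log ((k + l : ℕ) : ℝ)) (P := (barycenter : stdSimplex ℝ (Fin k)))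
    (Q := (barycenter : stdSimplex ℝ (Fin l))), ← h.map_inj _ _ _ finSumFinEquiv.injective,
    map_finSumFinEquiv_mix, h.unif]
  · ring
  · rw [h.unif, Real.log_div hk.ne' hkl.ne']; ring
  · rw [h.unif, e1, Real.log_div hl.ne' hkl.ne']; ring

theorem exists_nat_eq_div {q : ℚ} (h0 : 0 < q) (h1 : q < 1) :
    ∃ k l : ℕ, NeZero k ∧ NeZero l ∧ (q : ℝ) = k / ((k + l : ℕ) : ℝ) := by
  have hn : 0 < q.num := Rat.num_pos.2 h0
  have hlt : q.num < q.den := Rat.num_lt_denom_iff.2 h1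
  refine ⟨q.num.toNat, q.den - q.num.toNat, ⟨by omega⟩, ⟨by omega⟩, ?_⟩
  rw [show q.num.toNat + (q.den - q.num.toNat) = q.den by omega]
  have : ((q.num.toNat : ℕ) : ℝ) = (q.num : ℝ) := by
    have : ((q.num.toNat : ℕ) : ℤ) = q.num := Int.toNat_of_nonneg hn.le
    exact_mod_cast this
  rw [this]
  exact Rat.cast_def q

/-- A continuous function on the unit interval which is constant at the rationals is constant. -/
theorem eq_of_forall_nat_div {φ : ℝ → ℝ} (hφ : ContinuousOn φ (Ioo 0 1)) {c : ℝ}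
    (h : ∀ (k l : ℕ) [NeZero k] [NeZero l], φ (k / ((k + l : ℕ) : ℝ)) = c) {t : ℝ}
    (ht : t ∈ Ioo (0 : ℝ) 1) : φ t = c := by
  by_contra hne
  have hc : ContinuousAt φ t := hφ.continuousAt (Ioo_mem_nhds ht.1 ht.2)
  have hev := (hc.eventually_ne hne).and (Ioo_mem_nhds ht.1 ht.2)
  obtain ⟨U, hU, hUo, htU⟩ := eventually_nhds_iff.1 hev
  obtain ⟨q, hq⟩ := (Rat.denseRange_cast (𝕜 := ℝ)).exists_mem_open hUo ⟨t, htU⟩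
  obtain ⟨h1, h2⟩ := hU _ hq
  obtain ⟨k, l, hk, hl, e⟩ := exists_nat_eq_div (q := q) (by exact_mod_cast h2.1)
    (by exact_mod_cast h2.2)
  rw [e] at h1
  exact h1 (h k l)

theorem mean_idem (h : IsLogEntropy ℓ) (hm : IsMean ℓ m) {t : ℝ} (ht : t ∈ Ioo (0 : ℝ) 1)
    (y : ℝ) : m t y y = y := by
  refine eq_of_forall_nat_div (φ := fun t => m t y y) (fun t ht => ?_)
    (fun k l _ _ => h.mean_idem_rat hm k l y) ht
  exact ((h.continuousAt_mean hm ht y y).comp (f := fun t : ℝ => (t, y, y))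
    (continuousAt_id.prodMk continuousAt_const)).continuousWithinAt

/-- Each property of the mean reflects an identity of laws: `comm` and `assoc` regroup the
components of a mixture, and `boundary` is continuity at the one-point law, a mixture of two points
one of whose weights vanishes. -/
theorem translationMean (h : IsLogEntropy ℓ) (hm : IsMean ℓ m) : TranslationMean m where
  trans t _ y z c := by
    set C := max (y - Real.log t) (z - Real.log (1 - t))
    obtain ⟨n, P, hP⟩ := h.exists_law (X := Real.log t - y + C)
      (by linarith [le_max_left (y - Real.log t) (z - Real.log (1 - t))])
    obtain ⟨n', Q, hQ⟩ := h.exists_law (X := Real.log (1 - t) - z + C)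
      (by linarith [le_max_right (y - Real.log t) (z - Real.log (1 - t))])
    rw [hm.eq hP hQ, hm.eq (c := C + c) (P := P) (Q := Q) (by rw [hP]; ring) (by rw [hQ]; ring)]
    ring
  comm t ht y z := by
    set C := max (y - Real.log t) (z - Real.log (1 - t))
    obtain ⟨n, P, hP⟩ := h.exists_law (X := Real.log t - y + C)
      (by linarith [le_max_left (y - Real.log t) (z - Real.log (1 - t))])
    obtain ⟨n', Q, hQ⟩ := h.exists_law (X := Real.log (1 - t) - z + C)
      (by linarith [le_max_right (y - Real.log t) (z - Real.log (1 - t))])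
    rw [hm.eq hP hQ, hm.eq (c := C) (P := Q) (Q := P) hQ (by rw [hP]; ring_nf),
      ← map_swap_mix (Ioo_subset_Icc_self ht),
      h.map_inj _ _ Sum.swap (Equiv.sumComm _ _).injective]
  assoc s hs t ht x y z := by
    have h1s : 0 < 1 - s := by linarith [hs.2]
    have h1t : 0 < 1 - t := by linarith [ht.2]
    have hst : 0 < 1 - s * t := by nlinarith [hs.1, hs.2, ht.1, ht.2]
    set A := Real.log s + Real.log t - x with hA
    set B := Real.log s + Real.log (1 - t) - y with hB
    set D := Real.log (1 - s) - z with hD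
    set C := |A| + |B| + |D|
    obtain ⟨n, P, hP⟩ := h.exists_law (X := A + C)
      (by linarith [neg_abs_le A, abs_nonneg B, abs_nonneg D])
    obtain ⟨n', Q, hQ⟩ := h.exists_law (X := B + C)
      (by linarith [neg_abs_le B, abs_nonneg A, abs_nonneg D])
    obtain ⟨n'', R, hR⟩ := h.exists_law (X := D + C)
      (by linarith [neg_abs_le D, abs_nonneg B, abs_nonneg A])
    have e1 : m t x y = C + Real.log s - ℓ _ (mix t P Q) :=
      hm.eq (by rw [hP]; ring) (by rw [hQ]; ring)
    have e2 : m s (m t x y) z = C - ℓ _ (mix s (mix t P Q) R) :=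
      hm.eq (by rw [e1]; ring) hR
    have hr : 1 - s * (1 - t) / (1 - s * t) = (1 - s) / (1 - s * t) := by
      field_simp; ring
    have e3 : m (s * (1 - t) / (1 - s * t)) y z =
        C + Real.log (1 - s * t) - ℓ _ (mix (s * (1 - t) / (1 - s * t)) Q R) := by
      refine hm.eq ?_ ?_
      · rw [hQ, Real.log_div (mul_pos hs.1 h1t).ne' hst.ne', Real.log_mul hs.1.ne' h1t.ne']; ring
      · rw [hR, hr, Real.log_div h1s.ne' hst.ne']; ring
    have e4 : m (s * t) x (m (s * (1 - t) / (1 - s * t)) y z) =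
        C - ℓ _ (mix (s * t) P (mix (s * (1 - t) / (1 - s * t)) Q R)) := by
      refine hm.eq ?_ ?_
      · rw [hP, Real.log_mul hs.1.ne' ht.1.ne']
      · rw [e3]; ring
    rw [e2, e4, ← map_sumAssoc_mix hs ht, h.map_inj _ _ _ (Equiv.injective _)]
  idem t ht y := h.mean_idem hm ht y
  cont_weight y z t ht := by
    refine ContinuousAt.continuousWithinAt ?_
    exact (h.continuousAt_mean hm ht y z).comp (f := fun t : ℝ => (t, y, z))
      (continuousAt_id.prodMk continuousAt_const)
  cont_left t ht := by
    rw [continuous_iff_continuousAt]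
    intro y
    exact (h.continuousAt_mean hm ht y 0).comp (f := fun y : ℝ => (t, y, (0 : ℝ)))
      (continuousAt_const.prodMk (continuousAt_id.prodMk continuousAt_const))
  boundary := by
    set δ : stdSimplex ℝ Unit := default
    have e : ∀ t : ℝ, m t (Real.log t) (Real.log (1 - t)) = 0 - ℓ _ (mix t δ δ) := fun t =>
      hm.eq (by rw [h.point]; ring) (by rw [h.point]; ring)
    have hc : Continuous fun t : ℝ => 0 - ℓ _ (mix t δ δ) :=
      continuous_const.sub ((h.cont _).comp (continuous_mix_left δ δ))
    have := hc.tendsto 0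
    rw [mix_zero, h.map_inj _ _ _ Sum.inr_injective, h.point, sub_zero] at this
    simp only [e]
    exact this.mono_left nhdsWithin_le_nhds

/-- A logarithmic entropy is the logarithm of `1 / max p`, the Shannon entropy, or the logarithm
of a power sum. -/
theorem classification (h : IsLogEntropy ℓ) :
    (∀ (α β : Type) [Fintype α] [Fintype β] (P : stdSimplex ℝ α) (Q : stdSimplex ℝ β),
      ∀ t ∈ Ioo (0 : ℝ) 1, -ℓ _ (mix t P Q) =
        max (Real.log t - ℓ _ P) (Real.log (1 - t) - ℓ _ Q)) ∨
    (∀ (α β : Type) [Fintype α] [Fintype β] (P : stdSimplex ℝ α) (Q : stdSimplex ℝ β),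
      ∀ t ∈ Ioo (0 : ℝ) 1, ℓ _ (mix t P Q) =
        t * (ℓ _ P - Real.log t) + (1 - t) * (ℓ _ Q - Real.log (1 - t))) ∨
    ∃ q : ℝ, 0 < q ∧ q ≠ 1 ∧
      ∀ (α β : Type) [Fintype α] [Fintype β] (P : stdSimplex ℝ α) (Q : stdSimplex ℝ β),
      ∀ t ∈ Ioo (0 : ℝ) 1, Real.exp ((1 - q) * ℓ _ (mix t P Q)) =
        t ^ q * Real.exp ((1 - q) * ℓ _ P) + (1 - t) ^ q * Real.exp ((1 - q) * ℓ _ Q) := by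
  obtain ⟨m, hm⟩ := h.exists_isMean
  have hT := h.translationMean hm
  have key : ∀ (α β : Type) [Fintype α] [Fintype β] (P : stdSimplex ℝ α) (Q : stdSimplex ℝ β)
      (t : ℝ), m t (Real.log t - ℓ _ P) (Real.log (1 - t) - ℓ _ Q) = -ℓ _ (mix t P Q) := by
    intro α β _ _ P Q t
    have := hm α β t P Q 0
    simpa using this
  by_cases hc : ∀ y z, ∀ a ∈ Ioo (0 : ℝ) 1, ∀ b ∈ Ioo (0 : ℝ) 1, m a y z = m b y z
  · left
    intro α β _ _ P Q t ht
    rw [← key, hT.eq_max hc t ht]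
  · right
    push Not at hc
    rcases hT.eq_exp_mean hc with hlin | ⟨r, hr0, hr⟩
    · left
      intro α β _ _ P Q t ht
      have := key α β P Q t
      rw [hlin t ht] at this
      linarith
    · right
      refine ⟨1 + r, by linarith [hT.exponent_gt hr], by simpa using hr0, ?_⟩
      intro α β _ _ P Q t ht
      have := hr t ht (Real.log t - ℓ _ P) (Real.log (1 - t) - ℓ _ Q)
      rw [key] at this
      have hpow : ∀ u : ℝ, 0 < u → ∀ x : ℝ, u * Real.exp (r * (Real.log u - x)) =
          u ^ (1 + r) * Real.exp ((1 - (1 + r)) * x) := by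
        intro u hu x
        rw [Real.rpow_add hu, Real.rpow_one, Real.rpow_def_of_pos hu, mul_assoc, ← Real.exp_add]
        ring_nf
      rw [hpow t ht.1, hpow (1 - t) (by linarith [ht.2])] at this
      rw [← this]
      ring_nf

end IsLogEntropy

/-! ### The Uffink functional on arbitrary finite sets and its identification with `exp ℓ` -/

namespace stdSimplex

variable {α β : Type} [Fintype α] [Fintype β]

/-- The number `uffink q P` for a law on any finite set. -/
def uff (q : ℝ≥0∞) (P : stdSimplex ℝ α) : ℝ :=
  if q = ∞ then 1 / (⨆ i, P i)
  else if q = 1 then Real.exp (-∑ i, P i * Real.log (P i))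
  else (∑ i, P i ^ q.toReal) ^ (1 / (1 - q.toReal))

theorem uff_top (P : stdSimplex ℝ α) : uff ∞ P = 1 / (⨆ i, P i) := if_pos rfl

theorem uff_one (P : stdSimplex ℝ α) : uff 1 P = Real.exp (∑ i, Real.negMulLog (P i)) := by
  rw [uff, if_neg ENNReal.one_ne_top, if_pos rfl, ← Finset.sum_neg_distrib]
  simp only [Real.negMulLog, neg_mul]

theorem uff_of_ne {q : ℝ≥0∞} (h : q ≠ ∞) (h1 : q ≠ 1) (P : stdSimplex ℝ α) :
    uff q P = (∑ i, P i ^ q.toReal) ^ (1 / (1 - q.toReal)) := by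
  rw [uff, if_neg h, if_neg h1]

theorem nonempty_index (P : stdSimplex ℝ α) : Nonempty α := by
  by_contra hne
  rw [not_nonempty_iff] at hne
  have := sum_eq_one P
  simp at this

theorem le_iSup_apply (P : stdSimplex ℝ α) (i : α) : P i ≤ ⨆ i, P i :=
  le_ciSup (finite_range _).bddAbove i

theorem exists_apply_eq_iSup (P : stdSimplex ℝ α) : ∃ i, P i = ⨆ i, P i := by
  have := nonempty_index P
  exact exists_eq_ciSup_of_finite

theorem exists_pos (P : stdSimplex ℝ α) : ∃ i, 0 < P i := by
  by_contra hne
  push Not at hne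
  have := sum_eq_one P
  rw [Finset.sum_eq_zero fun i _ => le_antisymm (hne i) (zero_le P i)] at this
  exact zero_ne_one this

theorem iSup_pos (P : stdSimplex ℝ α) : 0 < ⨆ i, P i := by
  obtain ⟨i, hi⟩ := exists_pos P
  exact hi.trans_le (le_iSup_apply P i)

theorem iSup_le_one (P : stdSimplex ℝ α) : ⨆ i, P i ≤ 1 := by
  obtain ⟨i, hi⟩ := exists_apply_eq_iSup P
  rw [← hi]
  exact le_one P i

theorem iSup_map_of_injective {ι : α → β} (hι : Function.Injective ι) (P : stdSimplex ℝ α) :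
    ⨆ y, stdSimplex.map ι P y = ⨆ x, P x := by
  classical
  apply le_antisymm
  · obtain ⟨y, hy⟩ := exists_apply_eq_iSup (stdSimplex.map ι P)
    rw [← hy]
    by_cases hr : y ∈ range ι
    · obtain ⟨x, rfl⟩ := hr
      rw [map_apply_of_injective hι]
      exact le_iSup_apply P x
    · rw [map_apply, Finset.sum_eq_zero]
      · exact (iSup_pos P).le
      · exact fun x hx => absurd ⟨x, (Finset.mem_filter.1 hx).2⟩ hr
  · obtain ⟨x, hx⟩ := exists_apply_eq_iSup P
    rw [← hx, ← map_apply_of_injective hι]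
    exact le_iSup_apply _ _

theorem iSup_mix {t : ℝ} (ht : t ∈ Icc (0 : ℝ) 1) (P : stdSimplex ℝ α) (Q : stdSimplex ℝ β) :
    ⨆ x, mix t P Q x = max (t * ⨆ a, P a) ((1 - t) * ⨆ b, Q b) := by
  have ht' : 0 ≤ 1 - t := by linarith [ht.2]
  apply le_antisymm
  · obtain ⟨x, hx⟩ := exists_apply_eq_iSup (mix t P Q)
    rw [← hx]
    rcases x with a | b
    · rw [mix_inl ht]
      exact (mul_le_mul_of_nonneg_left (le_iSup_apply P a) ht.1).trans (le_max_left _ _)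
    · rw [mix_inr ht]
      exact (mul_le_mul_of_nonneg_left (le_iSup_apply Q b) ht').trans (le_max_right _ _)
  · obtain ⟨a, ha⟩ := exists_apply_eq_iSup P
    obtain ⟨b, hb⟩ := exists_apply_eq_iSup Q
    rw [← ha, ← hb, ← mix_inl ht P Q, ← mix_inr ht P Q]
    exact max_le (le_iSup_apply _ _) (le_iSup_apply _ _)

theorem sum_rpow_pos {q : ℝ} (P : stdSimplex ℝ α) : 0 < ∑ i, P i ^ q := by
  obtain ⟨i, hi⟩ := exists_pos P
  exact Finset.sum_pos' (fun i _ => Real.rpow_nonneg (zero_le P i) q)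
    ⟨i, Finset.mem_univ i, Real.rpow_pos_of_pos hi q⟩

theorem uff_pos (q : ℝ≥0∞) (P : stdSimplex ℝ α) : 0 < uff q P := by
  unfold uff
  split_ifs
  · exact one_div_pos.2 (iSup_pos P)
  · exact Real.exp_pos _
  · exact Real.rpow_pos_of_pos (sum_rpow_pos P) _

theorem uff_map_of_injective {q : ℝ≥0∞} (hq : 0 < q) {ι : α → β} (hι : Function.Injective ι)
    (P : stdSimplex ℝ α) : uff q (stdSimplex.map ι P) = uff q P := by
  unfold uff
  split_ifs with h1 h2
  · rw [iSup_map_of_injective hι]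
  · rw [sum_map_of_injective hι P (φ := fun x => x * Real.log x) (by simp)]
  · rw [sum_map_of_injective hι P (φ := fun x => x ^ q.toReal)
      (Real.zero_rpow (ENNReal.toReal_pos hq.ne' h1).ne')]

end stdSimplex

theorem uffink_eq_uff (q : ℝ≥0∞) {n : ℕ} (P : stdSimplex ℝ (Fin n)) : uffink q P = uff q P := rfl

/-- In each case of `classification` the rule for mixtures is a recursion also satisfied by the
corresponding maximum or sum over atoms, and `law_induction` propagates the agreement from the
one-point law. -/
theorem IsLogEntropy.exists_exp_eq_uff {ℓ : ∀ (α : Type) [Fintype α], stdSimplex ℝ α → ℝ}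
    (h : IsLogEntropy ℓ) : ∃ q : ℝ≥0∞, 0 < q ∧
      ∀ (α : Type) [Fintype α] (P : stdSimplex ℝ α), Real.exp (ℓ α P) = uff q P := by
  rcases h.classification with hmax | hsh | ⟨q, hq0, hq1, hq⟩
  · refine ⟨∞, ENNReal.zero_lt_top, fun α _ P => ?_⟩
    have key : ∀ (α : Type) [Fintype α] (P : stdSimplex ℝ α), Real.exp (-ℓ α P) = ⨆ i, P i := by
      refine law_induction ?_ ?_ ?_
      · intro α β _ _ ι hι P hP
        rw [h.map_inj _ _ ι hι, iSup_map_of_injective hι, hP]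
      · rw [h.point]
        simp
      · intro α _ P t ht hP
        rw [hmax _ _ _ _ t ht, Real.exp_monotone.map_max, iSup_mix (Ioo_subset_Icc_self ht),
          h.point, ← hP, sub_eq_add_neg, sub_eq_add_neg, Real.exp_add, Real.exp_add,
          Real.exp_log ht.1, Real.exp_log (by linarith [ht.2])]
        simp
    rw [uff_top, ← key, Real.exp_neg, one_div, inv_inv]
  · refine ⟨1, one_pos, fun α _ P => ?_⟩
    have key : ∀ (α : Type) [Fintype α] (P : stdSimplex ℝ α),
        ℓ α P = ∑ i, Real.negMulLog (P i) := by
      refine law_induction ?_ ?_ ?_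
      · intro α β _ _ ι hι P hP
        rw [h.map_inj _ _ ι hι, sum_map_of_injective hι P Real.negMulLog_zero, hP]
      · rw [h.point]
        simp
      · intro α _ P t ht hP
        rw [hsh _ _ _ _ t ht, Fintype.sum_sum_type]
        simp only [mix_inl (Ioo_subset_Icc_self ht), mix_inr (Ioo_subset_Icc_self ht),
          Real.negMulLog_mul, Finset.sum_add_distrib, ← Finset.mul_sum, ← Finset.sum_mul,
          sum_eq_one]
        rw [h.point, hP]
        simp [Real.negMulLog]
        ring
    rw [uff_one, key]
  · refine ⟨ENNReal.ofReal q, ENNReal.ofReal_pos.2 hq0, fun α _ P => ?_⟩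
    have key : ∀ (α : Type) [Fintype α] (P : stdSimplex ℝ α),
        Real.exp ((1 - q) * ℓ α P) = ∑ i, P i ^ q := by
      refine law_induction ?_ ?_ ?_
      · intro α β _ _ ι hι P hP
        rw [h.map_inj _ _ ι hι, sum_map_of_injective hι P (φ := fun x => x ^ q)
          (Real.zero_rpow hq0.ne'), hP]
      · rw [h.point]
        simp
      · intro α _ P t ht hP
        have h1 : 0 ≤ 1 - t := by linarith [ht.2]
        rw [hq _ _ _ _ t ht, Fintype.sum_sum_type, h.point, hP]
        simp only [mix_inl (Ioo_subset_Icc_self ht), mix_inr (Ioo_subset_Icc_self ht),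
          Real.mul_rpow ht.1.le (zero_le _ _), Real.mul_rpow h1 (zero_le P _), ← Finset.mul_sum]
        simp
    have h1q : 1 - q ≠ 0 := sub_ne_zero.2 hq1.symm
    rw [uff_of_ne ENNReal.ofReal_ne_top (by simpa [ENNReal.ofReal_eq_one] using hq1),
      ENNReal.toReal_ofReal hq0.le, ← key, ← Real.exp_mul]
    congr 1
    field_simp

/-! ### From the axioms to a logarithmic entropy -/

/-- The value of an entropic functional at a law on any finite set. -/
def EntropicFunctional.onType (S : EntropicFunctional) (α : Type) [Fintype α]
    (P : stdSimplex ℝ α) : ℝ :=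
  S (Fintype.card α) (stdSimplex.map (Fintype.equivFin α) P)

/-- Completely additive monotone functions on the positive integers are multiples of the
logarithm. -/
theorem eq_mul_log_of_additive {L : ℕ → ℝ} (hmul : ∀ k l, 0 < k → 0 < l → L (k * l) = L k + L l)
    (hmono : ∀ k l, 0 < k → k ≤ l → L k ≤ L l) {n : ℕ} (hn : 0 < n) :
    L n = L 2 / Real.log 2 * Real.log n := by
  have hl2 : 0 < Real.log 2 := Real.log_pos one_lt_two
  have h1 : L 1 = 0 := by have := hmul 1 1 one_pos one_pos; rw [mul_one] at this; linarith
  have hpow : ∀ k j : ℕ, 0 < k → L (k ^ j) = j * L k := by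
    intro k j hk
    induction j with
    | zero => simp [h1]
    | succ j ih => rw [pow_succ, hmul _ _ (pow_pos hk j) hk, ih]; push_cast; ring
  have h2 : 0 ≤ L 2 := h1 ▸ hmono 1 2 one_pos one_le_two
  have key : ∀ j : ℕ, |j * (L n * Real.log 2 - L 2 * Real.log n)| ≤ L 2 * Real.log 2 := by
    intro j
    have hnj : 0 < n ^ j := pow_pos hn j
    -- Since `n ^ j` lies between consecutive powers of `2`, the error in `j * L n` is bounded
    -- independently of `j`.
    set i := Nat.log 2 (n ^ j) with hi
    have a1 : 2 ^ i ≤ n ^ j := Nat.pow_log_le_self 2 hnj.ne'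
    have a2 : n ^ j < 2 ^ (i + 1) := Nat.lt_pow_succ_log_self one_lt_two _
    have b1 := hmono _ _ (pow_pos two_pos i) a1
    have b2 := hmono _ _ hnj a2.le
    rw [hpow 2 _ two_pos, hpow n _ hn] at b1 b2
    have c1 : (i : ℝ) * Real.log 2 ≤ j * Real.log n := by
      rw [← Real.log_pow, ← Real.log_pow]
      exact Real.log_le_log (by positivity) (by exact_mod_cast a1)
    have c2 : (j : ℝ) * Real.log n ≤ ((i + 1 : ℕ) : ℝ) * Real.log 2 := by
      rw [← Real.log_pow, ← Real.log_pow]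
      exact Real.log_le_log (by positivity) (by exact_mod_cast a2.le)
    push_cast at b2 c2
    rw [abs_le]
    constructor <;> nlinarith
  have := eq_zero_of_forall_nat_mul_le key
  field_simp
  linarith

namespace ShannonKhinchin

variable {f : ℝ → ℝ} {S : EntropicFunctional}

/-- Every injection of `Fin n` is the initial inclusion followed by a permutation; these are handled
by expandability and symmetry. -/
theorem apply_map (h : ShannonKhinchin f S) {n m : ℕ} {ι : Fin n → Fin m}
    (hι : Function.Injective ι) (P : stdSimplex ℝ (Fin n)) :
    S m (stdSimplex.map ι P) = S n P := by
  obtain ⟨k, rfl⟩ := Nat.exists_eq_add_of_le (by simpa using Fintype.card_le_of_injective ι hι)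
  have hcast : ∀ k : ℕ, S (n + k) (stdSimplex.map (Fin.castAdd k) P) = S n P := by
    intro k
    induction k with
    | zero =>
      rw [show Fin.castAdd 0 = (id : Fin n → Fin n) from rfl]
      exact congrArg _ (map_id_apply P)
    | succ k ih =>
      rw [← ih]
      refine h.expandable (n + k) _ _ (fun i => ?_) ?_
      · rw [show Fin.castAdd (k + 1) = (Fin.castSucc ∘ Fin.castAdd k : Fin n → Fin (n + k + 1))
          from rfl, ← map_comp_apply, map_apply_of_injective (Fin.castSucc_injective _)]
      · rw [stdSimplex.map_apply, Finset.sum_eq_zero]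
        intro x hx
        have := (Finset.mem_filter.1 hx).2
        rw [Fin.ext_iff] at this
        simp at this
        omega
  obtain ⟨σ, hσ⟩ := Equiv.Perm.exists_extending_pair (Fin.castAdd k) ι
    (Fin.castAdd_injective n k) hι
  have : ι = σ ∘ Fin.castAdd k := by
    ext x
    simp [← hσ]
  rw [this, ← map_comp_apply, h.symmetric, hcast]

theorem onType_map (h : ShannonKhinchin f S) {α β : Type} [Fintype α] [Fintype β] {ι : α → β}
    (hι : Function.Injective ι) (P : stdSimplex ℝ α) :
    S.onType β (stdSimplex.map ι P) = S.onType α P := by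
  unfold EntropicFunctional.onType
  have : stdSimplex.map (Fintype.equivFin β) (stdSimplex.map ι P) =
      stdSimplex.map (Fintype.equivFin β ∘ ι ∘ (Fintype.equivFin α).symm)
        (stdSimplex.map (Fintype.equivFin α) P) := by
    rw [map_comp_apply, map_comp_apply]
    congr 1
    ext x
    simp
  rw [this, h.apply_map]
  exact (Fintype.equivFin β).injective.comp (hι.comp (Fintype.equivFin α).symm.injective)

theorem onType_fin (h : ShannonKhinchin f S) {n : ℕ} (P : stdSimplex ℝ (Fin n)) :
    S.onType (Fin n) P = S n P :=
  h.apply_map (Fintype.equivFin (Fin n)).injective P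

theorem joint_eq (h : ShannonKhinchin f S) {n m : ℕ} (R : stdSimplex ℝ (Fin n × Fin m)) :
    S.joint R = S.onType (Fin n × Fin m) R := by
  rw [← h.onType_map finProdFinEquiv.injective, h.onType_fin]
  rfl

theorem continuous_onType (h : ShannonKhinchin f S) (α : Type) [Fintype α] :
    Continuous (S.onType α) := (h.continuous _).comp (continuous_map _)

/-- The coordinate of a law in the domain of `f`. -/
def coord (f : ℝ → ℝ) (x : ℝ) : ℝ := Function.invFunOn f (Ici 0) x

theorem coord_apply (h : ShannonKhinchin f S) {x : ℝ} (hx : 0 ≤ x) : coord f (f x) = x :=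
  h.injOn.leftInvOn_invFunOn hx

theorem coord_nonneg {x : ℝ} (hx : x ∈ f '' Ici 0) : 0 ≤ coord f x :=
  Function.invFunOn_mem hx

theorem apply_coord {x : ℝ} (hx : x ∈ f '' Ici 0) : f (coord f x) = x :=
  Function.invFunOn_eq hx

theorem onType_mem (h : ShannonKhinchin f S) {α : Type} [Fintype α] (P : stdSimplex ℝ α) :
    S.onType α P ∈ f '' Ici 0 := h.composable.1 _ _

theorem coord_onType_nonneg (h : ShannonKhinchin f S) {α : Type} [Fintype α]
    (P : stdSimplex ℝ α) : 0 ≤ coord f (S.onType α P) := coord_nonneg (h.onType_mem P)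

theorem coord_knMul (h : ShannonKhinchin f S) {x y : ℝ} (hx : x ∈ f '' Ici 0)
    (hy : y ∈ f '' Ici 0) : coord f (knMul f x y) = coord f x * coord f y :=
  h.coord_apply (mul_nonneg (coord_nonneg hx) (coord_nonneg hy))

theorem margB_prodLaw {n m : ℕ} (P : stdSimplex ℝ (Fin n)) (Q : stdSimplex ℝ (Fin m)) :
    margB (prodLaw P Q) = Q := by
  ext j
  rw [margB_apply]
  simp only [prodLaw_apply, ← Finset.sum_mul, sum_eq_one, one_mul]

theorem margA_prodLaw {n m : ℕ} (P : stdSimplex ℝ (Fin n)) (Q : stdSimplex ℝ (Fin m)) :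
    margA (prodLaw P Q) = P := by
  ext i
  rw [margA, stdSimplex.map_apply, Finset.sum_filter, Fintype.sum_prod_type_right]
  simp [prodLaw_apply, ← Finset.mul_sum]

theorem onType_prodLaw (h : ShannonKhinchin f S) {α β : Type} [Fintype α] [Fintype β]
    (P : stdSimplex ℝ α) (Q : stdSimplex ℝ β) :
    S.onType (α × β) (prodLaw P Q) = knMul f (S.onType α P) (S.onType β Q) := by
  set P' := stdSimplex.map (Fintype.equivFin α) P with hP'
  set Q' := stdSimplex.map (Fintype.equivFin β) Q with hQ'
  obtain ⟨-, C, -, -, hind, -⟩ := h.composable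
  have h1 := hind _ _ (prodLaw P' Q') fun i j => by
    rw [margA_prodLaw, margB_prodLaw, prodLaw_apply]
  rw [margA_prodLaw, margB_prodLaw, h.joint_eq] at h1
  have hinj : Function.Injective (Prod.map (Fintype.equivFin α) (Fintype.equivFin β)) :=
    (Fintype.equivFin α).injective.prodMap (Fintype.equivFin β).injective
  rw [← h.onType_map hinj, map_eq_of_injective hinj (Q := prodLaw P' Q'), h1]
  · rfl
  · intro x
    rw [prodLaw_apply, prodLaw_apply, hP', hQ']
    exact congrArg₂ _ (map_apply_of_injective (Fintype.equivFin α).injective P x.1)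
      (map_apply_of_injective (Fintype.equivFin β).injective Q x.2)

theorem coord_prodLaw (h : ShannonKhinchin f S) {α β : Type} [Fintype α] [Fintype β]
    (P : stdSimplex ℝ α) (Q : stdSimplex ℝ β) :
    coord f (S.onType (α × β) (prodLaw P Q)) =
      coord f (S.onType α P) * coord f (S.onType β Q) := by
  rw [h.onType_prodLaw, h.coord_knMul (h.onType_mem P) (h.onType_mem Q)]

/-- If the entropy of a coarse-graining has coordinate zero, so has the entropy of the law. -/
theorem coord_eq_zero_of_map (h : ShannonKhinchin f S) {α β : Type} [Fintype α] [Fintype β]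
    (R : stdSimplex ℝ α) (g : α → β) (h0 : coord f (S.onType β (stdSimplex.map g R)) = 0) :
    coord f (S.onType α R) = 0 := by
  obtain ⟨-, C, hC, hjoint, -, -⟩ := h.composable
  -- The pair of a variable and its coarse-graining lives on the graph of `g`, so its joint entropy
  -- is that of `R`, and composability supplies the zero factor.
  set ι : α → Fin (Fintype.card α) × Fin (Fintype.card β) :=
    fun a => (Fintype.equivFin α a, Fintype.equivFin β (g a)) with hι
  have hinj : Function.Injective ι := fun a b hab =>
    (Fintype.equivFin α).injective (Prod.ext_iff.1 hab).1
  have h1 := hjoint _ _ (stdSimplex.map ι R)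
  have h2 : margB (stdSimplex.map ι R) = stdSimplex.map (Fintype.equivFin β)
      (stdSimplex.map g R) := by
    rw [margB, map_comp_apply, map_comp_apply]
    rfl
  rw [h.joint_eq, h.onType_map hinj, h2] at h1
  rw [h1]
  change coord f (knMul f _ (S.onType β _)) = 0
  rw [h.coord_knMul (hC _ _ _) (h.onType_mem _), h0, mul_zero]

/-- A mixture, as the joint law of the mixed variable and of the index of its component. -/
def mixJoint {k : ℕ} (t : ℝ) (P Q : stdSimplex ℝ (Fin k)) : stdSimplex ℝ (Fin k × Fin 2) :=
  ⟨fun x => if x.2 = 0 then clamp t * P x.1 else (1 - clamp t) * Q x.1, by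
    refine ⟨fun x => ?_, ?_⟩
    · beta_reduce
      split_ifs
      · exact mul_nonneg (clamp_nonneg t) (zero_le P _)
      · exact mul_nonneg (sub_nonneg.2 (clamp_le_one t)) (zero_le Q _)
    · rw [Fintype.sum_prod_type_right, Fin.sum_univ_two]
      simp [← Finset.mul_sum]⟩

theorem mixJoint_zero {k : ℕ} (t : ℝ) (P Q : stdSimplex ℝ (Fin k)) (i : Fin k) :
    mixJoint t P Q (i, 0) = clamp t * P i := rfl

theorem mixJoint_one {k : ℕ} (t : ℝ) (P Q : stdSimplex ℝ (Fin k)) (i : Fin k) :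
    mixJoint t P Q (i, 1) = (1 - clamp t) * Q i := rfl

theorem margB_mixJoint_zero {k : ℕ} (t : ℝ) (P Q : stdSimplex ℝ (Fin k)) :
    margB (mixJoint t P Q) 0 = clamp t := by
  simp only [margB_apply, mixJoint_zero, ← Finset.mul_sum, sum_eq_one, mul_one]

theorem margB_mixJoint_one {k : ℕ} (t : ℝ) (P Q : stdSimplex ℝ (Fin k)) :
    margB (mixJoint t P Q) 1 = 1 - clamp t := by
  simp only [margB_apply, mixJoint_one, ← Finset.mul_sum, sum_eq_one, mul_one]

theorem condLaw_mixJoint_zero {k : ℕ} (t : ℝ) (P Q : stdSimplex ℝ (Fin k))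
    (h0 : 0 < margB (mixJoint t P Q) 0) : condLaw (mixJoint t P Q) 0 h0 = P := by
  ext i
  change mixJoint t P Q (i, 0) / margB (mixJoint t P Q) 0 = P i
  rw [mixJoint_zero]
  rw [margB_mixJoint_zero] at h0 ⊢
  field_simp

theorem condLaw_mixJoint_one {k : ℕ} (t : ℝ) (P Q : stdSimplex ℝ (Fin k))
    (h0 : 0 < margB (mixJoint t P Q) 1) : condLaw (mixJoint t P Q) 1 h0 = Q := by
  ext i
  change mixJoint t P Q (i, 1) / margB (mixJoint t P Q) 1 = Q i
  rw [mixJoint_one]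
  rw [margB_mixJoint_one] at h0 ⊢
  field_simp

/-- The joint entropy only depends on the law of `B` and on the conditional entropies. -/
theorem joint_congr (h : ShannonKhinchin f S) {n m : ℕ} (R R' : stdSimplex ℝ (Fin n × Fin m))
    (hB : margB R = margB R')
    (hc : ∀ j hj hj', S n (condLaw R j hj) = S n (condLaw R' j hj')) :
    S.joint R = S.joint R' := by
  obtain ⟨-, C, -, hjoint, -, G, hG⟩ := h.composable
  have key : ∀ (Q₁ Q₂ : stdSimplex ℝ (Fin m)) (_ : Q₁ = Q₂) (v₁ : {j : Fin m // 0 < Q₁ j} → ℝ)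
      (v₂ : {j : Fin m // 0 < Q₂ j} → ℝ), (∀ j h₁ h₂, v₁ ⟨j, h₁⟩ = v₂ ⟨j, h₂⟩) →
      G m Q₁ v₁ = G m Q₂ v₂ := by
    rintro Q₁ _ rfl v₁ v₂ hv
    congr 1
    ext ⟨j, hj⟩
    exact hv j hj hj
  rw [hjoint, hjoint, hG, hG, key _ _ hB _
    (fun j => S n (condLaw R' j.1 j.2)) (fun j hj hj' => hc j hj hj'), hB]

theorem tag_injective (k : ℕ) : Function.Injective
    (Sum.elim (fun i => (i, 0)) (fun i => (i, 1)) : Fin k ⊕ Fin k → Fin k × Fin 2) := by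
  rintro (a | a) (b | b) hab <;> simp_all

theorem map_tag_mix {k : ℕ} (t : ℝ) (P Q : stdSimplex ℝ (Fin k)) :
    stdSimplex.map (Sum.elim (fun i => (i, 0)) (fun i => (i, 1)) : _ → Fin k × Fin 2)
      (mix t P Q) = mixJoint t P Q := by
  refine map_eq_of_injective (tag_injective k) ?_
  rintro (a | a) <;> rfl

theorem onType_mix_eq_joint (h : ShannonKhinchin f S) {k : ℕ} (t : ℝ)
    (P Q : stdSimplex ℝ (Fin k)) : S.onType _ (mix t P Q) = S.joint (mixJoint t P Q) := by
  rw [h.joint_eq, ← h.onType_map (tag_injective k), map_tag_mix]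

theorem map_sumMap_mix {α α' β β' : Type} [Fintype α] [Fintype α'] [Fintype β] [Fintype β']
    {ι : α → α'} {κ : β → β'} (hι : Function.Injective ι) (hκ : Function.Injective κ) (t : ℝ)
    (P : stdSimplex ℝ α) (Q : stdSimplex ℝ β) :
    stdSimplex.map (Sum.map ι κ) (mix t P Q) =
      mix t (stdSimplex.map ι P) (stdSimplex.map κ Q) := by
  refine map_eq_of_injective (hι.sumMap hκ) ?_
  rintro (a | b)
  · rw [Sum.map_inl, mix_inl', mix_inl', map_apply_of_injective hι]
  · rw [Sum.map_inr, mix_inr', mix_inr', map_apply_of_injective hκ]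

theorem onType_mix_congr (h : ShannonKhinchin f S) {α α' β β' : Type} [Fintype α] [Fintype α']
    [Fintype β] [Fintype β'] (t : ℝ) (P : stdSimplex ℝ α) (P' : stdSimplex ℝ α')
    (Q : stdSimplex ℝ β) (Q' : stdSimplex ℝ β') (hP : S.onType α P = S.onType α' P')
    (hQ : S.onType β Q = S.onType β' Q') :
    S.onType _ (mix t P Q) = S.onType _ (mix t P' Q') := by
  -- All conditional laws of a joint law share one alphabet, so the four laws are first placed in a
  -- common finite set.
  let ε := Fintype.equivFin ((α ⊕ α') ⊕ (β ⊕ β'))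
  have i1 : Function.Injective (ε ∘ Sum.inl ∘ Sum.inl) :=
    ε.injective.comp (Sum.inl_injective.comp Sum.inl_injective)
  have i2 : Function.Injective (ε ∘ Sum.inl ∘ Sum.inr) :=
    ε.injective.comp (Sum.inl_injective.comp Sum.inr_injective)
  have i3 : Function.Injective (ε ∘ Sum.inr ∘ Sum.inl) :=
    ε.injective.comp (Sum.inr_injective.comp Sum.inl_injective)
  have i4 : Function.Injective (ε ∘ Sum.inr ∘ Sum.inr) :=
    ε.injective.comp (Sum.inr_injective.comp Sum.inr_injective)
  rw [← h.onType_map (i1.sumMap i3), map_sumMap_mix i1 i3, ← h.onType_map (i2.sumMap i4),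
    map_sumMap_mix i2 i4, h.onType_mix_eq_joint, h.onType_mix_eq_joint]
  refine h.joint_congr _ _ ?_ ?_
  · ext j
    fin_cases j
    · exact (margB_mixJoint_zero _ _ _).trans (margB_mixJoint_zero _ _ _).symm
    · exact (margB_mixJoint_one _ _ _).trans (margB_mixJoint_one _ _ _).symm
  · intro j hj hj'
    fin_cases j
    · refine (congrArg _ (condLaw_mixJoint_zero _ _ _ _)).trans
        (Eq.trans ?_ (congrArg _ (condLaw_mixJoint_zero _ _ _ _)).symm)
      rw [← h.onType_fin, ← h.onType_fin, h.onType_map i1, h.onType_map i2, hP]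
    · refine (congrArg _ (condLaw_mixJoint_one _ _ _ _)).trans
        (Eq.trans ?_ (congrArg _ (condLaw_mixJoint_one _ _ _ _)).symm)
      rw [← h.onType_fin, ← h.onType_fin, h.onType_map i3, h.onType_map i4, hQ]

/-- Pairing with a sure event changes nothing, so its coordinate is a unit for every coordinate.
Were it not `1`, all coordinates would vanish and `S` would be constant. -/
theorem coord_point (h : ShannonKhinchin f S) :
    coord f (S.onType Unit default) = 1 := by
  set δ : stdSimplex ℝ Unit := default
  have hP : ∀ (n : ℕ) (P : stdSimplex ℝ (Fin n)),
      coord f (S n P) = coord f (S n P) * coord f (S.onType Unit δ) := by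
    intro n P
    have hinj : Function.Injective fun a : Fin n => (a, ()) := fun a b hab => by simpa using hab
    have h1 : stdSimplex.map (fun a : Fin n => (a, ())) P = prodLaw P δ :=
      map_eq_of_injective hinj fun x => by
        rw [prodLaw_apply, eq_one_of_unique δ, mul_one]
    rw [← h.onType_fin, ← h.coord_prodLaw, ← h1, h.onType_map hinj]
  by_contra hne
  have h0 : ∀ (n : ℕ) (P : stdSimplex ℝ (Fin n)), S n P = f 0 := by
    intro n P
    have h1 : coord f (S n P) * (coord f (S.onType Unit δ) - 1) = 0 := by linarith [hP n P]
    rw [← apply_coord (h.composable.1 n P), (mul_eq_zero.1 h1).resolve_right (sub_ne_zero.2 hne)]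
  obtain ⟨n, m, P, Q, hPQ⟩ := h.nonconstant
  exact hPQ ((h0 n P).trans (h0 m Q).symm)

/-- The law of `X`, if it is not the first atom, and else of an independent copy of `X`. -/
theorem map_retry {α : Type} [Fintype α] (P : stdSimplex ℝ α) {r : ℝ} (hr : r ∈ Icc (0 : ℝ) 1) :
    stdSimplex.map (fun x : (Unit ⊕ α) × (Unit ⊕ α) => Sum.elim (fun _ => x.2) Sum.inr x.1)
      (prodLaw (mix r (default : stdSimplex ℝ Unit) P) (mix r (default : stdSimplex ℝ Unit) P)) =
      mix (r ^ 2) (default : stdSimplex ℝ Unit) P := by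
  classical
  have hr2 : r ^ 2 ∈ Icc (0 : ℝ) 1 := ⟨sq_nonneg r, pow_le_one₀ hr.1 hr.2⟩
  set M := mix r (default : stdSimplex ℝ Unit) P with hM
  ext z
  rw [stdSimplex.map_apply, Finset.sum_filter, Fintype.sum_prod_type, Fintype.sum_sum_type,
    Fintype.sum_unique]
  have e1 : ∀ (x : Unit ⊕ α) (p : Prop) [Decidable p],
      ∑ y, (if p then prodLaw M M (x, y) else 0) = if p then M x else 0 := by
    intro x p _
    split_ifs
    · simp only [prodLaw_apply, ← Finset.mul_sum, sum_eq_one, mul_one]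
    · simp
  refine (congrArg₂ (· + ·) (?_ : _ = M (Sum.inl ()) * M z)
    (Finset.sum_congr rfl fun a _ => e1 (Sum.inr a) (Sum.inr a = z))).trans ?_
  · refine (Finset.sum_eq_single z ?_ ?_).trans ?_
    · exact fun y _ hy => if_neg hy
    · exact fun hz => absurd (Finset.mem_univ z) hz
    · exact if_pos rfl
  rcases z with u | b
  · simp [hM, mix_inl hr, mix_inl hr2]
    ring
  · simp [hM, mix_inl hr, mix_inr hr, mix_inr hr2]
    ring

/-- A zero at weight `t` of the extra atom passes to weight `√t`: by `map_retry` the law is a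
coarse-graining of two independent copies of the law at weight `√t`. Iterated roots tend to `1`,
where the law is a sure event with coordinate `1`. -/
theorem coord_pos (h : ShannonKhinchin f S) :
    ∀ (α : Type) [Fintype α] (P : stdSimplex ℝ α), 0 < coord f (S.onType α P) := by
  refine law_induction ?_ ?_ ?_
  · intro α β _ _ ι hι P hP
    rwa [h.onType_map hι]
  · rw [h.coord_point]
    exact one_pos
  · intro α _ P t ht _
    set δ : stdSimplex ℝ Unit := default
    refine lt_of_le_of_ne (h.coord_onType_nonneg _) fun h0 => ?_
    have hstep : ∀ r ∈ Icc (0 : ℝ) 1, coord f (S.onType _ (mix (r ^ 2) δ P)) = 0 →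
        coord f (S.onType _ (mix r δ P)) = 0 := by
      intro r hr hr0
      rw [← map_retry P hr] at hr0
      have := h.coord_eq_zero_of_map _ _ hr0
      rw [h.coord_prodLaw] at this
      exact mul_self_eq_zero.1 this
    have hmem : ∀ x : ℝ, 0 ≤ x → t ^ x ∈ Icc (0 : ℝ) 1 := fun x hx =>
      ⟨Real.rpow_nonneg ht.1.le x, Real.rpow_le_one ht.1.le ht.2.le hx⟩
    have hall : ∀ k : ℕ, coord f (S.onType _ (mix (t ^ ((1 / 2 : ℝ) ^ k)) δ P)) = 0 := by
      intro k
      induction k with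
      | zero => simpa using h0.symm
      | succ k ih =>
        refine hstep _ (hmem _ (by positivity)) ?_
        rw [← Real.rpow_natCast, ← Real.rpow_mul ht.1.le]
        convert ih using 5
        rw [pow_succ]
        push_cast
        ring
    -- The limit is taken in the values of `S`, because `coord f` need not be continuous.
    have hall' : ∀ k : ℕ, S.onType _ (mix (t ^ ((1 / 2 : ℝ) ^ k)) δ P) = f 0 := fun k => by
      rw [← apply_coord (h.onType_mem _), hall k]
    have hlim : Tendsto (fun k : ℕ => t ^ ((1 / 2 : ℝ) ^ k)) atTop (𝓝 1) := by
      have h1 : Tendsto (fun k : ℕ => (1 / 2 : ℝ) ^ k) atTop (𝓝 0) :=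
        tendsto_pow_atTop_nhds_zero_of_lt_one (by norm_num) (by norm_num)
      have h2 := (Real.continuousAt_const_rpow (b := 0) ht.1.ne').tendsto.comp h1
      rwa [Real.rpow_zero] at h2
    have h3 := (((h.continuous_onType _).comp (continuous_mix_left δ P)).tendsto 1).comp hlim
    have h4 : S.onType _ (mix 1 δ P) = f 0 :=
      tendsto_nhds_unique h3 (tendsto_const_nhds.congr fun k => (hall' k).symm)
    rw [mix_one, h.onType_map Sum.inl_injective] at h4
    have h5 := h.coord_point
    rw [h4, h.coord_apply le_rfl] at h5
    exact zero_ne_one h5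

/-- The values of an entropic functional. -/
def values (S : EntropicFunctional) : Set ℝ := {x | ∃ n, ∃ P : stdSimplex ℝ (Fin n), S n P = x}

theorem onType_mem_values (S : EntropicFunctional) {α : Type} [Fintype α] (P : stdSimplex ℝ α) :
    S.onType α P ∈ values S := ⟨_, _, rfl⟩

theorem exists_common (h : ShannonKhinchin f S) {x y : ℝ} (hx : x ∈ values S)
    (hy : y ∈ values S) : ∃ n, NeZero n ∧ ∃ P Q : stdSimplex ℝ (Fin n), S n P = x ∧ S n Q = y := by
  obtain ⟨n, P, rfl⟩ := hx
  obtain ⟨m, Q, rfl⟩ := hy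
  obtain ⟨i⟩ := nonempty_index P
  have hn : n ≤ max n m := le_max_left _ _
  have hm : m ≤ max n m := le_max_right _ _
  refine ⟨max n m, ⟨(i.pos.trans_le hn).ne'⟩, stdSimplex.map (Fin.castLE hn) P,
    stdSimplex.map (Fin.castLE hm) Q, ?_, ?_⟩
  · rw [h.apply_map (Fin.castLE_injective _)]
  · rw [h.apply_map (Fin.castLE_injective _)]

theorem exists_Icc_subset_range (h : ShannonKhinchin f S) {x y : ℝ} (hx : x ∈ values S)
    (hy : y ∈ values S) : ∃ n, NeZero n ∧ Icc x y ⊆ range (S n) := by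
  obtain ⟨n, hn, P, Q, rfl, rfl⟩ := h.exists_common hx hy
  exact ⟨n, hn, intermediate_value_univ P Q (h.continuous n)⟩

/-- Continuity of the product comes from continuity of `S` on product laws: on each interval of
values the product factors through a compact simplex. -/
theorem intervalMonoid (h : ShannonKhinchin f S) : IntervalMonoid (values S) (knMul f)
    (fun x => Real.log (coord f x)) (S.onType Unit default) where
  ordConnected := ⟨fun x hx y hy z hz => by
    obtain ⟨n, -, hsub⟩ := h.exists_Icc_subset_range hx hy
    obtain ⟨P, hP⟩ := hsub hz
    exact ⟨n, P, hP⟩⟩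
  one_mem := onType_mem_values S _
  op_mem := by
    rintro _ ⟨n, P, rfl⟩ _ ⟨m, Q, rfl⟩
    rw [← h.onType_fin, ← h.onType_fin, ← h.onType_prodLaw]
    exact onType_mem_values S _
  injOn := by
    rintro _ ⟨n, P, rfl⟩ _ ⟨m, Q, rfl⟩ hPQ
    rw [← h.onType_fin, ← h.onType_fin] at hPQ ⊢
    have := Real.log_injOn_pos (h.coord_pos _ P) (h.coord_pos _ Q) hPQ
    rw [← apply_coord (h.onType_mem P), this, apply_coord (h.onType_mem Q)]
  map_op := by
    rintro _ ⟨n, P, rfl⟩ _ ⟨m, Q, rfl⟩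
    rw [← h.onType_fin, ← h.onType_fin, h.coord_knMul (h.onType_mem P) (h.onType_mem Q),
      Real.log_mul (h.coord_pos _ P).ne' (h.coord_pos _ Q).ne']
  map_one := by rw [h.coord_point, Real.log_one]
  cont := by
    rintro _ ⟨n, P, rfl⟩ u hu v hv
    obtain ⟨N, -, hsub⟩ := h.exists_Icc_subset_range hu hv
    refine (continuousOn_range_of_comp (h.continuous N) ?_).mono hsub
    have : knMul f (S n P) ∘ S N = fun Q => S.onType (Fin n × Fin N) (prodLaw P Q) := by
      ext Q
      rw [h.onType_prodLaw, h.onType_fin, h.onType_fin]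
      rfl
    rw [this]
    exact (h.continuous_onType _).comp
      (continuous_prodLaw.comp ((continuous_const (y := P)).prodMk continuous_id))

theorem unif_mono (h : ShannonKhinchin f S) {n m : ℕ} [NeZero n] [NeZero m] (hnm : n ≤ m) :
    S n barycenter ≤ S m barycenter := by
  rw [← h.apply_map (Fin.castLE_injective hnm)]
  exact h.maximal m _ _ fun i => by rw [barycenter_eval, Fintype.card_fin, one_div]

theorem unif_mul (h : ShannonKhinchin f S) (n m : ℕ) [NeZero n] [NeZero m] [NeZero (n * m)] :
    S (n * m) barycenter = knMul f (S n barycenter) (S m barycenter) := by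
  rw [← h.onType_fin, ← h.onType_fin, ← h.onType_fin, ← h.onType_prodLaw,
    ← h.onType_map finProdFinEquiv.injective, map_eq_of_injective finProdFinEquiv.injective]
  intro x
  rw [prodLaw_apply, barycenter_eval, barycenter_eval, barycenter_eval]
  simp [mul_comm]

theorem unif_one (h : ShannonKhinchin f S) : S 1 barycenter = S.onType Unit default := by
  rw [← h.onType_map (ι := fun _ : Unit => (0 : Fin 1)) (Function.injective_of_subsingleton _),
    h.onType_fin]
  congr 1
  exact Subsingleton.elim _ _

/-- The entropy of a fair coin exceeds that of a sure event. -/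
theorem point_lt_unif_two (h : ShannonKhinchin f S) :
    S.onType Unit default < S 2 barycenter := by
  have hI := h.intervalMonoid
  refine lt_of_le_of_ne (h.unif_one ▸ h.unif_mono one_le_two) fun he => ?_
  set δ : stdSimplex ℝ Unit := default
  set e := S.onType Unit δ
  have hpow : ∀ k : ℕ, S (2 ^ k) barycenter = e := by
    intro k
    induction k with
    | zero => exact h.unif_one
    | succ k ih =>
      have : NeZero (2 ^ k * 2) := ⟨by positivity⟩
      have h2 := h.unif_mul (2 ^ k) 2
      rw [ih, ← he, hI.one_op hI.one_mem] at h2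
      exact h2
  have hunif : ∀ (n : ℕ) [NeZero n], S n barycenter = e := by
    intro n _
    apply le_antisymm
    · rw [← hpow n]
      exact h.unif_mono Nat.lt_two_pow_self.le
    · have := h.unif_mono (n := 1) (m := n) (NeZero.pos n)
      rwa [h.unif_one] at this
  have hmix : ∀ t ∈ Ioo (0 : ℝ) 1, S.onType _ (mix t δ δ) = e := by
    intro t ht
    refine IsLogEntropy.eq_of_forall_nat_div (φ := fun t => S.onType _ (mix t δ δ))
      ((h.continuous_onType _).comp (continuous_mix_left δ δ)).continuousOn ?_ ht
    intro k l _ _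
    have : NeZero (k + l) := ⟨by have := NeZero.pos k; omega⟩
    -- Both atoms are replaced by uniform laws of the same entropy, chosen so that the mixture is
    -- itself uniform.
    rw [h.onType_mix_congr _ δ (barycenter : stdSimplex ℝ (Fin k)) δ
      (barycenter : stdSimplex ℝ (Fin l)), ← h.onType_map finSumFinEquiv.injective,
      map_finSumFinEquiv_mix, h.onType_fin, hunif]
    · rw [h.onType_fin, hunif]
    · rw [h.onType_fin, hunif]
  have hall : ∀ (α : Type) [Fintype α] (P : stdSimplex ℝ α), S.onType α P = e := by
    refine law_induction ?_ rfl ?_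
    · intro α β _ _ ι hι P hP
      rw [h.onType_map hι, hP]
    · intro α _ P t ht hP
      rw [h.onType_mix_congr t δ δ P δ rfl hP, hmix t ht]
  obtain ⟨n, m, P, Q, hPQ⟩ := h.nonconstant
  rw [← h.onType_fin, ← h.onType_fin, hall, hall] at hPQ
  exact hPQ rfl

/-- An entropic functional satisfying the axioms is a strictly increasing function of a
logarithmic entropy. -/
theorem exists_isLogEntropy (h : ShannonKhinchin f S) :
    ∃ ℓ : ∀ (α : Type) [Fintype α], stdSimplex ℝ α → ℝ, IsLogEntropy ℓ ∧
      ∀ (α β : Type) [Fintype α] [Fintype β] (P : stdSimplex ℝ α) (Q : stdSimplex ℝ β),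
        ℓ α P < ℓ β Q ↔ S.onType α P < S.onType β Q := by
  have hI := h.intervalMonoid
  have hlt := h.point_lt_unif_two
  have ha : S 2 barycenter ∈ values S := ⟨2, _, rfl⟩
  obtain ⟨L, hLm, hLadd⟩ := hI.exists_orderHom ha hlt
  have hLc : ∀ u ∈ values S, ∀ v ∈ values S, ContinuousOn L (Icc u v) := fun u hu v hv =>
    hI.continuousOn_of_strictMonoOn ha hlt hLm hLadd hu hv
  have hLe : L (S.onType Unit default) = 0 := by
    have := hLadd _ hI.one_mem _ hI.one_mem
    rw [hI.one_op hI.one_mem] at this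
    linarith
  have hL2 : 0 < L (S 2 barycenter) := hLe ▸ hLm hI.one_mem ha hlt
  -- Dividing by `c` sends the fair coin to `log 2`; `eq_mul_log_of_additive` then fixes all uniform
  -- laws.
  set c := L (S 2 barycenter) / Real.log 2 with hc
  have hc0 : 0 < c := div_pos hL2 (Real.log_pos one_lt_two)
  have hunif : ∀ (n : ℕ) [NeZero n], L (S n barycenter) = c * Real.log n := by
    set M : ℕ → ℝ := fun n => if hn : n = 0 then 0 else
      haveI : NeZero n := ⟨hn⟩
      L (S n barycenter) with hM
    have hMn : ∀ (n : ℕ) [hn : NeZero n], M n = L (S n barycenter) := fun n hn => by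
      simp only [hM, dif_neg hn.out]
    intro n hn
    rw [← hMn, hc, ← hMn 2]
    refine eq_mul_log_of_additive ?_ ?_ (NeZero.pos n)
    · intro k l hk hl
      have : NeZero k := ⟨hk.ne'⟩
      have : NeZero l := ⟨hl.ne'⟩
      have : NeZero (k * l) := ⟨(Nat.mul_pos hk hl).ne'⟩
      rw [hMn, hMn, hMn, h.unif_mul, hLadd _ ⟨k, _, rfl⟩ _ ⟨l, _, rfl⟩]
    · intro k l hk hkl
      have : NeZero k := ⟨hk.ne'⟩
      have : NeZero l := ⟨(hk.trans_le hkl).ne'⟩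
      rw [hMn, hMn]
      exact hLm.monotoneOn ⟨k, _, rfl⟩ ⟨l, _, rfl⟩ (h.unif_mono hkl)
  have hord : ∀ (α β : Type) [Fintype α] [Fintype β] (P : stdSimplex ℝ α) (Q : stdSimplex ℝ β),
      L (S.onType α P) / c < L (S.onType β Q) / c ↔ S.onType α P < S.onType β Q :=
    fun α β _ _ P Q => by
      rw [div_lt_div_iff_of_pos_right hc0,
        hLm.lt_iff_lt (onType_mem_values S P) (onType_mem_values S Q)]
  refine ⟨fun α _ P => L (S.onType α P) / c, ?_, hord⟩
  constructor
  · intro α β _ _ ι hι P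
    rw [h.onType_map hι]
  · intro α β _ _ P Q
    rw [h.onType_prodLaw, hLadd _ (onType_mem_values S P) _ (onType_mem_values S Q), add_div]
  · intro α α' β β' _ _ _ _ t P P' Q Q' hP hQ
    have inj : ∀ {x y : ℝ}, x ∈ values S → y ∈ values S → L x / c = L y / c → x = y :=
      fun hx hy hxy => hLm.injOn hx hy ((div_left_inj' hc0.ne').1 hxy)
    rw [h.onType_mix_congr t P P' Q Q' (inj (onType_mem_values S P) (onType_mem_values S P') hP)
      (inj (onType_mem_values S Q) (onType_mem_values S Q') hQ)]
  · intro α _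
    rw [continuous_iff_continuousAt]
    intro P
    have hcomp : IsCompact (range (S.onType α)) := isCompact_range (h.continuous_onType α)
    obtain ⟨_, ⟨P₁, rfl⟩, h1⟩ := hcomp.exists_isLeast ⟨_, P, rfl⟩
    obtain ⟨_, ⟨P₂, rfl⟩, h2⟩ := hcomp.exists_isGreatest ⟨_, P, rfl⟩
    have := (hLc _ (onType_mem_values S P₁) _ (onType_mem_values S P₂)).comp_continuous
      (h.continuous_onType α) fun Q => ⟨h1 ⟨Q, rfl⟩, h2 ⟨Q, rfl⟩⟩
    exact (this.div_const c).continuousAt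
  · intro n _
    rw [h.onType_fin, hunif]
    field_simp

end ShannonKhinchin

open stdSimplex ShannonKhinchin

/-! ### Bounds, continuity and multiplicativity of the Uffink functional -/

namespace stdSimplex

variable {α β : Type} [Fintype α] [Fintype β]

theorem one_le_uff {q : ℝ≥0∞} (P : stdSimplex ℝ α) : 1 ≤ uff q P := by
  by_cases h : q = ∞
  · rw [h, uff_top]
    exact one_le_one_div (iSup_pos P) (iSup_le_one P)
  by_cases h1 : q = 1
  · rw [h1, uff_one]
    exact Real.one_le_exp (Finset.sum_nonneg fun i _ =>
      Real.negMulLog_nonneg (zero_le P i) (le_one P i))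
  rw [uff_of_ne h h1]
  set r := q.toReal
  rcases le_or_gt r 1 with hr | hr
  · refine Real.one_le_rpow ?_ (one_div_nonneg.2 (by linarith))
    rw [← sum_eq_one P]
    exact Finset.sum_le_sum fun i _ =>
      Real.self_le_rpow_of_le_one (zero_le P i) (le_one P i) hr
  · refine Real.one_le_rpow_of_pos_of_le_one_of_nonpos (sum_rpow_pos P) ?_
      (one_div_nonpos.2 (by linarith))
    rw [← sum_eq_one P]
    exact Finset.sum_le_sum fun i _ =>
      Real.rpow_le_self_of_le_one (zero_le P i) (le_one P i) hr.le

theorem card_pos (P : stdSimplex ℝ α) : (0 : ℝ) < Fintype.card α := by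
  have := nonempty_index P
  exact_mod_cast Fintype.card_pos

theorem sum_inv_card_smul (P : stdSimplex ℝ α) :
    ∑ i, (Fintype.card α : ℝ)⁻¹ • P i = (Fintype.card α : ℝ)⁻¹ := by
  rw [← Finset.smul_sum, sum_eq_one, smul_eq_mul, mul_one]

theorem sum_inv_card (P : stdSimplex ℝ α) : ∑ _i : α, (Fintype.card α : ℝ)⁻¹ = 1 := by
  rw [Finset.sum_const, Finset.card_univ, nsmul_eq_mul, mul_inv_cancel₀ (card_pos P).ne']

/-- For finite `q` this is Jensen's inequality with equal weights, for `negMulLog` or the power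
function; for `q = ∞` the average atom is at most the largest. -/
theorem uff_le_card (q : ℝ≥0∞) (P : stdSimplex ℝ α) : uff q P ≤ Fintype.card α := by
  have hN := card_pos P
  set N : ℝ := ((Fintype.card α : ℕ) : ℝ) with hNdef
  have hw : ∀ i ∈ (Finset.univ : Finset α), (0 : ℝ) ≤ N⁻¹ := fun _ _ => (inv_pos.2 hN).le
  have hP : ∀ i ∈ (Finset.univ : Finset α), P i ∈ Ici (0 : ℝ) := fun i _ => zero_le P i
  by_cases h : q = ∞
  · rw [h, uff_top, div_le_iff₀ (iSup_pos P), ← sum_eq_one P, hNdef, ← nsmul_eq_mul,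
      ← Finset.card_univ]
    exact Finset.sum_le_card_nsmul _ _ _ fun i _ => le_iSup_apply P i
  by_cases h1 : q = 1
  · rw [h1, uff_one]
    have := Real.concaveOn_negMulLog.le_map_sum hw (sum_inv_card P) hP
    rw [sum_inv_card_smul, ← Finset.smul_sum, Real.negMulLog, Real.log_inv, smul_eq_mul,
      neg_mul_neg] at this
    rw [← Real.exp_log hN]
    exact Real.exp_le_exp.2 (le_of_mul_le_mul_left this (inv_pos.2 hN))
  rw [uff_of_ne h h1]
  set r := q.toReal with hr
  have hr1 : r ≠ 1 := fun e => h1 (by rw [← ENNReal.ofReal_toReal h, ← hr, e, ENNReal.ofReal_one])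
  have hr1' : 1 - r ≠ 0 := sub_ne_zero.2 hr1.symm
  have hNr : (N ^ (1 - r)) ^ (1 / (1 - r)) = N := by
    rw [← Real.rpow_mul hN.le, mul_one_div_cancel hr1', Real.rpow_one]
  have hNe : N ^ (1 - r) = N * (N⁻¹) ^ r := by
    rw [Real.rpow_sub hN, Real.rpow_one, Real.inv_rpow hN.le, div_eq_mul_inv]
  conv_rhs => rw [← hNr]
  rcases le_or_gt r 1 with hle | hgt
  · refine Real.rpow_le_rpow (sum_rpow_pos P).le ?_ (one_div_nonneg.2 (by linarith))
    have := (Real.concaveOn_rpow ENNReal.toReal_nonneg hle).le_map_sum hw (sum_inv_card P) hP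
    rw [sum_inv_card_smul, ← Finset.smul_sum, smul_eq_mul, inv_mul_le_iff₀ hN] at this
    rwa [hNe]
  · refine Real.rpow_le_rpow_of_nonpos (Real.rpow_pos_of_pos hN _) ?_
      (one_div_nonpos.2 (by linarith))
    have := (convexOn_rpow hgt.le).map_sum_le hw (sum_inv_card P) hP
    rw [sum_inv_card_smul, ← Finset.smul_sum, smul_eq_mul, le_inv_mul_iff₀ hN] at this
    rwa [hNe]

theorem uff_of_uniform (q : ℝ≥0∞) (P : stdSimplex ℝ α)
    (hP : ∀ i, P i = (Fintype.card α : ℝ)⁻¹) : uff q P = Fintype.card α := by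
  have hN := card_pos P
  have := nonempty_index P
  set N : ℝ := ((Fintype.card α : ℕ) : ℝ) with hNdef
  by_cases h : q = ∞
  · rw [h, uff_top]
    simp [hP]
  by_cases h1 : q = 1
  · rw [h1, uff_one]
    simp only [hP, Finset.sum_const, Finset.card_univ, nsmul_eq_mul, Real.negMulLog, Real.log_inv,
      neg_mul_neg, ← hNdef]
    rw [mul_inv_cancel_left₀ hN.ne', Real.exp_log hN]
  rw [uff_of_ne h h1]
  set r := q.toReal with hr
  have hr1 : r ≠ 1 := fun e => h1 (by rw [← ENNReal.ofReal_toReal h, ← hr, e, ENNReal.ofReal_one])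
  have hr1' : 1 - r ≠ 0 := sub_ne_zero.2 hr1.symm
  have hNe : N * (N⁻¹) ^ r = N ^ (1 - r) := by
    rw [Real.rpow_sub hN, Real.rpow_one, Real.inv_rpow hN.le, div_eq_mul_inv]
  simp only [hP, Finset.sum_const, Finset.card_univ, nsmul_eq_mul, ← hNdef]
  rw [hNe, ← Real.rpow_mul hN.le, mul_one_div_cancel hr1', Real.rpow_one]

theorem continuous_uff {q : ℝ≥0∞} : Continuous fun P : stdSimplex ℝ α => uff q P := by
  rcases isEmpty_or_nonempty α with hα | hα
  · rw [continuous_iff_continuousAt]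
    intro P
    exact (not_nonempty_iff.2 hα (nonempty_index P)).elim
  by_cases h : q = ∞
  · have : (fun P : stdSimplex ℝ α => uff q P) = fun P =>
        (Finset.univ.sup' Finset.univ_nonempty fun i => P i)⁻¹ := by
      ext P
      rw [h, uff_top, Finset.sup'_univ_eq_ciSup, one_div]
    rw [this]
    refine Continuous.inv₀ ?_ fun P => ?_
    · exact Continuous.finset_sup'_apply _ fun i _ => continuous_eval i
    · rw [Finset.sup'_univ_eq_ciSup]
      exact (iSup_pos P).ne'
  by_cases h1 : q = 1
  · simp only [h1, uff_one]
    exact Real.continuous_exp.comp (continuous_finsetSum _ fun i _ =>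
      Real.continuous_negMulLog.comp (continuous_eval i))
  simp only [uff_of_ne h h1]
  refine Continuous.rpow_const ?_ fun P => Or.inl (sum_rpow_pos P).ne'
  exact continuous_finsetSum _ fun i _ =>
    (continuous_eval i).rpow_const fun _ => Or.inr ENNReal.toReal_nonneg

theorem uff_prodLaw (q : ℝ≥0∞) (P : stdSimplex ℝ α) (Q : stdSimplex ℝ β) :
    uff q (prodLaw P Q) = uff q P * uff q Q := by
  by_cases h : q = ∞
  · rw [h, uff_top, uff_top, uff_top, div_mul_div_comm, one_mul]
    congr 1
    apply le_antisymm
    · obtain ⟨x, hx⟩ := exists_apply_eq_iSup (prodLaw P Q)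
      rw [← hx, prodLaw_apply]
      exact mul_le_mul (le_iSup_apply P _) (le_iSup_apply Q _) (zero_le Q _) (iSup_pos P).le
    · obtain ⟨a, ha⟩ := exists_apply_eq_iSup P
      obtain ⟨b, hb⟩ := exists_apply_eq_iSup Q
      rw [← ha, ← hb]
      exact le_iSup_apply (prodLaw P Q) (a, b)
  by_cases h1 : q = 1
  · rw [h1, uff_one, uff_one, uff_one, ← Real.exp_add, Fintype.sum_prod_type]
    simp only [prodLaw_apply, Real.negMulLog_mul, Finset.sum_add_distrib, ← Finset.mul_sum,
      ← Finset.sum_mul, sum_eq_one, one_mul]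
  rw [uff_of_ne h h1, uff_of_ne h h1, uff_of_ne h h1,
    ← Real.mul_rpow (sum_rpow_pos P).le (sum_rpow_pos Q).le, Fintype.sum_prod_type]
  simp only [prodLaw_apply, Real.mul_rpow (zero_le P _) (zero_le Q _), ← Finset.mul_sum,
    ← Finset.sum_mul]

end stdSimplex

/-! ### The chain rule -/

/-- The value of `uff q` at a joint law, in terms of the law `Q` of `B` and of the values `u` at
the conditional laws. -/
def combine (q : ℝ≥0∞) {m : ℕ} (Q : stdSimplex ℝ (Fin m)) (u : Fin m → ℝ) : ℝ :=
  if q = ∞ then 1 / (⨆ j, Q j / u j)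
  else if q = 1 then Real.exp (∑ j, (Real.negMulLog (Q j) + Q j * Real.log (u j)))
  else (∑ j, Q j ^ q.toReal * u j ^ (1 - q.toReal)) ^ (1 / (1 - q.toReal))

section ChainRule

variable {n m : ℕ}

theorem apply_eq_zero_of_margB (R : stdSimplex ℝ (Fin n × Fin m)) {j : Fin m}
    (hj : margB R j = 0) (i : Fin n) : R (i, j) = 0 := by
  rw [margB_apply] at hj
  exact (Finset.sum_eq_zero_iff_of_nonneg fun i _ => zero_le R (i, j)).1 hj i (Finset.mem_univ i)

theorem apply_eq_mul_condLaw (R : stdSimplex ℝ (Fin n × Fin m)) {j : Fin m}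
    (hj : 0 < margB R j) (i : Fin n) : R (i, j) = margB R j * condLaw R j hj i :=
  (mul_div_cancel₀ (R (i, j)) hj.ne').symm

theorem toReal_ne_one {q : ℝ≥0∞} (h : q ≠ ∞) (h1 : q ≠ 1) : 1 - q.toReal ≠ 0 := by
  rw [sub_ne_zero]
  intro e
  exact h1 (by rw [← ENNReal.ofReal_toReal h, ← e, ENNReal.ofReal_one])

/-- The atoms factor as `R (i, j) = margB R j * condLaw R j i`, and the sum or maximum over `i` is
taken first. Outcomes of probability zero contribute nothing, so `u` is free there. -/
theorem uff_eq_combine {q : ℝ≥0∞} (hq : 0 < q) (R : stdSimplex ℝ (Fin n × Fin m)) {u : Fin m → ℝ}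
    (hu : ∀ j hj, u j = uff q (condLaw R j hj)) : uff q R = combine q (margB R) u := by
  have hcase : ∀ j, margB R j = 0 ∨ 0 < margB R j := fun j =>
    (zero_le (margB R) j).eq_or_lt.imp Eq.symm id
  unfold combine
  by_cases h : q = ∞
  · subst h
    rw [uff_top, if_pos rfl]
    congr 1
    have := nonempty_index (margB R)
    have hbdd : BddAbove (range fun j => margB R j / u j) := (finite_range _).bddAbove
    apply le_antisymm
    · obtain ⟨⟨i, j⟩, hx⟩ := exists_apply_eq_iSup R
      rcases hcase j with hj | hj
      · have := iSup_pos R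
        rw [← hx, apply_eq_zero_of_margB R hj] at this
        exact (lt_irrefl _ this).elim
      · refine le_trans ?_ (le_ciSup hbdd j)
        rw [← hx, hu j hj, uff_top, div_div_eq_mul_div, div_one, apply_eq_mul_condLaw R hj]
        exact mul_le_mul_of_nonneg_left (le_iSup_apply _ i) hj.le
    · refine ciSup_le fun j => ?_
      rcases hcase j with hj | hj
      · rw [hj, zero_div]
        exact (iSup_pos R).le
      · obtain ⟨i, hi⟩ := exists_apply_eq_iSup (condLaw R j hj)
        rw [hu j hj, uff_top, div_div_eq_mul_div, div_one, ← hi, ← apply_eq_mul_condLaw]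
        exact le_iSup_apply R (i, j)
  by_cases h1 : q = 1
  · subst h1
    rw [uff_one, if_neg h, if_pos rfl, Fintype.sum_prod_type_right]
    congr 1
    refine Finset.sum_congr rfl fun j _ => ?_
    rcases hcase j with hj | hj
    · simp [hj, apply_eq_zero_of_margB R hj]
    · rw [hu j hj, uff_one, Real.log_exp]
      simp only [apply_eq_mul_condLaw R hj, Real.negMulLog_mul, Finset.sum_add_distrib,
        ← Finset.mul_sum, ← Finset.sum_mul, sum_eq_one, one_mul]
  · rw [uff_of_ne h h1, if_neg h, if_neg h1, Fintype.sum_prod_type_right]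
    congr 1
    have hq0 : q.toReal ≠ 0 := (ENNReal.toReal_pos hq.ne' h).ne'
    refine Finset.sum_congr rfl fun j _ => ?_
    rcases hcase j with hj | hj
    · simp [hj, apply_eq_zero_of_margB R hj, Real.zero_rpow hq0]
    · rw [hu j hj, uff_of_ne h h1, ← Real.rpow_mul (sum_rpow_pos _).le,
        one_div_mul_cancel (toReal_ne_one h h1), Real.rpow_one, Finset.mul_sum]
      exact Finset.sum_congr rfl fun i _ => by
        rw [apply_eq_mul_condLaw R hj, Real.mul_rpow hj.le (zero_le _ _)]

theorem combine_lt_combine {q : ℝ≥0∞} (h : q ≠ ∞) (Q : stdSimplex ℝ (Fin m)) {u u' : Fin m → ℝ}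
    (hu : ∀ j, 0 < u j) (hle : ∀ j, 0 < Q j → u j ≤ u' j) (hu' : ∀ j, 0 < u' j)
    (hlt : ∃ j, 0 < Q j ∧ u j < u' j) (hq : 0 < q) : combine q Q u < combine q Q u' := by
  obtain ⟨j₀, hj₀, hlt⟩ := hlt
  have hcase : ∀ j, Q j = 0 ∨ 0 < Q j := fun j => (zero_le Q j).eq_or_lt.imp Eq.symm id
  unfold combine
  rw [if_neg h, if_neg h]
  by_cases h1 : q = 1
  · rw [if_pos h1, if_pos h1, Real.exp_lt_exp]
    refine Finset.sum_lt_sum (fun j _ => ?_) ⟨j₀, Finset.mem_univ _, ?_⟩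
    · rcases hcase j with hj | hj
      · simp [hj]
      · have := mul_le_mul_of_nonneg_left (Real.log_le_log (hu j) (hle j hj)) hj.le
        linarith
    · have := mul_lt_mul_of_pos_left (Real.log_lt_log (hu j₀) hlt) hj₀
      linarith
  rw [if_neg h1, if_neg h1]
  set r := q.toReal
  have hr0 : r ≠ 0 := (ENNReal.toReal_pos hq.ne' h).ne'
  have hpos : ∀ v : Fin m → ℝ, (∀ j, 0 < v j) → 0 < ∑ j, Q j ^ r * v j ^ (1 - r) := fun v hv =>
    Finset.sum_pos' (fun j _ => mul_nonneg (Real.rpow_nonneg (zero_le Q j) _)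
      (Real.rpow_pos_of_pos (hv j) _).le) ⟨j₀, Finset.mem_univ _,
        mul_pos (Real.rpow_pos_of_pos hj₀ _) (Real.rpow_pos_of_pos (hv j₀) _)⟩
  -- The exponents `1 - r` and `1 / (1 - r)` have the same sign, so inner and outer monotonicity
  -- reverse together or not at all.
  rcases lt_or_gt_of_ne (sub_ne_zero.1 (toReal_ne_one h h1)) with hr | hr
  · refine Real.rpow_lt_rpow_of_neg (hpos u' hu') ?_ (one_div_neg.2 (by linarith))
    refine Finset.sum_lt_sum (fun j _ => ?_) ⟨j₀, Finset.mem_univ _, ?_⟩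
    · rcases hcase j with hj | hj
      · simp [hj, Real.zero_rpow hr0]
      · exact mul_le_mul_of_nonneg_left
          (Real.rpow_le_rpow_of_nonpos (hu j) (hle j hj) (by linarith))
          (Real.rpow_pos_of_pos hj _).le
    · exact mul_lt_mul_of_pos_left (Real.rpow_lt_rpow_of_neg (hu j₀) hlt (by linarith))
        (Real.rpow_pos_of_pos hj₀ _)
  · refine Real.rpow_lt_rpow (hpos u hu).le ?_ (one_div_pos.2 (by linarith))
    refine Finset.sum_lt_sum (fun j _ => ?_) ⟨j₀, Finset.mem_univ _, ?_⟩
    · rcases hcase j with hj | hj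
      · simp [hj, Real.zero_rpow hr0]
      · exact mul_le_mul_of_nonneg_left
          (Real.rpow_le_rpow (hu j).le (hle j hj) (by linarith))
          (Real.rpow_pos_of_pos hj _).le
    · exact mul_lt_mul_of_pos_left (Real.rpow_lt_rpow (hu j₀).le hlt (by linarith))
        (Real.rpow_pos_of_pos hj₀ _)

end ChainRule

/-! ### Verification of the axioms, strict decomposability, and the `q`-exponential form -/

theorem uffinkEntropy_joint {q : ℝ≥0∞} (hq : 0 < q) (g : ℝ → ℝ) {n m : ℕ}
    (R : stdSimplex ℝ (Fin n × Fin m)) : (uffinkEntropy q g).joint R = g (uff q R) := by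
  rw [← uff_map_of_injective hq finProdFinEquiv.injective R]
  rfl

theorem coord_apply_of_strictMonoOn {g : ℝ → ℝ} (hg : StrictMonoOn g (Ici 0)) {x : ℝ}
    (hx : 0 ≤ x) : coord g (g x) = x :=
  hg.injOn.leftInvOn_invFunOn hx

theorem knMul_apply {g : ℝ → ℝ} (hg : StrictMonoOn g (Ici 0)) {x y : ℝ} (hx : 0 ≤ x)
    (hy : 0 ≤ y) : knMul g (g x) (g y) = g (x * y) := by
  change g (coord g (g x) * coord g (g y)) = _
  rw [coord_apply_of_strictMonoOn hg hx, coord_apply_of_strictMonoOn hg hy]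

theorem shannonKhinchin_uffinkEntropy {q : ℝ≥0∞} {g : ℝ → ℝ} (hq : 0 < q)
    (hg : StrictMonoOn g (Ici 0)) (hgc : ContinuousOn g (Ici 1)) :
    ShannonKhinchin g (uffinkEntropy q g) where
  injOn := hg.injOn
  symmetric n σ P := congrArg g (uff_map_of_injective hq σ.injective P)
  nonconstant := by
    refine ⟨1, 2, barycenter, barycenter, fun he => ?_⟩
    have h1 : uffinkEntropy q g 1 barycenter = g 1 :=
      congrArg g ((uff_of_uniform q _ fun i => rfl).trans (by simp))
    have h2 : uffinkEntropy q g 2 barycenter = g 2 :=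
      congrArg g ((uff_of_uniform q _ fun i => rfl).trans (by simp))
    rw [h1, h2] at he
    have := hg.injOn (by simp) (by simp) he
    norm_num at this
  continuous n := hgc.comp_continuous continuous_uff fun P => one_le_uff P
  maximal n P U hU := by
    refine hg.monotoneOn (uff_pos q P).le (uff_pos q U).le ?_
    refine (uff_le_card q P).trans (uff_of_uniform q U fun i => ?_).ge
    rw [hU, Fintype.card_fin, one_div]
  expandable n P P' hP _ := by
    rw [← map_eq_of_injective (Fin.castSucc_injective n) (P := P) (Q := P') hP]
    exact congrArg g (uff_map_of_injective hq (Fin.castSucc_injective n) P)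
  composable := by
    -- The conditional entropy is `g` of the quotient of the two Uffink values; by the chain rule it
    -- is a function of the law of `B` and the conditional entropies. The default `1` at null
    -- outcomes has no effect.
    refine ⟨fun n P => ⟨_, (uff_pos q P).le, rfl⟩,
      fun n m R => g (uff q R / uff q (margB R)), fun n m R =>
        ⟨_, div_nonneg (uff_pos q R).le (uff_pos q _).le, rfl⟩, fun n m R => ?_,
      fun n m R hR => ?_, fun m Q v => g (combine q Q
        (fun j => if h : 0 < Q j then coord g (v ⟨j, h⟩) else 1) / uff q Q), fun n m R => ?_⟩
    · rw [uffinkEntropy_joint hq]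
      change _ = knMul g _ (g (uff q (margB R)))
      rw [knMul_apply hg (div_nonneg (uff_pos q R).le (uff_pos q _).le) (uff_pos q _).le,
        div_mul_cancel₀ _ (uff_pos q _).ne']
    · rw [uffinkEntropy_joint hq]
      change _ = knMul g (g (uff q (margA R))) (g (uff q (margB R)))
      rw [knMul_apply hg (uff_pos q _).le (uff_pos q _).le, ← uff_prodLaw]
      congr 2
      ext x
      exact hR x.1 x.2
    · beta_reduce
      rw [uff_eq_combine hq R (u := fun j => if h : 0 < margB R j then
        coord g (uffinkEntropy q g n (condLaw R j h)) else 1)]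
      intro j hj
      rw [dif_pos hj]
      exact coord_apply_of_strictMonoOn hg (uff_pos q _).le

theorem strictlyDecomposable_uffinkEntropy {q : ℝ≥0∞} {g : ℝ → ℝ} (hq : 0 < q)
    (hg : StrictMonoOn g (Ici 0)) (htop : q ≠ ∞) : StrictlyDecomposable (uffinkEntropy q g) := by
  intro n m R R' hB hle hlt
  rw [uffinkEntropy_joint hq, uffinkEntropy_joint hq]
  refine hg (uff_pos q R).le (uff_pos q R').le ?_
  have hle' : ∀ j h h', uff q (condLaw R j h) ≤ uff q (condLaw R' j h') := fun j h h' =>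
    (hg.le_iff_le (uff_pos q _).le (uff_pos q _).le).1 (hle j h h')
  have hlt' : ∃ j h h', uff q (condLaw R j h) < uff q (condLaw R' j h') := by
    obtain ⟨j, h, h', hj⟩ := hlt
    exact ⟨j, h, h', (hg.lt_iff_lt (uff_pos q _).le (uff_pos q _).le).1 hj⟩
  set u : Fin m → ℝ := fun j => if h : 0 < margB R j then uff q (condLaw R j h) else 1 with hu
  set u' : Fin m → ℝ := fun j => if h : 0 < margB R' j then uff q (condLaw R' j h) else 1 with hu'
  have e : ∀ j h, u j = uff q (condLaw R j h) := fun j h => dif_pos h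
  have e' : ∀ j h, u' j = uff q (condLaw R' j h) := fun j h => dif_pos h
  rw [uff_eq_combine hq R e, uff_eq_combine hq R' e', ← hB]
  refine combine_lt_combine htop (margB R) (fun j => ?_) (fun j hj => ?_) (fun j => ?_) ?_ hq
  · simp only [hu]
    split_ifs
    exacts [uff_pos q _, one_pos]
  · rw [e j hj, e' j (hB ▸ hj)]
    exact hle' _ _ _
  · simp only [hu']
    split_ifs
    exacts [uff_pos q _, one_pos]
  · obtain ⟨j, h, h', hj⟩ := hlt'
    exact ⟨j, h, by rwa [e j h, e' j h']⟩

/-- Given the first outcome of `B`, of probability `3 / 4`, let `A` be deterministic. This atom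
exceeds all the remaining mass, so spreading the other conditional law raises its entropy without
changing the joint maximum. -/
theorem not_strictlyDecomposable_top {g : ℝ → ℝ} (hg : StrictMonoOn g (Ici 0)) :
    ¬ StrictlyDecomposable (uffinkEntropy ∞ g) := by
  intro hS
  have hinj : Function.Injective fun _ : Unit => (0 : Fin 2) :=
    Function.injective_of_subsingleton _
  set D : stdSimplex ℝ (Fin 2) := stdSimplex.map (fun _ : Unit => (0 : Fin 2)) default with hD
  set U : stdSimplex ℝ (Fin 2) := barycenter
  have hDs : ⨆ i, D i = 1 := by rw [hD, iSup_map_of_injective hinj]; simp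
  have hclamp : clamp (3 / 4 : ℝ) = 3 / 4 := clamp_of_mem (by norm_num)
  have hjoint : ∀ Q : stdSimplex ℝ (Fin 2),
      (uffinkEntropy ∞ g).joint (mixJoint (3 / 4) D Q) = g (1 / (3 / 4)) := by
    intro Q
    rw [uffinkEntropy_joint ENNReal.zero_lt_top, ← map_tag_mix,
      uff_map_of_injective ENNReal.zero_lt_top (tag_injective 2), uff_top,
      iSup_mix (by norm_num), hDs, max_eq_left]
    · norm_num
    · have := iSup_le_one Q
      linarith
  have hb0 : ∀ Q, 0 < margB (mixJoint (3 / 4) D Q) 0 := fun Q => by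
    rw [margB_mixJoint_zero, hclamp]; norm_num
  have hb1 : ∀ Q, 0 < margB (mixJoint (3 / 4) D Q) 1 := fun Q => by
    rw [margB_mixJoint_one, hclamp]; norm_num
  have hDU : uffinkEntropy ∞ g 2 D < uffinkEntropy ∞ g 2 U := by
    refine hg (uff_pos ∞ D).le (uff_pos ∞ U).le ?_
    change uff ∞ D < uff ∞ U
    rw [uff_of_uniform ∞ U fun i => rfl, uff_top, hDs]
    norm_num
  have key : ∀ j h h', uffinkEntropy ∞ g 2 (condLaw (mixJoint (3 / 4) D D) j h) ≤
      uffinkEntropy ∞ g 2 (condLaw (mixJoint (3 / 4) D U) j h') := by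
    intro j h h'
    fin_cases j
    · exact ((congrArg _ (condLaw_mixJoint_zero _ _ _ _)).trans
        (congrArg _ (condLaw_mixJoint_zero _ _ _ _)).symm).le
    · exact (congrArg _ (condLaw_mixJoint_one _ _ _ _)).trans_le
        (hDU.le.trans_eq (congrArg _ (condLaw_mixJoint_one _ _ _ _)).symm)
  have := hS 2 2 (mixJoint (3 / 4) D D) (mixJoint (3 / 4) D U) ?_ key
    ⟨1, hb1 D, hb1 U, by rwa [condLaw_mixJoint_one, condLaw_mixJoint_one]⟩
  · rw [hjoint, hjoint] at this
    exact lt_irrefl _ this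
  · ext j
    fin_cases j
    · exact (margB_mixJoint_zero _ _ _).trans (margB_mixJoint_zero _ _ _).symm
    · exact (margB_mixJoint_one _ _ _).trans (margB_mixJoint_one _ _ _).symm

/-- For `q ≠ 1` each term satisfies `p ^ q = p + (1 - q) * (p * logq q (1 / p))`; summing gives the
base of the power in `expq`. -/
theorem uffink_eq_expq {q : ℝ} (hq : 0 < q) {n : ℕ} (P : stdSimplex ℝ (Fin n)) :
    uffink (ENNReal.ofReal q) P = expq q (∑ i, P i * logq q (1 / P i)) := by
  rw [uffink_eq_uff]
  unfold expq logq
  by_cases h1 : q = 1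
  · subst h1
    rw [ENNReal.ofReal_one, uff_one, if_pos rfl]
    simp only [if_true, one_div, Real.log_inv, Real.negMulLog, neg_mul, mul_neg]
  · have hq1 : 1 - q ≠ 0 := sub_ne_zero.2 (Ne.symm h1)
    rw [uff_of_ne ENNReal.ofReal_ne_top (by simpa [ENNReal.ofReal_eq_one] using h1), if_neg h1,
      ENNReal.toReal_ofReal hq.le]
    congr 1
    have : ∀ i, P i ^ q = P i + (1 - q) * (P i * (((1 / P i) ^ (1 - q) - 1) / (1 - q))) := by
      intro i
      have e : P i ^ q = P i * (1 / P i) ^ (1 - q) := by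
        rcases (zero_le P i).eq_or_lt with h0 | h0
        · rw [← h0, Real.zero_rpow hq.ne', zero_mul]
        · rw [one_div, Real.inv_rpow h0.le, Real.rpow_sub h0, Real.rpow_one]
          field_simp
      rw [e]
      field_simp
      ring
    simp only [if_neg h1]
    rw [Finset.sum_congr rfl fun i _ => this i, Finset.sum_add_distrib, sum_eq_one,
      ← Finset.mul_sum]

/-! ### Reconstruction of `g` -/

/-- The function `g` on `[1, ∞)` read off from the values at laws, continued below `1` as a
translate of the identity. -/
def profile (q : ℝ≥0∞) (S : EntropicFunctional) (v : ℝ) : ℝ :=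
  open Classical in
  if h : ∃ (n : ℕ) (P : stdSimplex ℝ (Fin n)), uff q P = v then S _ h.choose_spec.choose
  else S.onType Unit default + v - 1

theorem uff_default {q : ℝ≥0∞} : uff q (default : stdSimplex ℝ Unit) = 1 :=
  le_antisymm ((uff_le_card q _).trans (by simp)) (one_le_uff _)

namespace ShannonKhinchin

variable {f : ℝ → ℝ} {S : EntropicFunctional} {q : ℝ≥0∞}

theorem exists_onType_lt_iff_uff_lt (h : ShannonKhinchin f S) : ∃ q : ℝ≥0∞, 0 < q ∧
    (∀ (α β : Type) [Fintype α] [Fintype β] (P : stdSimplex ℝ α) (Q : stdSimplex ℝ β),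
      S.onType α P < S.onType β Q ↔ uff q P < uff q Q) ∧
    ∀ (n : ℕ) [NeZero n], Icc 1 (n : ℝ) ⊆ range fun P : stdSimplex ℝ (Fin n) => uff q P := by
  obtain ⟨ℓ, hℓ, hS⟩ := h.exists_isLogEntropy
  obtain ⟨q, hq, hexp⟩ := hℓ.exists_exp_eq_uff
  refine ⟨q, hq, fun α β _ _ P Q => ?_, fun n _ v hv => ?_⟩
  · rw [← hS, ← hexp, ← hexp, Real.exp_lt_exp]
  · have hv0 : 0 < v := one_pos.trans_le hv.1
    obtain ⟨P, hP⟩ := hℓ.Icc_subset_range n ⟨Real.log_nonneg hv.1, Real.log_le_log hv0 hv.2⟩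
    exact ⟨P, by beta_reduce; rw [← hexp, hP, Real.exp_log hv0]⟩

/-- As `S` and `uff q` order laws alike, `S` factors through `uff q` by an increasing function on
`[1, ∞)`, continuous by compactness of the simplices. The two products agree because both give the
value of `S` at a product law. -/
theorem exists_eq_uffinkEntropy (h : ShannonKhinchin f S) : ∃ (q : ℝ≥0∞) (g : ℝ → ℝ), 0 < q ∧
    StrictMonoOn g (Ici 0) ∧ ContinuousOn g (Ici 0) ∧ S = uffinkEntropy q g ∧
    ∀ (n m : ℕ) (P : stdSimplex ℝ (Fin n)) (Q : stdSimplex ℝ (Fin m)),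
      knMul f (S n P) (S m Q) = knMul g (S n P) (S m Q) := by
  obtain ⟨q, hq, hlt, hrange⟩ := h.exists_onType_lt_iff_uff_lt
  set e := S.onType Unit default with he
  set g := profile q S with hg
  have hex : ∀ v : ℝ, 1 ≤ v → ∃ (n : ℕ) (P : stdSimplex ℝ (Fin n)), uff q P = v := by
    intro v hv
    obtain ⟨n, hn⟩ := exists_nat_ge v
    have : NeZero n := ⟨by rintro rfl; norm_num at hn; linarith⟩
    obtain ⟨P, hP⟩ := hrange n ⟨hv, hn⟩
    exact ⟨n, P, hP⟩
  have hgu : ∀ (α : Type) [Fintype α] (P : stdSimplex ℝ α), g (uff q P) = S.onType α P := by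
    intro α _ P
    have hP := hex _ (one_le_uff (q := q) P)
    have hspec := hP.choose_spec.choose_spec
    rw [hg, profile, dif_pos hP, ← h.onType_fin]
    apply le_antisymm <;> rw [← not_lt, hlt, hspec] <;> exact lt_irrefl _
  have hg1 : g 1 = e := by rw [← uff_default (q := q), hgu]
  have hlow : ∀ v, v ≤ 1 → g v = e + v - 1 := by
    intro v hv
    rcases hv.eq_or_lt with rfl | hv
    · rw [hg1]; ring
    · rw [hg, profile, dif_neg]
      rintro ⟨n, P, rfl⟩
      exact (one_le_uff P).not_gt hv
  have hhigh : StrictMonoOn g (Ici 1) := by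
    intro v hv w hw hvw
    obtain ⟨n, P, rfl⟩ := hex v hv
    obtain ⟨m, Q, rfl⟩ := hex w hw
    rwa [hgu, hgu, hlt]
  have hmono : StrictMonoOn g (Ici 0) := by
    have : StrictMonoOn g (Iic 1 ∪ Ici 1) := by
      refine StrictMonoOn.union (c := 1) (fun v hv w hw hvw => ?_) hhigh isGreatest_Iic isLeast_Ici
      rw [hlow v hv, hlow w hw]
      linarith
    exact this.mono fun v _ => le_total v 1
  have hchigh : ContinuousOn g (Ici 1) := by
    intro v hv
    obtain ⟨n, hn⟩ := exists_nat_gt v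
    have hn0 : NeZero n := ⟨by rintro rfl; norm_num at hn; linarith [mem_Ici.1 hv]⟩
    have hc : ContinuousOn g (range fun P : stdSimplex ℝ (Fin n) => uff q P) := by
      refine continuousOn_range_of_comp continuous_uff ?_
      convert h.continuous_onType (Fin n) using 1
      exact funext fun P => hgu _ P
    refine ((hc.mono (hrange n)) v ⟨hv, hn.le⟩).mono_of_mem_nhdsWithin ?_
    exact mem_of_superset (inter_mem_nhdsWithin _ (Iio_mem_nhds hn)) fun x hx => ⟨hx.1, hx.2.le⟩
  have hcont : Continuous g := by
    rw [← continuousOn_univ, ← Iic_union_Ici (a := (1 : ℝ))]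
    refine ContinuousOn.union_of_isClosed ?_ hchigh isClosed_Iic isClosed_Ici
    exact ContinuousOn.congr (f := fun v => e + v - 1) (by fun_prop) hlow
  refine ⟨q, g, hq, hmono, hcont.continuousOn, ?_, fun n m P Q => ?_⟩
  · funext n P
    rw [← h.onType_fin, ← hgu]
    rfl
  · rw [← h.onType_fin, ← h.onType_fin, ← h.onType_prodLaw, ← hgu, ← hgu, ← hgu, uff_prodLaw,
      knMul_apply hmono (uff_pos q P).le (uff_pos q Q).le]

end ShannonKhinchin

theorem theorem1 :
    -- every solution of the axioms is of the form `S_q^g`, with the same generalized product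
    (∀ (f : ℝ → ℝ) (S : EntropicFunctional), ShannonKhinchin f S →
      ∃ (q : ℝ≥0∞) (g : ℝ → ℝ), 0 < q ∧ StrictMonoOn g (Ici 0) ∧ ContinuousOn g (Ici 0) ∧
        S = uffinkEntropy q g ∧
        ∀ (n m : ℕ) (P : stdSimplex ℝ (Fin n)) (Q : stdSimplex ℝ (Fin m)),
          knMul f (S n P) (S m Q) = knMul g (S n P) (S m Q)) ∧
    -- every functional of this form is a solution
    (∀ (q : ℝ≥0∞) (g : ℝ → ℝ), 0 < q → StrictMonoOn g (Ici 0) → ContinuousOn g (Ici 1) →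
      ShannonKhinchin g (uffinkEntropy q g)) ∧
    -- the strictly decomposable ones are those with finite `q`
    (∀ (q : ℝ≥0∞) (g : ℝ → ℝ), 0 < q → StrictMonoOn g (Ici 0) →
      (StrictlyDecomposable (uffinkEntropy q g) ↔ q ≠ ∞)) ∧
    -- the equivalent form in terms of the `q`-exponential and the `q`-logarithm
    (∀ (q : ℝ) (g : ℝ → ℝ), 0 < q → ∀ (n : ℕ) (P : stdSimplex ℝ (Fin n)),
      uffinkEntropy (ENNReal.ofReal q) g n P =
        g (expq q (∑ i, P i * logq q (1 / P i)))) := by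
  refine ⟨fun f S h => h.exists_eq_uffinkEntropy,
    fun q g hq hg hgc => shannonKhinchin_uffinkEntropy hq hg hgc, fun q g hq hg => ⟨?_, ?_⟩,
    fun q g hq n P => congrArg g (uffink_eq_expq hq P)⟩
  · rintro hS rfl
    exact not_strictlyDecomposable_top hg hS
  · exact strictlyDecomposable_uffinkEntropy hq hg

end
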